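/- Throughout, surfaces are compact and connected, and their boundary is a finite disjoint union of circles. For a surface $S$, let $\chi(S)$ be its Euler characteristic, $\beta(S)$ the number of connected components of its boundary, and $\overline{S}$ the closed surface obtained from $S$ by gluing a disc along each boundary component. A map on a surface is a decomposition of it into finitely many vertices ($0$-cells), edges ($1$-cells) and faces ($2$-cells). The degree of a vertex is the number of edge-ends at it, the degree of a face is the number of edge-sides along it, and a leaf is a vertex of degree $1$. A map is triangular if every face has degree $3$ (loops and multiple edges are allowed). A rooted map is a map with a distinguished end and a distinguished side of one of its edges, the root-edge; the vertex at the distinguished end is the root-vertex. Rooted maps are considered up to cell-preserving homeomorphisms that preserve the root. A rooted map is boundary-rooted if its root-edge lies on the boundary of the surface, and leaf-rooted if its root-vertex is a leaf. A cubic scheme of a surface $S$ with boundary is a leaf-rooted map on $\overline{S}$ with $\beta(S)$ faces in which every vertex other than the root-vertex has degree $3$. **Theorem.** Let $S$ be a surface with (non-empty) boundary, other than the disc. Let $a(S)$ be the number of cubic schemes of $S$ and, for $n \in \mathbb{N}$, let $M_S(n)$ be the number of boundary-rooted triangular maps on $S$ with $n$ vertices, all of them lying on the boundary of $S$. These numbers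 are finite, and, as $n \to \infty$, $$M_S(n) = \frac{a(S)}{4\,\Gamma\left(1-\tfrac{3\chi(S)}{2}\right)}\; n^{-3\chi(S)/2}\; 4^n \left(1+O\left(n^{-1/2}\right)\right),$$ where $\Gamma$ is the usual Gamma function and the constant implied by $O$ may depend on $S$. -/

import Mathlib

open Filter Asymptotics

/-- A closed (compact, connected, boundaryless) surface up to homeomorphism: the sphere with
`g ≥ 0` handles, or the sphere with `k ≥ 1` cross-caps. -/
inductive ClosedSurface : Type
  | handles (g : ℕ) : ClosedSurface
  | crosscaps (k : ℕ+) : ClosedSurface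

/-- A compact connected surface up to homeomorphism: a closed surface from which `β` disjoint
open discs have been removed. -/
structure Surface : Type where
  /-- the closed surface obtained by gluing a disc on each boundary circle -/
  capped : ClosedSurface
  /-- the number of boundary circles -/
  β : ℕ

namespace ClosedSurface

/-- Euler characteristic: `2 - 2g` with `g` handles, `2 - k` with `k` cross-caps. -/
def eulerChar : ClosedSurface → ℤ
  | handles g => 2 - 2 * (g : ℤ)
  | crosscaps k => 2 - ((k : ℕ) : ℤ)

/-- The surfaces made with handles are the orientable ones. -/
def IsOrientable : ClosedSurface → Prop
  | handles _ => True
  | crosscaps _ => False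

end ClosedSurface

namespace Surface

/-- Removing a disc lowers the Euler characteristic by one. -/
def eulerChar (S : Surface) : ℤ := S.capped.eulerChar - (S.β : ℤ)

/-- Orientability. -/
def IsOrientable (S : Surface) : Prop := S.capped.IsOrientable

/-- The surface without boundary obtained by gluing a disc along every boundary circle. -/
def closure (S : Surface) : Surface := ⟨S.capped, 0⟩

/-- The disc: the sphere minus one disc. -/
def disc : Surface := ⟨ClosedSurface.handles 0, 1⟩

end Surface

/-- A cell decomposition (with at least one edge) of a surface, possibly with boundary, up to
cell-preserving homeomorphism, as a combinatorial map. A flag is a pair made of an end and a side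
of the same edge; so an inner edge has four flags and a boundary edge, which has a single side,
has two.
* `endFlip` exchanges the two ends of the edge and keeps the side;
* `sideFlip` keeps the end and goes to the other side of the edge; it fixes exactly the flags of
  the edges that lie on the boundary of the surface;
* `cornerFlip` goes to the other flag that bounds the same corner (of a face, at a vertex). -/
structure CombMap (F : Type*) where
  endFlip : Equiv.Perm F
  cornerFlip : Equiv.Perm F
  sideFlip : Equiv.Perm F
  endFlip_endFlip : ∀ x, endFlip (endFlip x) = x
  cornerFlip_cornerFlip : ∀ x, cornerFlip (cornerFlip x) = x
  sideFlip_sideFlip : ∀ x, sideFlip (sideFlip x) = x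
  endFlip_sideFlip : ∀ x, endFlip (sideFlip x) = sideFlip (endFlip x)
  endFlip_ne : ∀ x, endFlip x ≠ x
  cornerFlip_ne : ∀ x, cornerFlip x ≠ x
  endFlip_ne_sideFlip : ∀ x, endFlip x ≠ sideFlip x

namespace CombMap

variable {F : Type*} (M : CombMap F)

/-- The vertex of a flag, as the set of all the flags at this vertex. -/
def vertex (x : F) : Set F := MulAction.orbit (Subgroup.closure {M.cornerFlip, M.sideFlip}) x

/-- The edge of a flag, as the set of all the flags of this edge. -/
def edge (x : F) : Set F := MulAction.orbit (Subgroup.closure {M.endFlip, M.sideFlip}) x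

/-- The face of a flag, as the set of all the flags in this face. -/
def face (x : F) : Set F := MulAction.orbit (Subgroup.closure {M.endFlip, M.cornerFlip}) x

/-- The edge-end of a flag, as the set of the (one or two) flags that share it. -/
def edgeEnd (x : F) : Set F := {x, M.sideFlip x}

/-- The edge-side of a flag, as the set of the two flags that share it. -/
def edgeSide (x : F) : Set F := {x, M.endFlip x}

/-- The degree of the vertex of `x`: the number of edge-ends at it (a loop counts twice). -/
noncomputable def vertexDegree (x : F) : ℕ := (M.edgeEnd '' M.vertex x).ncard

/-- The degree of the face of `x`: the number of edge-sides along it (an edge both of whose sides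
are incident to the face counts twice). -/
noncomputable def faceDegree (x : F) : ℕ := (M.edgeSide '' M.face x).ncard

/-- The number of vertices. -/
noncomputable def numVertices : ℕ := (Set.range M.vertex).ncard

/-- The number of edges. -/
noncomputable def numEdges : ℕ := (Set.range M.edge).ncard

/-- The number of faces. -/
noncomputable def numFaces : ℕ := (Set.range M.face).ncard

/-- The flag belongs to an edge on the boundary of the surface. -/
def OnBoundary (x : F) : Prop := M.sideFlip x = x

/-- The number of connected components of the boundary: boundary edges that share a vertex lie
on the same component, and `Quot` takes the generated equivalence relation. -/
noncomputable def numBoundaries : ℕ :=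
  Nat.card (Quot fun x y : {x : F // M.OnBoundary x} =>
    (y : F) ∈ M.edge (x : F) ∨ (y : F) ∈ M.vertex (x : F))

/-- `v - e + f`. -/
noncomputable def eulerChar : ℤ :=
  (M.numVertices : ℤ) - (M.numEdges : ℤ) + (M.numFaces : ℤ)

/-- The underlying surface is connected. -/
def IsConnected : Prop :=
  ∀ x y : F, y ∈ MulAction.orbit (Subgroup.closure {M.endFlip, M.cornerFlip, M.sideFlip}) x

/-- The underlying surface is orientable: the flags can be given signs so that any two distinct
neighbouring flags have opposite signs. -/
def IsOrientable : Prop :=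
  ∃ c : F → Bool, ∀ x, c (M.endFlip x) ≠ c x ∧ c (M.cornerFlip x) ≠ c x ∧
    (M.sideFlip x ≠ x → c (M.sideFlip x) ≠ c x)

/-- `M` is a map on the surface `S`. By the classification of surfaces, a compact connected
surface is determined by its Euler characteristic, its number of boundary components and its
orientability. -/
def IsMapOn (S : Surface) : Prop :=
  M.IsConnected ∧ M.eulerChar = S.eulerChar ∧ M.numBoundaries = S.β ∧
    (M.IsOrientable ↔ S.IsOrientable)

/-- Every face has degree three. -/
def IsTriangular : Prop := ∀ x, M.faceDegree x = 3

/-- Every vertex lies on the boundary of the surface. -/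
def AllVerticesOnBoundary : Prop := ∀ x, ∃ y ∈ M.vertex x, M.OnBoundary y

end CombMap

/-- A finite map with a root, that is, a distinguished end and side of an edge. -/
structure RootedMap : Type where
  numFlags : ℕ
  toMap : CombMap (Fin numFlags)
  root : Fin numFlags

namespace RootedMap

/-- Isomorphism of rooted maps: a bijection of the flags that respects all the incidences and the
root. It expresses the cell-preserving homeomorphisms that preserve the root-end and root-side. -/
def Iso (R R' : RootedMap) : Prop :=
  ∃ φ : Fin R.numFlags ≃ Fin R'.numFlags,
    (∀ x, φ (R.toMap.endFlip x) = R'.toMap.endFlip (φ x)) ∧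
    (∀ x, φ (R.toMap.cornerFlip x) = R'.toMap.cornerFlip (φ x)) ∧
    (∀ x, φ (R.toMap.sideFlip x) = R'.toMap.sideFlip (φ x)) ∧
    φ R.root = R'.root

theorem Iso.refl (R : RootedMap) : Iso R R :=
  ⟨Equiv.refl _, fun _ => rfl, fun _ => rfl, fun _ => rfl, rfl⟩

theorem Iso.symm {R R' : RootedMap} : Iso R R' → Iso R' R := by
  rintro ⟨φ, h0, h1, h2, hr⟩
  refine ⟨φ.symm, fun x => ?_, fun x => ?_, fun x => ?_, ?_⟩
  · rw [Equiv.symm_apply_eq, h0, Equiv.apply_symm_apply]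
  · rw [Equiv.symm_apply_eq, h1, Equiv.apply_symm_apply]
  · rw [Equiv.symm_apply_eq, h2, Equiv.apply_symm_apply]
  · rw [Equiv.symm_apply_eq, hr]

theorem Iso.trans {R R' R'' : RootedMap} : Iso R R' → Iso R' R'' → Iso R R'' := by
  rintro ⟨φ, h0, h1, h2, hr⟩ ⟨ψ, k0, k1, k2, kr⟩
  refine ⟨φ.trans ψ, fun x => ?_, fun x => ?_, fun x => ?_, ?_⟩
  · simp [h0, k0]
  · simp [h1, k1]
  · simp [h2, k2]
  · simp [hr, kr]

/-- Rooted maps are considered up to isomorphism. -/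
instance setoid : Setoid RootedMap := ⟨Iso, Iso.refl, Iso.symm, Iso.trans⟩

/-- The root-edge lies on the boundary of the surface. -/
def IsBoundaryRooted (R : RootedMap) : Prop := R.toMap.OnBoundary R.root

/-- The root-vertex is a leaf, that is, has degree one. -/
def IsLeafRooted (R : RootedMap) : Prop := R.toMap.vertexDegree R.root = 1

/-- Every vertex other than the root-vertex has degree three. -/
def IsCubicExceptRoot (R : RootedMap) : Prop :=
  ∀ x, x ∉ R.toMap.vertex R.root → R.toMap.vertexDegree x = 3

end RootedMap

/-- The boundary-rooted triangular maps on `S` having `n` vertices, all of them lying on the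
boundary (up to isomorphism of rooted maps). -/
def triangularMaps (S : Surface) (n : ℕ) : Set (Quotient RootedMap.setoid) :=
  {q | ∃ R : RootedMap, ⟦R⟧ = q ∧ R.toMap.IsMapOn S ∧ R.IsBoundaryRooted ∧
    R.toMap.IsTriangular ∧ R.toMap.AllVerticesOnBoundary ∧ R.toMap.numVertices = n}

/-- The cubic schemes of `S`: the leaf-rooted maps on the closed surface obtained by gluing a disc
along each of the `β` boundary circles of `S`, with `β` faces and all of whose non-root vertices
have degree three (up to isomorphism of rooted maps). -/
def cubicSchemes (S : Surface) : Set (Quotient RootedMap.setoid) :=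
  {q | ∃ R : RootedMap, ⟦R⟧ = q ∧ R.toMap.IsMapOn S.closure ∧ R.IsLeafRooted ∧
    R.IsCubicExceptRoot ∧ R.toMap.numFaces = S.β}

/-! Duality turns the problem into one on cubic maps. In a triangular map whose vertices all lie on
the boundary, put a vertex in each triangle, join neighbouring triangles, and end the edge dual to
each boundary edge at a new leaf. The resulting map has vertices of degree one or three only. A dual
face follows one boundary component, so the dual lives on the capped surface, has `β` faces, and
every face contains a leaf. Each boundary vertex sees exactly two boundary flags, so `n` vertices
give `n` leaves. The root becomes a flag at a leaf. Conversely, every such leafy cubic map is a dual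
(`isTriangularMap_iff_dual`, `exists_pointedIso_dual`, `exists_bijOn_triangularMaps`).

Drop first the condition that every face has a leaf, and let `N(n)` be the number of leafy cubic
maps with `n` leaves. Euler's formula gives each of them `8n - 12χ` flags. A leaf can be attached at
any flag, and conversely any leaf other than the root can be removed. The root leaves no
automorphism, so counting pairs (map, flag) against pairs (larger map, non-root leaf flag) gives
exactly `2n N(n+1) = (8n - 12χ) N(n)` (`sum_leafyClasses_succ`). Hence `N(n) = N(1) 4^(n-1) Γ(n+s) /
(Γ(1+s) Γ(n))` with `s = -3χ/2`. The maps counted by `N(1)` are the cubic schemes, and `Γ(n+s) /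
Γ(n)` is asymptotic to `n^s`.

It remains to see that a leafless face is rare: a proportion `O(n^(-1/2))` of the maps has one.
Weight each leafless face by `y^h`, where `h` is the number of its sides that face another face.
Averaged over the position of a new leaf, the total weight at `y` is at most the weight of the
smaller maps at a smaller `y` (`sum_addLeaf_leaflessWeight_le`). The successive values of `y`
follow, up to a one-sided error, the curve `y = 2 / (1 + √(T/G))`, where `G` is the number of flags
(`weight_step`). Going from `y = 1` at `n` leaves down to one leaf leaves `y = O(n^(-1/2))`. There
each face weighs at most `y`, because a leafless face has an outer side, and there are `β` faces.

In the combinatorial encoding, the condition `(cornerFlip ∘ sideFlip)^3 = 1` says that degrees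
divide three. It thus allows leaves and cubic vertices at once. -/

/-! ### Orbits of groups generated by involutions. -/

section Orbits

variable {F : Type*}

/-- The generators are their own inverses, so an orbit is what is reached by applying generators
alone. This gives induction over vertices, faces and connected components. -/
theorem mem_orbit_closure_iff {s : Set (Equiv.Perm F)} (hs : ∀ g ∈ s, ∀ z, g (g z) = z) {x y : F} :
    y ∈ MulAction.orbit (Subgroup.closure s) x ↔
      ∀ p : F → Prop, p x → (∀ z, p z → ∀ g ∈ s, p (g z)) → p y := by
  constructor
  · rintro ⟨⟨g, hg⟩, rfl⟩ p hx hp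
    have key : ∀ z, p z → p (g z) := by
      induction hg using Subgroup.closure_induction with
      | mem g hg => exact fun z hz => hp z hz g hg
      | one => exact fun z hz => hz
      | mul a b _ _ ha hb => exact fun z hz => ha _ (hb _ hz)
      | inv a ha h =>
        clear h
        -- A one-sided implication does not pass to inverses; the equivalence does.
        have : ∀ a ∈ Subgroup.closure s, ∀ z, (p (a z) ↔ p z) := by
          intro a ha
          induction ha using Subgroup.closure_induction with
          | mem g hg => exact fun z => ⟨fun h => by simpa [hs g hg] using hp _ h g hg,
              fun h => hp z h g hg⟩
          | one => exact fun z => Iff.rfl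
          | mul a b _ _ ha hb => exact fun z => (ha _).trans (hb _)
          | inv a _ h => exact fun z => by rw [← h]; simp
        exact fun z hz => by rw [← this a ha]; simpa using hz
    exact key x hx
  · intro h
    refine h _ (MulAction.mem_orbit_self x) ?_
    rintro z ⟨g, rfl⟩ k hk
    exact ⟨⟨k, Subgroup.subset_closure hk⟩ * g, rfl⟩

/-- The orbits of the group generated by two permutations. -/
def PairOrbit (p q : Equiv.Perm F) : Type _ := Quot fun a b : F => b = p a ∨ b = q a

/-- The orbit of a point. -/
def PairOrbit.mk (p q : Equiv.Perm F) (x : F) : PairOrbit p q := Quot.mk _ x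

namespace PairOrbit

variable {p q : Equiv.Perm F}

theorem mk_left (x : F) : mk p q (p x) = mk p q x := (Quot.sound (r := fun a b : F => b = p a ∨ b = q a) (Or.inl rfl)).symm

theorem mk_right (x : F) : mk p q (q x) = mk p q x := 
  (Quot.sound (r := fun a b : F => b = p a ∨ b = q a) (Or.inr rfl)).symm

theorem mk_surjective : Function.Surjective (mk p q) := Quot.mk_surjective

/-- A function that is constant on the orbits. -/
def lift {α : Sort*} (f : F → α) (hp : ∀ x, f (p x) = f x) (hq : ∀ x, f (q x) = f x) :
    PairOrbit p q → α :=
  Quot.lift f (by rintro a b (rfl | rfl); exacts [(hp a).symm, (hq a).symm])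

@[simp] theorem lift_mk {α : Sort*} (f : F → α) (hp : ∀ x, f (p x) = f x)
    (hq : ∀ x, f (q x) = f x) (x : F) : lift f hp hq (mk p q x) = f x := rfl

instance [Finite F] : Finite (PairOrbit p q) := Finite.of_surjective _ mk_surjective

theorem pair_involutive (hp : ∀ z, p (p z) = z) (hq : ∀ z, q (q z) = z) :
    ∀ g ∈ ({p, q} : Set (Equiv.Perm F)), ∀ z, g (g z) = z := by
  rintro g (rfl | rfl) <;> assumption

theorem mem_orbit_pair_iff (hp : ∀ z, p (p z) = z) (hq : ∀ z, q (q z) = z) {x y : F} :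
    y ∈ MulAction.orbit (Subgroup.closure {p, q}) x ↔
      ∀ P : F → Prop, P x → (∀ z, P z → P (p z)) → (∀ z, P z → P (q z)) → P y := by
  rw [mem_orbit_closure_iff (pair_involutive hp hq)]
  simp only [Set.mem_insert_iff, Set.mem_singleton_iff, forall_eq_or_imp, forall_eq]
  constructor
  · exact fun h P hx h1 h2 => h P hx fun z hz => ⟨h1 z hz, h2 z hz⟩
  · exact fun h P hx h1 => h P hx (fun z hz => (h1 z hz).1) (fun z hz => (h1 z hz).2)

theorem mk_eq_mk_iff (hp : ∀ z, p (p z) = z) (hq : ∀ z, q (q z) = z) {x y : F} :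
    mk p q x = mk p q y ↔ y ∈ MulAction.orbit (Subgroup.closure {p, q}) x := by
  constructor
  · intro h
    have hc : ∀ g ∈ ({p, q} : Set (Equiv.Perm F)), ∀ z,
        MulAction.orbit (Subgroup.closure {p, q}) (g z) =
          MulAction.orbit (Subgroup.closure {p, q}) z := by
      intro g hg z
      exact MulAction.orbit_eq_iff.2 ⟨⟨g, Subgroup.subset_closure hg⟩, rfl⟩
    have := congrArg (lift (fun z => MulAction.orbit (Subgroup.closure {p, q}) z)
      (hc p (by simp)) (hc q (by simp))) h
    simp only [lift_mk] at this
    rw [this]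
    exact MulAction.mem_orbit_self y
  · rw [mem_orbit_pair_iff hp hq]
    exact fun h => h (fun z => mk p q x = mk p q z) rfl
      (fun z hz => by rw [hz, mk_left]) (fun z hz => by rw [hz, mk_right])

/-- Replaces the sets of flags counted by `numFaces` with a quotient type, out of which functions
can be defined. -/
theorem ncard_range_orbit (hp : ∀ z, p (p z) = z) (hq : ∀ z, q (q z) = z) :
    (Set.range fun x : F => (MulAction.orbit (Subgroup.closure {p, q}) x : Set F)).ncard =
      Nat.card (PairOrbit p q) := by
  rw [← Nat.card_coe_set_eq]
  refine Nat.card_congr (Equiv.symm (Equiv.ofBijective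
    (lift (fun x => (⟨MulAction.orbit (Subgroup.closure {p, q}) x, x, rfl⟩ :
      Set.range fun x : F => (MulAction.orbit (Subgroup.closure {p, q}) x : Set F)))
      (fun x => ?_) (fun x => ?_)) ⟨?_, ?_⟩))
  · exact Subtype.ext (MulAction.orbit_eq_iff.2 ((mk_eq_mk_iff hp hq).1 (mk_left x).symm))
  · exact Subtype.ext (MulAction.orbit_eq_iff.2 ((mk_eq_mk_iff hp hq).1 (mk_right x).symm))
  · intro a b h
    obtain ⟨a, rfl⟩ := mk_surjective a
    obtain ⟨b, rfl⟩ := mk_surjective b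
    have h := congrArg Subtype.val h
    simp only [lift_mk] at h
    exact (mk_eq_mk_iff hp hq).2 (h ▸ MulAction.mem_orbit_self b)
  · rintro ⟨_, x, rfl⟩
    exact ⟨mk p q x, rfl⟩

end PairOrbit

/-- Each fibre contributes one in total. Vertices, edges and faces are thus counted by summing
inverse orbit sizes over the flags. -/
theorem ncard_range_eq_sum {X Y : Type*} [Fintype X] (f : X → Y) :
    ((Set.range f).ncard : ℚ) = ∑ x, 1 / ({y | f y = f x}.ncard : ℚ) := by
  classical
  have h1 : (Set.range f).ncard = (Finset.univ.image f).card := by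
    rw [← Set.ncard_coe_finset]; simp
  rw [h1, ← Finset.sum_fiberwise_of_maps_to (s := Finset.univ) (t := Finset.univ.image f) (g := f)
    (by simp)]
  rw [Finset.card_eq_sum_ones, Nat.cast_sum]
  refine Finset.sum_congr rfl fun b hb => ?_
  obtain ⟨x, -, rfl⟩ := Finset.mem_image.1 hb
  have h2 : ∀ y ∈ Finset.univ.filter (fun y => f y = f x),
      1 / ({z | f z = f y}.ncard : ℚ) = 1 / ((Finset.univ.filter (fun y => f y = f x)).card : ℚ) := by
    intro y hy
    rw [Finset.mem_filter] at hy
    rw [hy.2, ← Set.ncard_coe_finset]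
    simp
  rw [Finset.sum_congr rfl h2, Finset.sum_const, nsmul_eq_mul, Nat.cast_one, mul_one_div_cancel]
  have : x ∈ Finset.univ.filter (fun y => f y = f x) := by simp
  exact_mod_cast (Finset.card_pos.2 ⟨x, this⟩).ne'

section Dihedral

variable {p q : Equiv.Perm F} (hp : ∀ z, p (p z) = z) (hq : ∀ z, q (q z) = z)
  (hp' : ∀ z, p z ≠ z) (hq' : ∀ z, q z ≠ z)
include hp hq

theorem orbit_pair_of_eq {x : F} (h : p x = q x) :
    MulAction.orbit (Subgroup.closure {p, q}) x = {x, q x} := by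
  ext y
  rw [PairOrbit.mem_orbit_pair_iff hp hq]
  constructor
  · refine fun H => H (fun z => z ∈ ({x, q x} : Set F)) (by simp) ?_ ?_
    · rintro z (rfl | rfl)
      · simp [h]
      · simp [← h, hp]
    · rintro z (rfl | rfl) <;> simp [hq]
  · rintro (rfl | rfl) P h0 h1 h2
    exacts [h0, h2 _ h0]

theorem orbit_pair_of_cube {x : F} (h : p (q (p (q (p (q x))))) = x) :
    MulAction.orbit (Subgroup.closure {p, q}) x =
      {x, q x, p (q x), q (p (q x)), p (q (p (q x))), p x} := by
  have h' : q (p (q (p (q x)))) = p x := by rw [← hp (q (p (q (p (q x))))), h]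
  ext y
  rw [PairOrbit.mem_orbit_pair_iff hp hq]
  constructor
  · refine fun H => H (fun z => z ∈ ({x, q x, p (q x), q (p (q x)), p (q (p (q x))), p x} : Set F))
      (by simp) ?_ ?_
    · rintro z (rfl | rfl | rfl | rfl | rfl | rfl) <;> simp [hp]
    · rintro z (rfl | rfl | rfl | rfl | rfl | rfl) <;> simp [hq, h']
      simp [← h', hq]
  · rintro (rfl | rfl | rfl | rfl | rfl | rfl) P h0 h1 h2
    exacts [h0, h2 _ h0, h1 _ (h2 _ h0), h2 _ (h1 _ (h2 _ h0)), h1 _ (h2 _ (h1 _ (h2 _ h0))), h1 _ h0]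

include hp' hq'

/-- The orbit is a cycle alternating `p` and `q`, of even length dividing six; `p x ≠ q x` excludes
length two. -/
theorem cube_distinct {x : F} (h : p (q (p (q (p (q x))))) = x) (hne : p x ≠ q x) :
    [x, q x, p (q x), q (p (q x)), p (q (p (q x))), p x].Nodup := by
  have h' : q (p (q (p (q x)))) = p x := by rw [← hp (q (p (q (p (q x))))), h]
  have e1 : p (q x) ≠ x := fun e => hne (by rw [← e, hp, e])
  have e2 : q (p (q x)) ≠ x := fun e => hp' (q x) (by rw [← hq (p (q x)), e])
  have e3 : p (q (p (q x))) ≠ x := fun e => by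
    rw [e] at h'
    exact hne h'.symm
  have e4 : q (p (q x)) ≠ q x := fun e => e1 (q.injective e)
  have e5 : p (q (p (q x))) ≠ q x := fun e => hq' (p (q x)) (p.injective (by rw [e, hp]))
  have e6 : p (q (p (q x))) ≠ p (q x) := fun e => e4 (p.injective e)
  simp only [List.nodup_cons, List.mem_cons, List.not_mem_nil, or_false, not_or, List.nodup_nil,
    not_false_eq_true, and_true]
  refine ⟨⟨(hq' _).symm, e1.symm, e2.symm, e3.symm, (hp' _).symm⟩, ⟨(hp' _).symm, e4.symm, e5.symm,
    hne.symm⟩, ⟨(hq' _).symm, e6.symm, fun e => hq' x (p.injective e)⟩, ⟨(hp' _).symm, fun e => ?_⟩, fun e => e2 (p.injective e)⟩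
  rw [e, hp] at h
  exact e1 h

omit hp' hq' in
theorem ncard_ends_of_eq {x : F} (h : p x = q x) :
    ((fun z => ({z, q z} : Set F)) '' MulAction.orbit (Subgroup.closure {p, q}) x).ncard = 1 := by
  rw [orbit_pair_of_eq hp hq h, Set.image_pair, hq, Set.pair_comm (q x) x, Set.pair_eq_singleton,
    Set.ncard_singleton]

omit hq' in
theorem ncard_ends_eq_one_iff {x : F} :
    ((fun z => ({z, q z} : Set F)) '' MulAction.orbit (Subgroup.closure {p, q}) x).ncard = 1 ↔
      p x = q x := by
  refine ⟨fun h => ?_, ncard_ends_of_eq hp hq⟩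
  obtain ⟨a, ha⟩ := Set.ncard_eq_one.1 h
  have h1 : ({x, q x} : Set F) ∈ ({a} : Set (Set F)) := ha ▸
    Set.mem_image_of_mem (fun z => ({z, q z} : Set F)) (MulAction.mem_orbit_self x)
  have h2 : ({p x, q (p x)} : Set F) ∈ ({a} : Set (Set F)) := ha ▸
    Set.mem_image_of_mem (fun z => ({z, q z} : Set F))
      ((PairOrbit.mem_orbit_pair_iff hp hq).2 fun P h0 h1 _ => h1 _ h0)
  rw [Set.mem_singleton_iff] at h1 h2
  have h3 : p x ∈ ({x, q x} : Set F) := by rw [h1, ← h2]; simp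
  rcases h3 with h3 | h3
  · exact absurd h3 (hp' x)
  · exact h3

/-- Without fixed points the orbit is an alternating cycle of length `2k`, and the pairs `{z, q z}`
number `k`. The cube relation says that `k` divides three, and `p x ≠ q x` that `k ≠ 1`. -/
theorem ncard_ends_eq_three_iff [Finite F] {x : F} :
    ((fun z => ({z, q z} : Set F)) '' MulAction.orbit (Subgroup.closure {p, q}) x).ncard = 3 ↔
      p x ≠ q x ∧ p (q (p (q (p (q x))))) = x := by
  set g : F → Set F := fun z => ({z, q z} : Set F) with hg
  have hgq : ∀ z, g (q z) = g z := fun z => by simp only [hg, hq]; exact Set.pair_comm _ _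
  have hgg : ∀ a b, g a = g b → a = b ∨ a = q b := fun a b h => by
    have : a ∈ g b := h ▸ (by simp [hg])
    simpa [hg] using this
  have mem : ∀ z ∈ MulAction.orbit (Subgroup.closure {p, q}) x,
      p (q z) ∈ MulAction.orbit (Subgroup.closure {p, q}) x := by
    intro z hz
    rw [PairOrbit.mem_orbit_pair_iff hp hq] at hz ⊢
    exact fun P h0 h1 h2 => h1 _ (h2 _ (hz P h0 h1 h2))
  have m0 := MulAction.mem_orbit_self (M := Subgroup.closure {p, q}) x
  -- The first three pairs met along the cycle are distinct as soon as `k` is neither one nor two.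
  have key : p x ≠ q x → p (q (p (q x))) ≠ x →
      ({g x, g (p (q x)), g (p (q (p (q x))))} : Set (Set F)).ncard = 3 := by
    intro hne h2
    have a1 : g x ≠ g (p (q x)) := fun h => by
      rcases hgg _ _ h with h | h
      · exact hne (by rw [h, hp, ← h])
      · exact hp' (q x) (by rw [← hq (p (q x)), ← h])
    have a2 : g (p (q x)) ≠ g (p (q (p (q x)))) := fun h => by
      rcases hgg _ _ h with h | h
      · exact hne (by
          have h3 := congrArg p (q.injective (p.injective h))
          rwa [hp] at h3)
      · exact hp' (q (p (q x))) (q.injective (by rw [← h, hq]))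
    have a3 : g x ≠ g (p (q (p (q x)))) := fun h => by
      rcases hgg _ _ h with h | h
      · exact h2 h.symm
      · have h3 := congrArg (fun z => p (q z)) h
        simp only [hq, hp] at h3
        exact hq' _ h3.symm
    rw [Set.ncard_eq_three]
    exact ⟨_, _, _, a1, a3, a2, rfl⟩
  constructor
  · intro h
    have hne : p x ≠ q x := fun e => by
      rw [(ncard_ends_eq_one_iff hp hq hp').2 e] at h
      omega
    refine ⟨hne, ?_⟩
    have h2 : p (q (p (q x))) ≠ x := by
      intro e
      have hsub : g '' MulAction.orbit (Subgroup.closure {p, q}) x ⊆ {g x, g (p (q x))} := by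
        have e' : q (p (q x)) = p x := by rw [← hp (q (p (q x))), e]
        rintro _ ⟨y, hy, rfl⟩
        rw [PairOrbit.mem_orbit_pair_iff hp hq] at hy
        have := hy (fun z => z ∈ ({x, q x, p (q x), p x} : Set F)) (by simp)
          (by rintro z (rfl | rfl | rfl | rfl) <;> simp [hp])
          (by rintro z (rfl | rfl | rfl | rfl) <;> simp [hq, e']; simp [← e', hq])
        rcases this with rfl | rfl | rfl | rfl
        · simp
        · simp [hgq]
        · simp
        · rw [← e', hgq]; simp
      have := Set.ncard_le_ncard hsub
      have h4 : ({g x, g (p (q x))} : Set (Set F)).ncard ≤ 2 :=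
        (Set.ncard_insert_le _ _).trans (by simp)
      omega
    have hsub : {g x, g (p (q x)), g (p (q (p (q x))))} ⊆
        g '' MulAction.orbit (Subgroup.closure {p, q}) x := by
      rintro _ (rfl | rfl | rfl)
      · exact Set.mem_image_of_mem g m0
      · exact Set.mem_image_of_mem g (mem _ m0)
      · exact Set.mem_image_of_mem g (mem _ (mem _ m0))
    have heq := Set.eq_of_subset_of_ncard_le hsub (by rw [h, key hne h2])
    -- The fourth pair must be one of the first three. Of the six possible coincidences, only the
    -- return to `x` is compatible with the absence of fixed points.
    have h5 : g (p (q (p (q (p (q x)))))) ∈ ({g x, g (p (q x)), g (p (q (p (q x))))} : Set (Set F)) := by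
      rw [heq]
      exact Set.mem_image_of_mem g (mem _ (mem _ (mem _ m0)))
    have inj : ∀ a b, p (q a) = p (q b) → a = b := fun a b h => q.injective (p.injective h)
    have nfix : ∀ z, p z ≠ q z → p (q z) ≠ z := fun z hz e => hz (by rw [← e, hp, e])
    rcases h5 with h5 | h5 | h5 <;> rcases hgg _ _ h5 with h5 | h5
    · exact h5
    · have h6 := congrArg (fun z => p (q (p z))) h5
      simp only [hq, hp] at h6
      exact absurd h6.symm (hp' _)
    · exact absurd (inj _ _ h5) h2
    · have h6 := congrArg p h5
      simp only [hp] at h6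
      exact absurd h6 (hq' _)
    · exact absurd (inj _ _ (inj _ _ h5)) (fun e => nfix x hne e)
    · exact absurd h5 (hp' _)
  · rintro ⟨hne, h⟩
    have hnd := cube_distinct hp hq hp' hq' h hne
    rw [← key hne (by simp at hnd; tauto), orbit_pair_of_cube hp hq h]
    congr 1
    ext s
    have h' : g (p x) = g (p (q (p (q x)))) := by
      rw [← hgq (p (q (p (q x)))), ← hp (q (p (q (p (q x))))), h]
    simp only [Set.image_insert_eq, Set.image_singleton, hgq, h', Set.mem_insert_iff,
      Set.mem_singleton_iff]
    tauto

end Dihedral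

end Orbits

/-- Restricts an isomorphism to the old flags once it is known to preserve the added ones. It serves
both for attached leaves and for duals. -/
theorem Equiv.exists_inl_eq_of_isRight {A A' B B' : Type*} (e : A ⊕ B ≃ A' ⊕ B')
    (h : ∀ b, (e (Sum.inr b)).isRight) (h' : ∀ b, (e.symm (Sum.inr b)).isRight) :
    ∃ φ : A ≃ A', ∀ a, e (Sum.inl a) = Sum.inl (φ a) := by
  have h1 : ∀ a, ∃ a', e (Sum.inl a) = Sum.inl a' := by
    intro a
    rcases h2 : e (Sum.inl a) with a' | b'
    · exact ⟨a', rfl⟩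
    · have := h' b'
      rw [← h2] at this
      simp at this
  have h2 : ∀ a, ∃ a', e.symm (Sum.inl a) = Sum.inl a' := by
    intro a
    rcases h2 : e.symm (Sum.inl a) with a' | b'
    · exact ⟨a', rfl⟩
    · have := h b'
      rw [← h2] at this
      simp at this
  choose f hf using h1
  choose g hg using h2
  refine ⟨⟨f, g, fun a => ?_, fun a => ?_⟩, hf⟩
  · apply Sum.inl_injective (β := B)
    rw [← hg, ← hf, e.symm_apply_apply]
  · apply Sum.inl_injective (β := B')
    rw [← hf, ← hg, e.apply_symm_apply]

/-! ### Isomorphisms, connectedness and leafy cubic maps. -/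

namespace CombMap

variable {F F' F'' : Type*}

/-- The bijections of the flags that respect all the incidences. -/
structure IsIso (M : CombMap F) (M' : CombMap F') (φ : F ≃ F') : Prop where
  map_end : ∀ x, φ (M.endFlip x) = M'.endFlip (φ x)
  map_corner : ∀ x, φ (M.cornerFlip x) = M'.cornerFlip (φ x)
  map_side : ∀ x, φ (M.sideFlip x) = M'.sideFlip (φ x)

namespace IsIso

variable {M : CombMap F} {M' : CombMap F'} {M'' : CombMap F''}

theorem refl (M : CombMap F) : IsIso M M (Equiv.refl F) := ⟨fun _ => rfl, fun _ => rfl, fun _ => rfl⟩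

theorem symm {φ : F ≃ F'} (h : IsIso M M' φ) : IsIso M' M φ.symm where
  map_end x := by rw [Equiv.symm_apply_eq, h.map_end, Equiv.apply_symm_apply]
  map_corner x := by rw [Equiv.symm_apply_eq, h.map_corner, Equiv.apply_symm_apply]
  map_side x := by rw [Equiv.symm_apply_eq, h.map_side, Equiv.apply_symm_apply]

theorem trans {φ : F ≃ F'} {ψ : F' ≃ F''} (h : IsIso M M' φ) (h' : IsIso M' M'' ψ) :
    IsIso M M'' (φ.trans ψ) where
  map_end x := by simp [h.map_end, h'.map_end]
  map_corner x := by simp [h.map_corner, h'.map_corner]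
  map_side x := by simp [h.map_side, h'.map_side]

end IsIso

/-- Relabelling of the flags. -/
def relabel (M : CombMap F) (e : F ≃ F') : CombMap F' where
  endFlip := e.permCongr M.endFlip
  cornerFlip := e.permCongr M.cornerFlip
  sideFlip := e.permCongr M.sideFlip
  endFlip_endFlip x := by simp [Equiv.permCongr_apply, M.endFlip_endFlip]
  cornerFlip_cornerFlip x := by simp [Equiv.permCongr_apply, M.cornerFlip_cornerFlip]
  sideFlip_sideFlip x := by simp [Equiv.permCongr_apply, M.sideFlip_sideFlip]
  endFlip_sideFlip x := by simp [Equiv.permCongr_apply, M.endFlip_sideFlip]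
  endFlip_ne x := by
    simpa [Equiv.permCongr_apply, ← Equiv.eq_symm_apply] using M.endFlip_ne (e.symm x)
  cornerFlip_ne x := by
    simpa [Equiv.permCongr_apply, ← Equiv.eq_symm_apply] using M.cornerFlip_ne (e.symm x)
  endFlip_ne_sideFlip x := by
    simpa [Equiv.permCongr_apply] using M.endFlip_ne_sideFlip (e.symm x)

theorem isIso_relabel (M : CombMap F) (e : F ≃ F') : IsIso M (M.relabel e) e where
  map_end x := by simp [relabel, Equiv.permCongr_apply]
  map_corner x := by simp [relabel, Equiv.permCongr_apply]
  map_side x := by simp [relabel, Equiv.permCongr_apply]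

/-- Isomorphism of maps with a distinguished flag. -/
def PointedIso (M : CombMap F) (r : F) (M' : CombMap F') (r' : F') : Prop :=
  ∃ φ : F ≃ F', IsIso M M' φ ∧ φ r = r'

theorem PointedIso.symm {M : CombMap F} {r : F} {M' : CombMap F'} {r' : F'} :
    PointedIso M r M' r' → PointedIso M' r' M r := by
  rintro ⟨φ, h, hr⟩
  exact ⟨φ.symm, h.symm, by rw [← hr, φ.symm_apply_apply]⟩

theorem PointedIso.trans {M : CombMap F} {r : F} {M' : CombMap F'} {r' : F'} {M'' : CombMap F''}
    {r'' : F''} : PointedIso M r M' r' → PointedIso M' r' M'' r'' → PointedIso M r M'' r'' := by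
  rintro ⟨φ, h, hr⟩ ⟨ψ, h', hr'⟩
  exact ⟨φ.trans ψ, h.trans h', by rw [← hr', ← hr]; rfl⟩

/-- Every flag is reached from `r`. -/
def ReachesAll (M : CombMap F) (r : F) : Prop :=
  ∀ p : F → Prop, p r → (∀ z, p z → p (M.endFlip z)) → (∀ z, p z → p (M.cornerFlip z)) →
    (∀ z, p z → p (M.sideFlip z)) → ∀ z, p z

theorem isConnected_iff (M : CombMap F) (r : F) : M.IsConnected ↔ M.ReachesAll r := by
  have hs : ∀ g ∈ ({M.endFlip, M.cornerFlip, M.sideFlip} : Set (Equiv.Perm F)), ∀ z,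
      g (g z) = z := by
    rintro g (rfl | rfl | rfl)
    exacts [M.endFlip_endFlip, M.cornerFlip_cornerFlip, M.sideFlip_sideFlip]
  have key : ∀ x, (∀ y, y ∈ MulAction.orbit (Subgroup.closure
      {M.endFlip, M.cornerFlip, M.sideFlip}) x) ↔ M.ReachesAll x := by
    intro x
    simp only [mem_orbit_closure_iff hs, Set.mem_insert_iff, Set.mem_singleton_iff,
      forall_eq_or_imp, forall_eq]
    constructor
    · exact fun h p hx h1 h2 h3 z => h z p hx fun z hz => ⟨h1 z hz, h2 z hz, h3 z hz⟩
    · exact fun h z p hx h1 => h p hx (fun z hz => (h1 z hz).1) (fun z hz => (h1 z hz).2.1)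
        (fun z hz => (h1 z hz).2.2) z
  constructor
  · exact fun h => (key r).1 fun y => h r y
  · intro h x y
    have hx := (key r).2 h x
    have hy := (key r).2 h y
    rw [← MulAction.orbit_eq_iff] at hx hy
    rw [hx, ← hy]
    exact MulAction.mem_orbit_self y

theorem ReachesAll.mem_of_mem {M : CombMap F} {r a : F} (h : M.ReachesAll r) {p : F → Prop}
    (ha : p a) (h1 : ∀ z, p z → p (M.endFlip z)) (h2 : ∀ z, p z → p (M.cornerFlip z))
    (h3 : ∀ z, p z → p (M.sideFlip z)) (z : F) : p z :=
  (isConnected_iff M a).1 ((isConnected_iff M r).2 h) p ha h1 h2 h3 z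

theorem ReachesAll.iso {M : CombMap F} {r : F} {M' : CombMap F'} {φ : F ≃ F'} (h : IsIso M M' φ)
    (hM : M.ReachesAll r) : M'.ReachesAll (φ r) := by
  intro p hr h1 h2 h3 z
  have := hM (fun z => p (φ z)) hr (fun z hz => by rw [h.map_end]; exact h1 _ hz)
    (fun z hz => by rw [h.map_corner]; exact h2 _ hz)
    (fun z hz => by rw [h.map_side]; exact h3 _ hz) (φ.symm z)
  simpa using this

/-- A connected map with a distinguished flag has no automorphism. -/
theorem ReachesAll.iso_unique {M : CombMap F} {r : F} {M' : CombMap F'} (hM : M.ReachesAll r)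
    {φ ψ : F ≃ F'} (hφ : IsIso M M' φ) (hψ : IsIso M M' ψ) (hr : φ r = ψ r) : φ = ψ := by
  ext z
  refine hM (fun z => φ z = ψ z) hr ?_ ?_ ?_ z
  · intro z hz; rw [hφ.map_end, hψ.map_end, hz]
  · intro z hz; rw [hφ.map_corner, hψ.map_corner, hz]
  · intro z hz; rw [hφ.map_side, hψ.map_side, hz]

/-- The faces of a map, as a type. -/
abbrev Face (M : CombMap F) : Type _ := PairOrbit M.endFlip M.cornerFlip

/-- The face of a flag. -/
abbrev faceOf (M : CombMap F) (x : F) : M.Face := PairOrbit.mk M.endFlip M.cornerFlip x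

@[simp] theorem faceOf_endFlip (M : CombMap F) (x : F) : M.faceOf (M.endFlip x) = M.faceOf x :=
  PairOrbit.mk_left x

@[simp] theorem faceOf_cornerFlip (M : CombMap F) (x : F) :
    M.faceOf (M.cornerFlip x) = M.faceOf x :=
  PairOrbit.mk_right x

theorem numFaces_eq (M : CombMap F) : M.numFaces = Nat.card M.Face :=
  PairOrbit.ncard_range_orbit M.endFlip_endFlip M.cornerFlip_cornerFlip

/-- An isomorphism acts on the faces. -/
def IsIso.faceEquiv {M : CombMap F} {M' : CombMap F'} {φ : F ≃ F'} (h : IsIso M M' φ) :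
    M.Face ≃ M'.Face where
  toFun := PairOrbit.lift (fun x => M'.faceOf (φ x)) (fun x => by rw [h.map_end, faceOf_endFlip])
    (fun x => by rw [h.map_corner, faceOf_cornerFlip])
  invFun := PairOrbit.lift (fun x => M.faceOf (φ.symm x))
    (fun x => by rw [h.symm.map_end, faceOf_endFlip])
    (fun x => by rw [h.symm.map_corner, faceOf_cornerFlip])
  left_inv f := by obtain ⟨x, rfl⟩ := PairOrbit.mk_surjective f; simp
  right_inv f := by obtain ⟨x, rfl⟩ := PairOrbit.mk_surjective f; simp

@[simp] theorem IsIso.faceEquiv_faceOf {M : CombMap F} {M' : CombMap F'} {φ : F ≃ F'}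
    (h : IsIso M M' φ) (x : F) : h.faceEquiv (M.faceOf x) = M'.faceOf (φ x) := rfl

theorem IsOrientable.iso {M : CombMap F} {M' : CombMap F'} {φ : F ≃ F'} (h : IsIso M M' φ) :
    M.IsOrientable → M'.IsOrientable := by
  rintro ⟨c, hc⟩
  refine ⟨fun x => c (φ.symm x), fun x => ?_⟩
  have := hc (φ.symm x)
  beta_reduce
  rw [h.symm.map_end, h.symm.map_corner, h.symm.map_side]
  refine ⟨this.1, this.2.1, fun hx => this.2.2 fun hx' => hx (φ.symm.injective ?_)⟩
  rw [h.symm.map_side, hx']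

/-- The flag is at a vertex of degree one (of a map without boundary). -/
def IsLeaf (M : CombMap F) (x : F) : Prop := M.cornerFlip x = M.sideFlip x

theorem IsIso.isLeaf_iff {M : CombMap F} {M' : CombMap F'} {φ : F ≃ F'} (h : IsIso M M' φ) (x : F) :
    M'.IsLeaf (φ x) ↔ M.IsLeaf x := by
  rw [IsLeaf, IsLeaf, ← h.map_corner, ← h.map_side, φ.apply_eq_iff_eq]

theorem IsLeaf.sideFlip {M : CombMap F} {x : F} (h : M.IsLeaf x) : M.IsLeaf (M.sideFlip x) := by
  rw [IsLeaf] at h ⊢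
  rw [M.sideFlip_sideFlip, ← h, M.cornerFlip_cornerFlip]

/-- The maps without boundary whose vertices have degree one or three, of which `n` of degree one,
with as many faces, edges and sides as a map on `S.closure` with `S.β` faces, rooted at a leaf. -/
structure IsLeafyCubic (S : Surface) (n : ℕ) (M : CombMap F) (r : F) : Prop where
  side_ne : ∀ x, M.sideFlip x ≠ x
  reaches : M.ReachesAll r
  cube : ∀ x, M.cornerFlip (M.sideFlip (M.cornerFlip (M.sideFlip (M.cornerFlip
    (M.sideFlip x))))) = x
  root : M.IsLeaf r
  card_leaf : Nat.card {x // M.IsLeaf x} = 2 * n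
  card_flag : (Nat.card F : ℤ) = 8 * n - 12 * S.eulerChar
  card_face : Nat.card M.Face = S.β
  orientable : M.IsOrientable ↔ S.IsOrientable

theorem IsLeafyCubic.iso {S : Surface} {n : ℕ} {M : CombMap F} {r : F} {M' : CombMap F'} {r' : F'}
    (hM : IsLeafyCubic S n M r) (h : PointedIso M r M' r') : IsLeafyCubic S n M' r' := by
  obtain ⟨φ, h, rfl⟩ := h
  refine ⟨fun x => ?_, hM.reaches.iso h, fun x => ?_, (h.isLeaf_iff r).2 hM.root, ?_, ?_, ?_, ?_⟩
  · obtain ⟨x, rfl⟩ := φ.surjective x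
    rw [← h.map_side]
    exact fun e => hM.side_ne x (φ.injective e)
  · obtain ⟨x, rfl⟩ := φ.surjective x
    simp only [← h.map_side, ← h.map_corner, hM.cube]
  · rw [← hM.card_leaf]
    exact Nat.card_congr (φ.subtypeEquiv fun x => (h.isLeaf_iff x).symm).symm
  · rw [← hM.card_flag, Nat.card_congr φ]
  · rw [← hM.card_face, Nat.card_congr h.faceEquiv]
  · rw [← hM.orientable]
    exact ⟨IsOrientable.iso h.symm, IsOrientable.iso h⟩

end CombMap

/-! ### Isomorphism classes of rooted maps. -/

namespace RootedMap

open CombMap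

theorem iso_iff {R R' : RootedMap} :
    (⟦R⟧ : Quotient RootedMap.setoid) = ⟦R'⟧ ↔ PointedIso R.toMap R.root R'.toMap R'.root := by
  rw [Quotient.eq]
  constructor
  · rintro ⟨φ, h0, h1, h2, hr⟩
    exact ⟨φ, ⟨h0, h1, h2⟩, hr⟩
  · rintro ⟨φ, h, hr⟩
    exact ⟨φ, h.map_end, h.map_corner, h.map_side, hr⟩

/-- The rooted map given by a map on any finite type of flags. -/
noncomputable def ofMap {F : Type*} [Finite F] (M : CombMap F) (r : F) : RootedMap :=
  ⟨Nat.card F, M.relabel (Finite.equivFin F), Finite.equivFin F r⟩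

theorem pointedIso_ofMap {F : Type*} [Finite F] (M : CombMap F) (r : F) :
    PointedIso M r (ofMap M r).toMap (ofMap M r).root :=
  ⟨Finite.equivFin F, isIso_relabel M _, rfl⟩

theorem ofMap_eq_iff {F F' : Type*} [Finite F] [Finite F'] {M : CombMap F} {r : F}
    {M' : CombMap F'} {r' : F'} :
    (⟦ofMap M r⟧ : Quotient RootedMap.setoid) = ⟦ofMap M' r'⟧ ↔ PointedIso M r M' r' := by
  rw [iso_iff]
  exact ⟨fun h => (pointedIso_ofMap M r).trans (h.trans (pointedIso_ofMap M' r').symm),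
    fun h => (pointedIso_ofMap M r).symm.trans (h.trans (pointedIso_ofMap M' r'))⟩

theorem ofMap_toMap (R : RootedMap) :
    (⟦ofMap R.toMap R.root⟧ : Quotient RootedMap.setoid) = ⟦R⟧ :=
  iso_iff.2 (pointedIso_ofMap _ _).symm

/-- The classes of the rooted maps with a given property. -/
def classes (P : RootedMap → Prop) : Set (Quotient RootedMap.setoid) := {q | ∃ R, ⟦R⟧ = q ∧ P R}

theorem classes_finite {P : RootedMap → Prop} {N : ℕ} (h : ∀ R, P R → R.numFlags = N) :
    (classes P).Finite := by
  have hfin : Finite (CombMap (Fin N) × Fin N) := by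
    have : Finite (CombMap (Fin N)) := by
      refine Finite.of_injective
        (fun M => ((M.endFlip, M.cornerFlip, M.sideFlip) : _ × _ × _)) ?_
      rintro ⟨_, _, _, _⟩ ⟨_, _, _, _⟩ h
      simp only [Prod.mk.injEq] at h
      obtain ⟨rfl, rfl, rfl⟩ := h
      rfl
    infer_instance
  refine (Set.finite_range fun p : CombMap (Fin N) × Fin N =>
    (⟦⟨N, p.1, p.2⟩⟧ : Quotient RootedMap.setoid)).subset ?_
  rintro q ⟨⟨k, M, r⟩, rfl, hR⟩
  obtain rfl : k = N := h _ hR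
  exact ⟨(M, r), rfl⟩

/-- The equivalence `h2` gives at once that the construction descends to classes and that it is
injective there. -/
theorem bijOn_classes {P Q : RootedMap → Prop} (d : ∀ R, P R → RootedMap)
    (h1 : ∀ R h, Q (d R h))
    (h2 : ∀ R R' h h', (⟦d R h⟧ : Quotient RootedMap.setoid) = ⟦d R' h'⟧ ↔
      (⟦R⟧ : Quotient RootedMap.setoid) = ⟦R'⟧)
    (h3 : ∀ R', Q R' → ∃ R h, (⟦d R h⟧ : Quotient RootedMap.setoid) = ⟦R'⟧) :
    ∃ f, Set.BijOn f (classes P) (classes Q) := by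
  classical
  -- The value `q` outside `classes P` is arbitrary.
  let f : Quotient RootedMap.setoid → Quotient RootedMap.setoid := fun q =>
    if h : ∃ R, ⟦R⟧ = q ∧ P R then ⟦d h.choose h.choose_spec.2⟧ else q
  have hf : ∀ R (h : P R), f ⟦R⟧ = ⟦d R h⟧ := by
    intro R h
    have h' : ∃ R', (⟦R'⟧ : Quotient RootedMap.setoid) = ⟦R⟧ ∧ P R' := ⟨R, rfl, h⟩
    simp only [f, dif_pos h']
    exact (h2 _ _ _ _).2 h'.choose_spec.1
  refine ⟨f, ?_, ?_, ?_⟩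
  · rintro _ ⟨R, rfl, h⟩
    exact ⟨d R h, (hf R h).symm, h1 R h⟩
  · rintro _ ⟨R, rfl, h⟩ _ ⟨R', rfl, h'⟩ he
    rw [hf R h, hf R' h'] at he
    exact (h2 _ _ _ _).1 he
  · rintro _ ⟨R', rfl, h'⟩
    obtain ⟨R, h, he⟩ := h3 R' h'
    exact ⟨⟦R⟧, ⟨R, rfl, h⟩, (hf R h).trans he⟩

end RootedMap

/-! ### Attaching a leaf. -/

/-- The flags that a new leaf adds to a map: two at the leaf, two at the other end of its edge, and
four at the new vertex on the subdivided edge. -/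
inductive Spur : Type
  | a0 | a1 | b0 | b1 | x0 | x1 | y0 | y1
  deriving DecidableEq

instance : Fintype Spur := ⟨{.a0, .a1, .b0, .b1, .x0, .x1, .y0, .y1}, by rintro (_ | _) <;> simp⟩

theorem Spur.card : Nat.card Spur = 8 := by rw [Nat.card_eq_fintype_card]; rfl

namespace CombMap

variable {F F' : Type*}

open Classical in
/-- The new action of `endFlip` when a leaf is added. -/
noncomputable def spurEnd (M : CombMap F) (x : F) : F ⊕ Spur → F ⊕ Spur
  | .inl z =>
    if z = x then .inr .x0 else if z = M.sideFlip x then .inr .x1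
    else if z = M.endFlip x then .inr .y0 else if z = M.endFlip (M.sideFlip x) then .inr .y1
    else .inl (M.endFlip z)
  | .inr .a0 => .inr .b0
  | .inr .a1 => .inr .b1
  | .inr .b0 => .inr .a0
  | .inr .b1 => .inr .a1
  | .inr .x0 => .inl x
  | .inr .x1 => .inl (M.sideFlip x)
  | .inr .y0 => .inl (M.endFlip x)
  | .inr .y1 => .inl (M.endFlip (M.sideFlip x))

/-- `sideFlip` on the new flags. -/
def spurSide : Spur → Spur
  | .a0 => .a1 | .a1 => .a0 | .b0 => .b1 | .b1 => .b0
  | .x0 => .x1 | .x1 => .x0 | .y0 => .y1 | .y1 => .y0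

/-- `cornerFlip` on the new flags. -/
def spurCorner : Spur → Spur
  | .a0 => .a1 | .a1 => .a0 | .b0 => .x0 | .x0 => .b0
  | .b1 => .y0 | .y0 => .b1 | .x1 => .y1 | .y1 => .x1

/-- The edge of `x` is cut into one half with flags `x, x0` and, across, `sideFlip x, x1`, and
another with `endFlip x, y0` and, across, `endFlip (sideFlip x), y1`. Distinctness of the four old
flags makes the cases of `spurEnd` exclusive. -/
theorem end_ne_side_end (M : CombMap F) (hs : ∀ x, M.sideFlip x ≠ x) (x : F) :
    [x, M.sideFlip x, M.endFlip x, M.endFlip (M.sideFlip x)].Nodup := by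
  have h1 := M.endFlip_ne x
  have h2 := hs x
  have h3 := M.endFlip_ne_sideFlip x
  have h4 := M.endFlip_ne (M.sideFlip x)
  have h5 := M.endFlip_ne_sideFlip (M.sideFlip x)
  have h6 := M.sideFlip_sideFlip x
  have h7 : M.endFlip x ≠ M.endFlip (M.sideFlip x) := fun h => h2 (M.endFlip.injective h).symm
  simp only [List.nodup_cons, List.mem_cons, List.not_mem_nil, or_false, not_or, List.nodup_nil,
    not_false_eq_true, and_true]
  rw [h6] at h5
  exact ⟨⟨h2.symm, h1.symm, h5.symm⟩, ⟨h3.symm, h4.symm⟩, h7⟩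

theorem spurEnd_spurEnd (M : CombMap F) (hs : ∀ x, M.sideFlip x ≠ x) (x : F) (z : F ⊕ Spur) :
    M.spurEnd x (M.spurEnd x z) = z := by
  have h := M.end_ne_side_end hs x
  simp only [List.nodup_cons, List.mem_cons, List.not_mem_nil, or_false, not_or, List.nodup_nil,
    not_false_eq_true, and_true] at h
  have e1 := M.endFlip_endFlip
  rcases z with z | i
  · by_cases h1 : z = x
    · subst h1; simp [spurEnd]
    by_cases h2 : z = M.sideFlip x
    · subst h2; simp [spurEnd, hs]
    by_cases h3 : z = M.endFlip x
    · subst h3; simp [spurEnd, h1, h2]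
    by_cases h4 : z = M.endFlip (M.sideFlip x)
    · subst h4; simp [spurEnd, h1, h2, h3]
    simp only [spurEnd, if_neg h1, if_neg h2, if_neg h3, if_neg h4]
    rw [if_neg, if_neg, if_neg, if_neg, e1]
    · exact fun e => h2 (M.endFlip.injective e)
    · exact fun e => h1 (M.endFlip.injective e)
    · exact fun e => h4 (by rw [← e, e1])
    · exact fun e => h3 (by rw [← e, e1])
  · cases i <;> simp [spurEnd, hs] <;> grind

/-- A map given by functions on the flags. -/
def ofFun (e c s : F → F) (hee : ∀ x, e (e x) = x) (hcc : ∀ x, c (c x) = x)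
    (hss : ∀ x, s (s x) = x) (hes : ∀ x, e (s x) = s (e x)) (he : ∀ x, e x ≠ x)
    (hc : ∀ x, c x ≠ x) (hne : ∀ x, e x ≠ s x) : CombMap F where
  endFlip := ⟨e, e, hee, hee⟩
  cornerFlip := ⟨c, c, hcc, hcc⟩
  sideFlip := ⟨s, s, hss, hss⟩
  endFlip_endFlip := hee
  cornerFlip_cornerFlip := hcc
  sideFlip_sideFlip := hss
  endFlip_sideFlip := hes
  endFlip_ne := he
  cornerFlip_ne := hc
  endFlip_ne_sideFlip := hne

theorem spurEnd_side (M : CombMap F) (hs : ∀ x, M.sideFlip x ≠ x) (x : F) (z : F ⊕ Spur) :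
    M.spurEnd x (Sum.map M.sideFlip spurSide z) = Sum.map M.sideFlip spurSide (M.spurEnd x z) := by
  have h := M.end_ne_side_end hs x
  simp only [List.nodup_cons, List.mem_cons, List.not_mem_nil, or_false, not_or, List.nodup_nil,
    not_false_eq_true, and_true] at h
  have e2 := M.sideFlip_sideFlip
  have e3 := M.endFlip_sideFlip
  rcases z with z | i
  · simp only [Sum.map_inl]
    by_cases h1 : z = x
    · subst h1; simp [spurEnd, hs, spurSide]
    by_cases h2 : z = M.sideFlip x
    · subst h2; simp [spurEnd, hs, e2, spurSide]
    by_cases h3 : z = M.endFlip x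
    · subst h3; simp only [spurEnd]; grind [spurSide]
    by_cases h4 : z = M.endFlip (M.sideFlip x)
    · subst h4; simp only [spurEnd]; grind [spurSide]
    simp only [spurEnd, if_neg h1, if_neg h2, if_neg h3, if_neg h4]
    rw [if_neg, if_neg, if_neg, if_neg, e3, Sum.map_inl]
    · intro e; apply h3; rw [← e2 z, e, ← e3, e2]
    · intro e; apply h4; rw [← e2 z, e, ← e3]
    · intro e; exact h1 (M.sideFlip.injective e)
    · intro e; apply h2; rw [← e, e2]
  · cases i <;> simp [spurEnd, spurSide, e2, e3]

/-- `M` with a new leaf, whose edge is attached in the middle of the edge of `x`, on the side of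
`x`. -/
noncomputable def addLeaf (M : CombMap F) (hs : ∀ x, M.sideFlip x ≠ x) (x : F) :
    CombMap (F ⊕ Spur) :=
  ofFun (M.spurEnd x) (Sum.map M.cornerFlip spurCorner) (Sum.map M.sideFlip spurSide)
    (M.spurEnd_spurEnd hs x)
    (by rintro (z | (_ | _)) <;> simp [M.cornerFlip_cornerFlip, spurCorner])
    (by rintro (z | (_ | _)) <;> simp [M.sideFlip_sideFlip, spurSide])
    (M.spurEnd_side hs x)
    (by
      have h1 := M.endFlip_ne
      rintro (z | (_ | _)) <;> simp [spurEnd]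
      split_ifs <;> simp [h1])
    (by rintro (z | (_ | _)) <;> simp [M.cornerFlip_ne, spurCorner])
    (by
      have h1 := M.endFlip_ne_sideFlip
      rintro (z | (_ | _)) <;> simp [spurEnd, spurSide]
      split_ifs <;> simp [h1])

section AddLeaf

variable (M : CombMap F) (hs : ∀ x, M.sideFlip x ≠ x) (x : F)

@[simp] theorem addLeaf_corner_inl (z : F) :
    (M.addLeaf hs x).cornerFlip (.inl z) = .inl (M.cornerFlip z) := rfl

@[simp] theorem addLeaf_corner_inr (i : Spur) :
    (M.addLeaf hs x).cornerFlip (.inr i) = .inr (spurCorner i) := rfl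

@[simp] theorem addLeaf_side_inl (z : F) :
    (M.addLeaf hs x).sideFlip (.inl z) = .inl (M.sideFlip z) := rfl

@[simp] theorem addLeaf_side_inr (i : Spur) :
    (M.addLeaf hs x).sideFlip (.inr i) = .inr (spurSide i) := rfl

theorem addLeaf_end (z : F ⊕ Spur) : (M.addLeaf hs x).endFlip z = M.spurEnd x z := rfl

theorem addLeaf_end_x0 : (M.addLeaf hs x).endFlip (.inr .x0) = .inl x := rfl

theorem addLeaf_end_x1 : (M.addLeaf hs x).endFlip (.inr .x1) = .inl (M.sideFlip x) := rfl

theorem addLeaf_end_y0 : (M.addLeaf hs x).endFlip (.inr .y0) = .inl (M.endFlip x) := rfl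

theorem addLeaf_end_y1 :
    (M.addLeaf hs x).endFlip (.inr .y1) = .inl (M.endFlip (M.sideFlip x)) := rfl

theorem addLeaf_end_inl (z : F) :
    (M.addLeaf hs x).endFlip (.inl z) = .inl (M.endFlip z) ∨
      (z = x ∧ (M.addLeaf hs x).endFlip (.inl z) = .inr .x0) ∨
      (z = M.sideFlip x ∧ (M.addLeaf hs x).endFlip (.inl z) = .inr .x1) ∨
      (z = M.endFlip x ∧ (M.addLeaf hs x).endFlip (.inl z) = .inr .y0) ∨
      (z = M.endFlip (M.sideFlip x) ∧ (M.addLeaf hs x).endFlip (.inl z) = .inr .y1) := by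
  rw [addLeaf_end]
  simp only [spurEnd]
  split_ifs <;> simp_all

/-- A function on the flags that is compatible with `endFlip` extends to the new flags. -/
theorem addLeaf_end_retract {α : Type*} (f : F → α) (g : Spur → α) (hf : ∀ z, f (M.endFlip z) = f z)
    (hx0 : g .x0 = f x) (hx1 : g .x1 = f (M.sideFlip x)) (hy0 : g .y0 = f x)
    (hy1 : g .y1 = f (M.sideFlip x)) (ha : g .a0 = g .b0) (hb : g .a1 = g .b1) (z : F ⊕ Spur) :
    Sum.elim f g ((M.addLeaf hs x).endFlip z) = Sum.elim f g z := by
  rcases z with z | i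
  · rcases M.addLeaf_end_inl hs x z with h | ⟨rfl, h⟩ | ⟨rfl, h⟩ | ⟨rfl, h⟩ | ⟨rfl, h⟩ <;>
      rw [h] <;> simp [*]
  · rw [addLeaf_end]
    cases i <;> simp [spurEnd, *]

theorem addLeaf_isLeaf_inl (z : F) : (M.addLeaf hs x).IsLeaf (.inl z) ↔ M.IsLeaf z := by
  simp [IsLeaf]

theorem addLeaf_isLeaf_inr (i : Spur) :
    (M.addLeaf hs x).IsLeaf (.inr i) ↔ i = .a0 ∨ i = .a1 := by
  cases i <;> simp [IsLeaf, spurCorner, spurSide]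

theorem addLeaf_side_ne (z : F ⊕ Spur) : (M.addLeaf hs x).sideFlip z ≠ z := by
  rcases z with z | (_ | _) <;> simp [hs, spurSide]

theorem addLeaf_cube_iff : (∀ z, (M.addLeaf hs x).cornerFlip ((M.addLeaf hs x).sideFlip
      ((M.addLeaf hs x).cornerFlip ((M.addLeaf hs x).sideFlip ((M.addLeaf hs x).cornerFlip
      ((M.addLeaf hs x).sideFlip z))))) = z) ↔
    ∀ z, M.cornerFlip (M.sideFlip (M.cornerFlip (M.sideFlip (M.cornerFlip (M.sideFlip z))))) = z := by
  constructor
  · intro h z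
    simpa using h (.inl z)
  · rintro h (z | (_ | _)) <;> simp [h, spurCorner, spurSide]

/-- A step along the old edge is replaced by the walk round the spur, `x, x0, b0, a0, a1, b1, y0,
endFlip x`. -/
theorem addLeaf_reaches_iff (r : F) : (M.addLeaf hs x).ReachesAll (.inl r) ↔ M.ReachesAll r := by
  constructor
  · intro h p h0 h1 h2 h3 z
    have hE : ∀ z, p (M.endFlip z) = p z := fun z =>
      propext ⟨fun h => by simpa [M.endFlip_endFlip] using h1 _ h, h1 z⟩
    have hS : ∀ z, p (M.sideFlip z) = p z := fun z =>
      propext ⟨fun h => by simpa [M.sideFlip_sideFlip] using h3 _ h, h3 z⟩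
    -- A property closed under the flips of `M` takes one value on the edge of `x`; the new flags
    -- receive it too.
    refine h (Sum.elim p fun _ => p x) h0 (fun z hz => ?_) ?_ ?_ (.inl z)
    · rw [addLeaf_end_retract _ _ _ p (fun _ => p x) hE rfl (hS x).symm rfl (hS x).symm rfl rfl]
      exact hz
    · rintro (z | i) hz
      · exact h2 z hz
      · exact hz
    · rintro (z | i) hz
      · exact h3 z hz
      · exact hz
  · intro h p h0 h1 h2 h3
    have s1 : p (.inl x) → ∀ i, i ≠ Spur.x1 → i ≠ Spur.y1 → p (.inr i) := by
      intro hx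
      have a1 : p (.inr .x0) := by
        have := h1 _ hx
        rwa [← addLeaf_end_x0 M hs, (M.addLeaf hs x).endFlip_endFlip] at this
      have a2 : p (.inr .b0) := h2 _ a1
      have a3 : p (.inr .a0) := h1 _ a2
      have a4 : p (.inr .a1) := h2 _ a3
      have a5 : p (.inr .b1) := h1 _ a4
      have a6 : p (.inr .y0) := h2 _ a5
      intro i; cases i <;> simp_all
    -- The same walk backwards.
    have s2 : p (.inl (M.endFlip x)) → p (.inl x) := by
      intro hx
      have a1 : p (.inr .y0) := by
        have := h1 _ hx
        rwa [← addLeaf_end_y0 M hs, (M.addLeaf hs x).endFlip_endFlip] at this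
      have a2 : p (.inr .b1) := h2 _ a1
      have a3 : p (.inr .a1) := h1 _ a2
      have a4 : p (.inr .a0) := h2 _ a3
      have a5 : p (.inr .b0) := h1 _ a4
      have a6 : p (.inr .x0) := h2 _ a5
      exact h1 _ a6
    have s3 : ∀ z, p (.inl z) ↔ p (.inl (M.sideFlip z)) := fun z =>
      ⟨fun hz => h3 _ hz, fun hz => by simpa [M.sideFlip_sideFlip] using h3 _ hz⟩
    have s4 : p (.inl x) → p (.inl (M.endFlip x)) := fun hx =>
      h1 _ (s1 hx .y0 (by simp) (by simp))
    have hx : ∀ z, p (.inl z) → p (.inl (M.endFlip z)) := by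
      intro z hz
      rcases M.addLeaf_end_inl hs x z with e | ⟨rfl, e⟩ | ⟨rfl, e⟩ | ⟨rfl, e⟩ | ⟨rfl, e⟩
      · rw [← e]; exact h1 _ hz
      · exact s4 hz
      · rw [M.endFlip_sideFlip]; exact (s3 _).1 (s4 ((s3 _).2 hz))
      · rw [M.endFlip_endFlip]; exact s2 hz
      · rw [M.endFlip_endFlip]
        rw [M.endFlip_sideFlip] at hz
        exact (s3 _).1 (s2 ((s3 _).2 hz))
    have hl : ∀ z, p (.inl z) := h (fun z => p (.inl z)) h0 hx (fun z hz => h2 _ hz)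
      (fun z hz => h3 _ hz)
    rintro (z | i)
    · exact hl z
    · by_cases h5 : i = .x1
      · subst h5; exact h3 _ (s1 (hl x) .x0 (by simp) (by simp))
      by_cases h6 : i = .y1
      · subst h6; exact h3 _ (s1 (hl x) .y0 (by simp) (by simp))
      exact s1 (hl x) i h5 h6

/-- The face of `M` that becomes the face of a new flag. -/
def spurFace (M : CombMap F) (x : F) : Spur → M.Face
  | .x1 | .y1 => M.faceOf (M.sideFlip x)
  | _ => M.faceOf x

/-- Adding a leaf keeps the faces. -/
noncomputable def addLeafFace : (M.addLeaf hs x).Face ≃ M.Face := by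
  refine Equiv.ofBijective (PairOrbit.lift (Sum.elim M.faceOf (M.spurFace x)) ?_ ?_) ⟨?_, ?_⟩
  · exact addLeaf_end_retract _ _ _ _ _ (by simp) rfl rfl rfl rfl rfl rfl
  · rintro (z | (_ | _)) <;> simp [spurFace, spurCorner]
  · have b0 : ∀ z, (M.addLeaf hs x).faceOf (.inl (M.cornerFlip z)) =
        (M.addLeaf hs x).faceOf (.inl z) := fun z => by
      rw [← addLeaf_corner_inl M hs x, faceOf_cornerFlip]
    -- On the side of `x` the face goes round the leaf; on the other side it passes only through
    -- `x1` and `y1`. Either way the two ends of the old edge keep a common face.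
    have b1 : (M.addLeaf hs x).faceOf (.inr .x0) = (M.addLeaf hs x).faceOf (.inl x) := by
      rw [← addLeaf_end_x0 M hs, faceOf_endFlip]
    have b2 : (M.addLeaf hs x).faceOf (.inr .b0) = (M.addLeaf hs x).faceOf (.inl x) := by
      rw [← b1]; exact faceOf_cornerFlip (M.addLeaf hs x) (.inr .x0)
    have b3 : (M.addLeaf hs x).faceOf (.inr .a0) = (M.addLeaf hs x).faceOf (.inl x) := by
      rw [← b2]; exact faceOf_endFlip (M.addLeaf hs x) (.inr .b0)
    have b4 : (M.addLeaf hs x).faceOf (.inr .a1) = (M.addLeaf hs x).faceOf (.inl x) := by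
      rw [← b3]; exact faceOf_cornerFlip (M.addLeaf hs x) (.inr .a0)
    have b5 : (M.addLeaf hs x).faceOf (.inr .b1) = (M.addLeaf hs x).faceOf (.inl x) := by
      rw [← b4]; exact faceOf_endFlip (M.addLeaf hs x) (.inr .a1)
    have b6 : (M.addLeaf hs x).faceOf (.inr .y0) = (M.addLeaf hs x).faceOf (.inl x) := by
      rw [← b5]; exact faceOf_cornerFlip (M.addLeaf hs x) (.inr .b1)
    have b7 : (M.addLeaf hs x).faceOf (.inl (M.endFlip x)) = (M.addLeaf hs x).faceOf (.inl x) := by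
      rw [← b6, ← addLeaf_end_y0 M hs, faceOf_endFlip]
    have b8 : (M.addLeaf hs x).faceOf (.inr .x1) =
        (M.addLeaf hs x).faceOf (.inl (M.sideFlip x)) := by
      rw [← addLeaf_end_x1 M hs, faceOf_endFlip]
    have b9 : (M.addLeaf hs x).faceOf (.inr .y1) =
        (M.addLeaf hs x).faceOf (.inl (M.sideFlip x)) := by
      rw [← b8]; exact faceOf_cornerFlip (M.addLeaf hs x) (.inr .x1)
    have b10 : (M.addLeaf hs x).faceOf (.inl (M.endFlip (M.sideFlip x))) =
        (M.addLeaf hs x).faceOf (.inl (M.sideFlip x)) := by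
      rw [← b9, ← addLeaf_end_y1 M hs, faceOf_endFlip]
    have bE : ∀ z, (M.addLeaf hs x).faceOf (.inl (M.endFlip z)) =
        (M.addLeaf hs x).faceOf (.inl z) := by
      intro z
      rcases M.addLeaf_end_inl hs x z with e | ⟨rfl, e⟩ | ⟨rfl, e⟩ | ⟨rfl, e⟩ | ⟨rfl, e⟩
      · rw [← e, faceOf_endFlip]
      · exact b7
      · exact b10
      · rw [M.endFlip_endFlip, b7]
      · rw [M.endFlip_endFlip, b10]
    let g : M.Face → (M.addLeaf hs x).Face :=
      PairOrbit.lift (fun z => (M.addLeaf hs x).faceOf (.inl z)) bE b0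
    have hg : ∀ z, g (Sum.elim M.faceOf (M.spurFace x) z) = (M.addLeaf hs x).faceOf z := by
      rintro (z | (_ | _)) <;> simp [spurFace, g, *]
    refine Function.LeftInverse.injective (g := g) fun f => ?_
    obtain ⟨z, rfl⟩ := PairOrbit.mk_surjective f
    exact hg z
  · intro f
    obtain ⟨z, rfl⟩ := PairOrbit.mk_surjective f
    exact ⟨(M.addLeaf hs x).faceOf (.inl z), rfl⟩

theorem addLeafFace_faceOf (z : F ⊕ Spur) : M.addLeafFace hs x ((M.addLeaf hs x).faceOf z) =
    Sum.elim M.faceOf (M.spurFace x) z := rfl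

/-- The walk from `x` to `endFlip x` round the spur has seven steps. Seven is odd, so signs
alternate along it exactly as along the old edge. -/
theorem addLeaf_isOrientable_iff : (M.addLeaf hs x).IsOrientable ↔ M.IsOrientable := by
  constructor
  · rintro ⟨c, hc⟩
    have key : ∀ z, c ((M.addLeaf hs x).sideFlip z) ≠ c z := fun z =>
      (hc z).2.2 (M.addLeaf_side_ne hs x z)
    have q : ∀ {a b : Bool}, a ≠ b → a = !b := fun {a b} h => by cases a <;> cases b <;> simp_all
    have s3 : ∀ z, c (.inl (M.sideFlip z)) = !c (.inl z) := fun z => q (key (.inl z))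
    have a1 : c (.inl x) = !c (.inr .x0) := q ((hc (.inr .x0)).1)
    have a2 : c (.inr .x0) = !c (.inr .b0) := q ((hc (.inr .b0)).2.1)
    have a3 : c (.inr .b0) = !c (.inr .a0) := q ((hc (.inr .a0)).1)
    have a4 : c (.inr .a0) = !c (.inr .a1) := q ((hc (.inr .a1)).2.1)
    have a5 : c (.inr .a1) = !c (.inr .b1) := q ((hc (.inr .b1)).1)
    have a6 : c (.inr .b1) = !c (.inr .y0) := q ((hc (.inr .y0)).2.1)
    have a7 : c (.inr .y0) = !c (.inl (M.endFlip x)) := by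
      have := (hc (.inr .y0)).1
      rw [addLeaf_end_y0] at this
      exact q this.symm
    have hE : ∀ z, c (.inl (M.endFlip z)) ≠ c (.inl z) := by
      have h1 : c (.inl (M.endFlip x)) = !c (.inl x) := by simp [a1, a2, a3, a4, a5, a6, a7]
      intro z
      rcases M.addLeaf_end_inl hs x z with e | ⟨rfl, e⟩ | ⟨rfl, e⟩ | ⟨rfl, e⟩ | ⟨rfl, e⟩
      · rw [← e]; exact (hc _).1
      · simp [h1]
      · simp [M.endFlip_sideFlip, s3, h1]
      · simp [M.endFlip_endFlip, h1]
      · simp [M.endFlip_endFlip, s3, M.endFlip_sideFlip, h1]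
    exact ⟨fun z => c (.inl z), fun z => ⟨hE z, (hc (.inl z)).2.1, fun _ => by simp [s3]⟩⟩
  · rintro ⟨c, hc⟩
    have q : ∀ {a b : Bool}, a ≠ b → a = !b := fun {a b} h => by cases a <;> cases b <;> simp_all
    have h1 : ∀ z, c (M.endFlip z) = !c z := fun z => q (hc z).1
    have h2 : ∀ z, c (M.cornerFlip z) = !c z := fun z => q (hc z).2.1
    have h3 : ∀ z, c (M.sideFlip z) = !c z := fun z => q ((hc z).2.2 (hs z))
    let g : Spur → Bool := fun i => match i with
      | .a0 => !c x | .a1 => c x | .b0 => c x | .b1 => !c x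
      | .x0 => !c x | .x1 => c x | .y0 => c x | .y1 => !c x
    refine ⟨Sum.elim c g, ?_⟩
    rintro (z | i)
    · refine ⟨?_, by simp [h2], by simp [h3]⟩
      rcases M.addLeaf_end_inl hs x z with e | ⟨rfl, e⟩ | ⟨rfl, e⟩ | ⟨rfl, e⟩ | ⟨rfl, e⟩ <;>
        simp [e, h1, h3, g]
    · rw [addLeaf_end]
      cases i <;> simp [g, spurEnd, spurCorner, spurSide, h1, h3]

/-- A leaf brings eight flags, two of them at the leaf, and no face. This is the increment in the
prescribed counts when `n` becomes `n + 1`. -/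
theorem addLeaf_isLeafyCubic_iff [Finite F] {S : Surface} {n : ℕ} {r : F} :
    IsLeafyCubic S (n + 1) (M.addLeaf hs x) (.inl r) ↔ IsLeafyCubic S n M r := by
  have h1 : Nat.card {z // (M.addLeaf hs x).IsLeaf z} = Nat.card {z // M.IsLeaf z} + 2 := by
    have e : {z // (M.addLeaf hs x).IsLeaf z} ≃ {z // M.IsLeaf z} ⊕ {i : Spur // i = .a0 ∨ i = .a1} :=
      (Equiv.subtypeSum).trans (Equiv.sumCongr
        (Equiv.subtypeEquivRight fun z => M.addLeaf_isLeaf_inl hs x z)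
        (Equiv.subtypeEquivRight fun i => M.addLeaf_isLeaf_inr hs x i))
    rw [Nat.card_congr e, Nat.card_sum, Nat.card_eq_fintype_card (α := {i : Spur // _})]
    rfl
  have h2 : Nat.card (F ⊕ Spur) = Nat.card F + 8 := by rw [Nat.card_sum, Spur.card]
  have h3 : Nat.card (M.addLeaf hs x).Face = Nat.card M.Face := Nat.card_congr (M.addLeafFace hs x)
  constructor
  · intro h
    refine ⟨hs, (M.addLeaf_reaches_iff hs x r).1 h.reaches, (M.addLeaf_cube_iff hs x).1 h.cube,
      (M.addLeaf_isLeaf_inl hs x r).1 h.root, ?_, ?_, ?_, ?_⟩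
    · have := h.card_leaf; omega
    · have := h.card_flag
      rw [h2] at this
      push_cast at this
      linarith
    · rw [← h3, h.card_face]
    · rw [← M.addLeaf_isOrientable_iff hs x, h.orientable]
  · intro h
    refine ⟨M.addLeaf_side_ne hs x, (M.addLeaf_reaches_iff hs x r).2 h.reaches,
      (M.addLeaf_cube_iff hs x).2 h.cube,
      (M.addLeaf_isLeaf_inl hs x r).2 h.root, ?_, ?_, ?_, ?_⟩
    · have := h.card_leaf; omega
    · have := h.card_flag
      rw [h2]
      push_cast
      linarith
    · rw [h3, h.card_face]
    · rw [M.addLeaf_isOrientable_iff hs x, h.orientable]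

end AddLeaf

end CombMap

namespace CombMap

variable {F F' : Type*}

theorem IsIso.addLeaf {M : CombMap F} {M' : CombMap F'} (hs : ∀ x, M.sideFlip x ≠ x)
    (hs' : ∀ x, M'.sideFlip x ≠ x) {φ : F ≃ F'} (h : IsIso M M' φ) (x : F) :
    IsIso (M.addLeaf hs x) (M'.addLeaf hs' (φ x)) (Equiv.sumCongr φ (Equiv.refl Spur)) where
  map_end z := by
    simp only [addLeaf_end]
    rcases z with z | i
    · have i0 : φ z = φ x ↔ z = x := φ.apply_eq_iff_eq
      have i1 : φ z = M'.sideFlip (φ x) ↔ z = M.sideFlip x := by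
        rw [← h.map_side, φ.apply_eq_iff_eq]
      have i2 : φ z = M'.endFlip (φ x) ↔ z = M.endFlip x := by
        rw [← h.map_end, φ.apply_eq_iff_eq]
      have i3 : φ z = M'.endFlip (M'.sideFlip (φ x)) ↔ z = M.endFlip (M.sideFlip x) := by
        rw [← h.map_side, ← h.map_end, φ.apply_eq_iff_eq]
      simp only [spurEnd, Equiv.sumCongr_apply, Sum.map_inl]
      split_ifs <;> first | contradiction | (exfalso; tauto) | simp [h.map_end]
    · cases i <;> simp [spurEnd, h.map_end, h.map_side]
  map_corner z := by rcases z with z | i <;> simp [h.map_corner]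
  map_side z := by rcases z with z | i <;> simp [h.map_side]

/-- Incidences recover the whole spur from `a0`, so an isomorphism fixing `a0` fixes the spur. The
neighbour of `x0` along its edge then recovers `x`. -/
theorem IsIso.of_addLeaf {M : CombMap F} {M' : CombMap F'} {hs : ∀ x, M.sideFlip x ≠ x}
    {hs' : ∀ x, M'.sideFlip x ≠ x} {x : F} {x' : F'} {Φ : F ⊕ Spur ≃ F' ⊕ Spur}
    (h : IsIso (M.addLeaf hs x) (M'.addLeaf hs' x') Φ) (ha : Φ (.inr .a0) = .inr .a0) :
    ∃ φ : F ≃ F', IsIso M M' φ ∧ (∀ z, Φ (.inl z) = .inl (φ z)) ∧ φ x = x' := by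
  have a1 : Φ (.inr .a1) = .inr .a1 := by
    have := h.map_side (.inr .a0); rw [ha] at this; exact this
  have b0 : Φ (.inr .b0) = .inr .b0 := by
    have := h.map_end (.inr .a0); rw [ha] at this; exact this
  have b1 : Φ (.inr .b1) = .inr .b1 := by
    have := h.map_end (.inr .a1); rw [a1] at this; exact this
  have x0 : Φ (.inr .x0) = .inr .x0 := by
    have := h.map_corner (.inr .b0); rw [b0] at this; exact this
  have y0 : Φ (.inr .y0) = .inr .y0 := by
    have := h.map_corner (.inr .b1); rw [b1] at this; exact this
  have x1 : Φ (.inr .x1) = .inr .x1 := by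
    have := h.map_side (.inr .x0); rw [x0] at this; exact this
  have y1 : Φ (.inr .y1) = .inr .y1 := by
    have := h.map_side (.inr .y0); rw [y0] at this; exact this
  have hΦ : ∀ i, Φ (.inr i) = .inr i := by rintro (_ | _) <;> assumption
  obtain ⟨φ, hφ⟩ := Equiv.exists_inl_eq_of_isRight Φ (fun b => by rw [hΦ]; rfl)
    (fun b => by rw [(Φ.symm_apply_eq).2 (hΦ b).symm]; rfl)
  have hx : φ x = x' := by
    have := h.map_end (.inr .x0)
    rw [x0, addLeaf_end_x0, addLeaf_end_x0, hφ] at this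
    exact Sum.inl_injective this
  have hx1 : φ (M.sideFlip x) = M'.sideFlip x' := by
    have := h.map_end (.inr .x1)
    rw [x1, addLeaf_end_x1, addLeaf_end_x1, hφ] at this
    exact Sum.inl_injective this
  have hy : φ (M.endFlip x) = M'.endFlip x' := by
    have := h.map_end (.inr .y0)
    rw [y0, addLeaf_end_y0, addLeaf_end_y0, hφ] at this
    exact Sum.inl_injective this
  have hy1 : φ (M.endFlip (M.sideFlip x)) = M'.endFlip (M'.sideFlip x') := by
    have := h.map_end (.inr .y1)
    rw [y1, addLeaf_end_y1, addLeaf_end_y1, hφ] at this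
    exact Sum.inl_injective this
  refine ⟨φ, ⟨fun z => ?_, fun z => ?_, fun z => ?_⟩, hφ, hx⟩
  · rcases M.addLeaf_end_inl hs x z with e | ⟨rfl, e⟩ | ⟨rfl, e⟩ | ⟨rfl, e⟩ | ⟨rfl, e⟩
    · have h1 := h.map_end (.inl z)
      rw [e, hφ, hφ] at h1
      rcases M'.addLeaf_end_inl hs' x' (φ z) with e | ⟨-, e⟩ | ⟨-, e⟩ | ⟨-, e⟩ | ⟨-, e⟩ <;>
        rw [e] at h1
      · exact Sum.inl_injective h1
      all_goals simp at h1
    · rw [hy, hx]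
    · rw [hy1, hx1]
    · rw [M.endFlip_endFlip, hy, hx, M'.endFlip_endFlip]
    · rw [M.endFlip_endFlip, hy1, hx1, M'.endFlip_endFlip]
  · have h1 := h.map_corner (.inl z)
    rw [addLeaf_corner_inl, hφ, hφ, addLeaf_corner_inl] at h1
    exact Sum.inl_injective h1
  · have h1 := h.map_side (.inl z)
    rw [addLeaf_side_inl, hφ, hφ, addLeaf_side_inl] at h1
    exact Sum.inl_injective h1

/-! ### Removing a leaf. -/

/-- The flags near a leaf flag `a`: those of its edge and of the other two edge-ends at the other
end of this edge. -/
def spurAt (M : CombMap F) (a : F) : Spur → F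
  | .a0 => a
  | .a1 => M.sideFlip a
  | .b0 => M.endFlip a
  | .b1 => M.endFlip (M.sideFlip a)
  | .x0 => M.cornerFlip (M.endFlip a)
  | .x1 => M.sideFlip (M.cornerFlip (M.endFlip a))
  | .y0 => M.cornerFlip (M.endFlip (M.sideFlip a))
  | .y1 => M.sideFlip (M.cornerFlip (M.endFlip (M.sideFlip a)))

section Delete

variable {M : CombMap F} {a : F}

theorem spurAt_side (i : Spur) : M.sideFlip (M.spurAt a i) = M.spurAt a (spurSide i) := by
  cases i <;> simp [spurAt, spurSide, M.sideFlip_sideFlip, M.endFlip_sideFlip]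

/-- All corners are immediate except the one between `x1` and `y1`, which comes from the cube
relation at the neighbour of the leaf. -/
theorem spurAt_corner (hc : ∀ x, M.cornerFlip (M.sideFlip (M.cornerFlip (M.sideFlip (M.cornerFlip
    (M.sideFlip x))))) = x) (ha : M.IsLeaf a) (i : Spur) :
    M.cornerFlip (M.spurAt a i) = M.spurAt a (spurCorner i) := by
  rw [IsLeaf] at ha
  have h1 : M.cornerFlip (M.sideFlip (M.cornerFlip (M.endFlip a))) =
      M.sideFlip (M.cornerFlip (M.endFlip (M.sideFlip a))) := by
    have := hc (M.endFlip a)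
    rw [M.endFlip_sideFlip]
    have h2 := congrArg M.cornerFlip this
    rw [M.cornerFlip_cornerFlip] at h2
    have h3 := congrArg M.sideFlip h2
    rw [M.sideFlip_sideFlip] at h3
    rw [← h3, M.cornerFlip_cornerFlip]
  cases i <;> simp [spurAt, spurCorner, M.cornerFlip_cornerFlip, ha, h1]
  · rw [← ha, M.cornerFlip_cornerFlip]
  · rw [← h1, M.cornerFlip_cornerFlip]

theorem spurAt_injective (hs : ∀ x, M.sideFlip x ≠ x) (hc : ∀ x, M.cornerFlip (M.sideFlip
    (M.cornerFlip (M.sideFlip (M.cornerFlip (M.sideFlip x))))) = x) (ha : M.IsLeaf a)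
    (hb : ¬ M.IsLeaf (M.endFlip a)) : Function.Injective (M.spurAt a) := by
  have h1 := M.endFlip_ne
  have h2 := M.cornerFlip_ne
  have h3 := M.endFlip_ne_sideFlip
  have e1 := M.endFlip_endFlip
  have e2 := M.sideFlip_sideFlip
  have e3 := M.cornerFlip_cornerFlip
  have e4 := M.endFlip_sideFlip
  have e5 := spurAt_corner hc ha .x1
  simp only [spurAt, spurCorner] at e5
  rw [IsLeaf] at ha hb
  clear hc
  intro i j hij
  cases i <;> cases j <;> first | rfl | (exfalso; simp only [spurAt] at hij; grind)

theorem isLeaf_spurAt_iff (hc : ∀ x, M.cornerFlip (M.sideFlip (M.cornerFlip (M.sideFlip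
    (M.cornerFlip (M.sideFlip x))))) = x) (ha : M.IsLeaf a)
    (hinj : Function.Injective (M.spurAt a)) (i : Spur) :
    M.IsLeaf (M.spurAt a i) ↔ i = .a0 ∨ i = .a1 := by
  rw [IsLeaf, spurAt_side, spurAt_corner hc ha, hinj.eq_iff]
  cases i <;> simp [spurSide, spurCorner]

/-- If the two remaining edge-ends at the neighbour of the leaf formed a loop, the spur would be the
whole map and `a` its only leaf, whereas `r` is at another leaf. So both edges leave the spur. -/
theorem endFlip_spurAt_ne (hc : ∀ x, M.cornerFlip (M.sideFlip (M.cornerFlip (M.sideFlip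
    (M.cornerFlip (M.sideFlip x))))) = x) (ha : M.IsLeaf a)
    (hinj : Function.Injective (M.spurAt a)) {r : F} (hr : M.ReachesAll r) (hl : M.IsLeaf r)
    (hra : r ≠ a) (hra' : r ≠ M.sideFlip a) :
    (∀ i, M.endFlip (M.spurAt a .x0) ≠ M.spurAt a i) ∧
      (∀ i, M.endFlip (M.spurAt a .x1) ≠ M.spurAt a i) ∧
      (∀ i, M.endFlip (M.spurAt a .y0) ≠ M.spurAt a i) ∧
      (∀ i, M.endFlip (M.spurAt a .y1) ≠ M.spurAt a i) := by
  have ea0 : M.endFlip (M.spurAt a .a0) = M.spurAt a .b0 := rfl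
  have ea1 : M.endFlip (M.spurAt a .a1) = M.spurAt a .b1 := rfl
  have eb0 : M.endFlip (M.spurAt a .b0) = M.spurAt a .a0 := M.endFlip_endFlip _
  have eb1 : M.endFlip (M.spurAt a .b1) = M.spurAt a .a1 := M.endFlip_endFlip _
  have ex1 : M.endFlip (M.spurAt a .x1) = M.sideFlip (M.endFlip (M.spurAt a .x0)) := by
    rw [← M.endFlip_sideFlip, spurAt_side]; rfl
  have ey1 : M.endFlip (M.spurAt a .y1) = M.sideFlip (M.endFlip (M.spurAt a .y0)) := by
    rw [← M.endFlip_sideFlip, spurAt_side]; rfl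
  have hloop : ¬ ∀ i, ∃ j, M.endFlip (M.spurAt a i) = M.spurAt a j := by
    intro hcl
    obtain ⟨i, hi⟩ := hr.mem_of_mem (p := fun z => ∃ i, z = M.spurAt a i) (a := a) ⟨.a0, rfl⟩
      (by rintro _ ⟨i, rfl⟩; exact hcl i)
      (by rintro _ ⟨i, rfl⟩; exact ⟨_, spurAt_corner hc ha i⟩)
      (by rintro _ ⟨i, rfl⟩; exact ⟨_, spurAt_side i⟩) r
    subst hi
    rcases (isLeaf_spurAt_iff hc ha hinj i).1 hl with rfl | rfl
    · exact hra rfl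
    · exact hra' rfl
  have inv : ∀ {i j}, M.endFlip (M.spurAt a i) = M.spurAt a j →
      M.endFlip (M.spurAt a j) = M.spurAt a i := fun {i j} h => by rw [← h, M.endFlip_endFlip]
  have hx : ∀ i, M.endFlip (M.spurAt a .x0) ≠ M.spurAt a i := by
    intro i hi
    have hi' := inv hi
    have h1 : i ≠ .a0 := fun e => by subst e; rw [ea0] at hi'; cases hinj hi'
    have h2 : i ≠ .a1 := fun e => by subst e; rw [ea1] at hi'; cases hinj hi'
    have h3 : i ≠ .b0 := fun e => by subst e; rw [eb0] at hi'; cases hinj hi'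
    have h4 : i ≠ .b1 := fun e => by subst e; rw [eb1] at hi'; cases hinj hi'
    have h5 : i ≠ .x0 := fun e => by subst e; exact M.endFlip_ne _ hi
    have h6 : i ≠ .x1 := fun e => by
      subst e
      have : M.spurAt a .x1 = M.sideFlip (M.spurAt a .x0) := (spurAt_side .x0).symm
      rw [this] at hi
      exact M.endFlip_ne_sideFlip _ hi
    apply hloop
    rw [hi, spurAt_side] at ex1
    have hx1' := inv ex1
    rintro (_ | _)
    -- Only `i = y0` and `i = y1` remain, the two ways to close the loop.
    exacts [⟨_, ea0⟩, ⟨_, ea1⟩, ⟨_, eb0⟩, ⟨_, eb1⟩, ⟨_, hi⟩, ⟨_, ex1⟩,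
      by cases i <;> first | contradiction | exact ⟨_, hi'⟩ | exact ⟨_, hx1'⟩,
      by cases i <;> first | contradiction | exact ⟨_, hi'⟩ | exact ⟨_, hx1'⟩]
  have side : ∀ z, (∀ i, z ≠ M.spurAt a i) → ∀ i, M.sideFlip z ≠ M.spurAt a i := by
    intro z hz i hi
    exact hz (spurSide i) (by rw [← spurAt_side, ← hi, M.sideFlip_sideFlip])
  have hx1 : ∀ i, M.endFlip (M.spurAt a .x1) ≠ M.spurAt a i := by
    rw [ex1]; exact side _ hx
  have hy : ∀ i, M.endFlip (M.spurAt a .y0) ≠ M.spurAt a i := by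
    intro i hi
    have hi' := inv hi
    cases i
    · rw [ea0] at hi'; cases hinj hi'
    · rw [ea1] at hi'; cases hinj hi'
    · rw [eb0] at hi'; cases hinj hi'
    · rw [eb1] at hi'; cases hinj hi'
    · exact hx _ hi'
    · exact hx1 _ hi'
    · exact M.endFlip_ne _ hi
    · have : M.spurAt a .y1 = M.sideFlip (M.spurAt a .y0) := (spurAt_side .y0).symm
      rw [this] at hi
      exact M.endFlip_ne_sideFlip _ hi
  exact ⟨hx, hx1, hy, by rw [ey1]; exact side _ hy⟩

/-- Otherwise the map would be a single edge, with four flags, whereas `8(n+1) - 12χ ≥ 8`. -/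
theorem IsLeafyCubic.not_isLeaf_endFlip [Finite F] {S : Surface} {n : ℕ} {r : F}
    (h : IsLeafyCubic S (n + 1) M r) (hS : S.eulerChar ≤ 0) (ha : M.IsLeaf a) :
    ¬ M.IsLeaf (M.endFlip a) := by
  intro hb
  rw [IsLeaf] at ha hb
  have e4 := M.endFlip_sideFlip
  have hcl := h.reaches.mem_of_mem (a := a)
    (p := fun z => z ∈ ({a, M.sideFlip a, M.endFlip a, M.endFlip (M.sideFlip a)} : Set F))
    (by simp) (by rintro z (rfl | rfl | rfl | rfl) <;> simp [M.endFlip_endFlip])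
    (by
      rintro z (rfl | rfl | rfl | rfl)
      · simp [ha]
      · simp [← ha, M.cornerFlip_cornerFlip]
      · simp [hb, e4]
      · simp [e4, ← hb, M.cornerFlip_cornerFlip])
    (by rintro z (rfl | rfl | rfl | rfl) <;> simp [M.sideFlip_sideFlip, e4])
  have huniv : ({a, M.sideFlip a, M.endFlip a, M.endFlip (M.sideFlip a)} : Set F) = Set.univ :=
    Set.eq_univ_of_forall hcl
  have h4 : ({a, M.sideFlip a, M.endFlip a, M.endFlip (M.sideFlip a)} : Set F).ncard ≤ 4 :=
    (Set.ncard_insert_le _ _).trans (Nat.succ_le_succ ((Set.ncard_insert_le _ _).trans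
      (Nat.succ_le_succ ((Set.ncard_insert_le _ _).trans (by simp)))))
  rw [huniv, Set.ncard_univ] at h4
  have := h.card_flag
  push_cast at this
  omega

open Classical in
/-- Every leaf is obtained by adding a leaf to a smaller map. -/
theorem IsLeafyCubic.exists_addLeaf [Finite F] {S : Surface} {n : ℕ} {r : F}
    (h : IsLeafyCubic S (n + 1) M r) (hS : S.eulerChar ≤ 0) (ha : M.IsLeaf a) (hra : r ≠ a)
    (hra' : r ≠ M.sideFlip a) :
    ∃ (s : Set F) (M₀ : CombMap s) (hs : ∀ x, M₀.sideFlip x ≠ x) (x r₀ : s)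
      (Φ : s ⊕ Spur ≃ F), IsIso (M₀.addLeaf hs x) M Φ ∧ Φ (.inr .a0) = a ∧ Φ (.inl r₀) = r := by
  have hs := h.side_ne
  have hinj := spurAt_injective hs h.cube ha (h.not_isLeaf_endFlip hS ha)
  obtain ⟨np0, np1, nq0, nq1⟩ := endFlip_spurAt_ne h.cube ha hinj h.reaches h.root hra hra'
  set p0 := M.endFlip (M.spurAt a .x0) with hp0
  set p1 := M.endFlip (M.spurAt a .x1) with hp1
  set q0 := M.endFlip (M.spurAt a .y0) with hq0
  set q1 := M.endFlip (M.spurAt a .y1) with hq1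
  -- The smaller map keeps the flags outside the spur. The flags `p0, p1, q0, q1` are the far ends
  -- of the two edges that leave it.
  let s : Set F := {z | ∀ i, z ≠ M.spurAt a i}
  have e1 := M.endFlip_endFlip
  have e2 := M.sideFlip_sideFlip
  have sp0 : M.sideFlip p0 = p1 := by rw [hp0, ← M.endFlip_sideFlip, spurAt_side]; rfl
  have sp1 : M.sideFlip p1 = p0 := by rw [← sp0, e2]
  have sq0 : M.sideFlip q0 = q1 := by rw [hq0, ← M.endFlip_sideFlip, spurAt_side]; rfl
  have sq1 : M.sideFlip q1 = q0 := by rw [← sq0, e2]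
  have d1 : p0 ≠ p1 := fun e => by cases hinj (M.endFlip.injective e)
  have d2 : p0 ≠ q0 := fun e => by cases hinj (M.endFlip.injective e)
  have d3 : p0 ≠ q1 := fun e => by cases hinj (M.endFlip.injective e)
  have d4 : p1 ≠ q0 := fun e => by cases hinj (M.endFlip.injective e)
  have d5 : p1 ≠ q1 := fun e => by cases hinj (M.endFlip.injective e)
  have d6 : q0 ≠ q1 := fun e => by cases hinj (M.endFlip.injective e)
  have hsS : ∀ z ∈ s, M.sideFlip z ∈ s := fun z hz i hi =>
    hz (spurSide i) (by rw [← spurAt_side, ← hi, e2])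
  have hsC : ∀ z ∈ s, M.cornerFlip z ∈ s := fun z hz i hi =>
    hz (spurCorner i) (by rw [← spurAt_corner h.cube ha, ← hi, M.cornerFlip_cornerFlip])
  have hsE : ∀ z ∈ s, z ≠ p0 → z ≠ p1 → z ≠ q0 → z ≠ q1 → M.endFlip z ∈ s := by
    intro z hz h1 h2 h3 h4 i hi
    have hz' : z = M.endFlip (M.spurAt a i) := by rw [← hi, e1]
    cases i
    · exact hz .b0 hz'
    · exact hz .b1 hz'
    · exact hz .a0 (hz'.trans (e1 _))
    · exact hz .a1 (hz'.trans (e1 _))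
    all_goals contradiction
  have nE : ∀ z ∈ s, M.endFlip z ≠ p0 ∧ M.endFlip z ≠ p1 ∧ M.endFlip z ≠ q0 ∧ M.endFlip z ≠ q1 :=
    fun z hz => ⟨fun e => hz _ (M.endFlip.injective e), fun e => hz _ (M.endFlip.injective e),
      fun e => hz _ (M.endFlip.injective e), fun e => hz _ (M.endFlip.injective e)⟩
  -- The two edges that met the spur are merged into one, with `p0` facing `q0` on one side and `p1`
  -- facing `q1` on the other.
  let f : F → F := fun z => if z = p0 then q0 else if z = p1 then q1 else if z = q0 then p0
    else if z = q1 then p1 else M.endFlip z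
  have fp0 : f p0 = q0 := by simp [f]
  have fp1 : f p1 = q1 := by simp [f, d1.symm]
  have fq0 : f q0 = p0 := by simp [f, d2.symm, d4.symm]
  have fq1 : f q1 = p1 := by simp [f, d3.symm, d5.symm, d6.symm]
  have fz : ∀ z, z ≠ p0 → z ≠ p1 → z ≠ q0 → z ≠ q1 → f z = M.endFlip z := fun z h1 h2 h3 h4 => by
    simp [f, h1, h2, h3, h4]
  have cases4 : ∀ z, z = p0 ∨ z = p1 ∨ z = q0 ∨ z = q1 ∨ (z ≠ p0 ∧ z ≠ p1 ∧ z ≠ q0 ∧ z ≠ q1) := by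
    intro z; tauto
  have hsf : ∀ z ∈ s, f z ∈ s := by
    intro z hz
    rcases cases4 z with rfl | rfl | rfl | rfl | ⟨h1, h2, h3, h4⟩
    · rw [fp0]; exact nq0
    · rw [fp1]; exact nq1
    · rw [fq0]; exact np0
    · rw [fq1]; exact np1
    · rw [fz z h1 h2 h3 h4]; exact hsE z hz h1 h2 h3 h4
  have hff : ∀ z ∈ s, f (f z) = z := by
    intro z hz
    rcases cases4 z with rfl | rfl | rfl | rfl | ⟨h1, h2, h3, h4⟩
    · rw [fp0, fq0]
    · rw [fp1, fq1]
    · rw [fq0, fp0]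
    · rw [fq1, fp1]
    · obtain ⟨g1, g2, g3, g4⟩ := nE z hz
      rw [fz z h1 h2 h3 h4, fz _ g1 g2 g3 g4, e1]
  have nS : ∀ z, z ≠ p0 → z ≠ p1 → z ≠ q0 → z ≠ q1 → M.sideFlip z ≠ p0 ∧ M.sideFlip z ≠ p1 ∧
      M.sideFlip z ≠ q0 ∧ M.sideFlip z ≠ q1 := fun z h1 h2 h3 h4 =>
    ⟨fun e => h2 (by rw [← sp0, ← e, e2]), fun e => h1 (by rw [← sp1, ← e, e2]),
      fun e => h4 (by rw [← sq0, ← e, e2]), fun e => h3 (by rw [← sq1, ← e, e2])⟩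
  have hfs : ∀ z, f (M.sideFlip z) = M.sideFlip (f z) := by
    intro z
    rcases cases4 z with rfl | rfl | rfl | rfl | ⟨h1, h2, h3, h4⟩
    · rw [fp0, sp0, fp1, sq0]
    · rw [fp1, sp1, fp0, sq1]
    · rw [fq0, sq0, fq1, sp0]
    · rw [fq1, sq1, fq0, sp1]
    · obtain ⟨g1, g2, g3, g4⟩ := nS z h1 h2 h3 h4
      rw [fz z h1 h2 h3 h4, fz _ g1 g2 g3 g4, M.endFlip_sideFlip]
  have hne : ∀ z, f z ≠ z := by
    intro z
    rcases cases4 z with rfl | rfl | rfl | rfl | ⟨h1, h2, h3, h4⟩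
    · rw [fp0]; exact d2.symm
    · rw [fp1]; exact d5.symm
    · rw [fq0]; exact d2
    · rw [fq1]; exact d5
    · rw [fz z h1 h2 h3 h4]; exact M.endFlip_ne z
  have hnes : ∀ z, f z ≠ M.sideFlip z := by
    intro z
    rcases cases4 z with rfl | rfl | rfl | rfl | ⟨h1, h2, h3, h4⟩
    · rw [fp0, sp0]; exact d4.symm
    · rw [fp1, sp1]; exact d3.symm
    · rw [fq0, sq0]; exact d3
    · rw [fq1, sq1]; exact d4
    · rw [fz z h1 h2 h3 h4]; exact M.endFlip_ne_sideFlip z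
  let M₀ : CombMap s := ofFun (fun z => ⟨f z, hsf z z.2⟩) (fun z => ⟨M.cornerFlip z, hsC z z.2⟩)
    (fun z => ⟨M.sideFlip z, hsS z z.2⟩) (fun z => Subtype.ext (hff z z.2))
    (fun z => Subtype.ext (M.cornerFlip_cornerFlip z)) (fun z => Subtype.ext (e2 z))
    (fun z => Subtype.ext (hfs z)) (fun z e => hne z (congrArg Subtype.val e))
    (fun z e => M.cornerFlip_ne z (congrArg Subtype.val e))
    (fun z e => hnes z (congrArg Subtype.val e))
  have hr : r ∈ s := by
    intro i hi
    have hl := h.root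
    rw [hi, isLeaf_spurAt_iff h.cube ha hinj] at hl
    rcases hl with rfl | rfl
    · exact hra hi
    · exact hra' hi
  have hbij : Function.Bijective (Sum.elim (Subtype.val : s → F) (M.spurAt a)) := by
    refine ⟨Subtype.val_injective.sumElim hinj fun z i => z.2 i, fun z => ?_⟩
    by_cases hz : z ∈ s
    · exact ⟨.inl ⟨z, hz⟩, rfl⟩
    · simp only [s, Set.mem_ofPred_eq, not_forall, not_not] at hz
      obtain ⟨i, rfl⟩ := hz
      exact ⟨.inr i, rfl⟩
  have hs₀ : ∀ x, M₀.sideFlip x ≠ x := fun z e => hs z (congrArg Subtype.val e)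
  -- Attaching a leaf at `p0` cuts the merged edge again, on the side where the leaf was.
  refine ⟨s, M₀, hs₀, ⟨p0, np0⟩, ⟨r, hr⟩, Equiv.ofBijective _ hbij, ⟨?_, ?_, ?_⟩, rfl, rfl⟩
  · rintro (⟨z, hz⟩ | i)
    · have t0 : (⟨z, hz⟩ : s) = ⟨p0, np0⟩ ↔ z = p0 := by rw [Subtype.mk.injEq]
      have t1 : (⟨z, hz⟩ : s) = M₀.sideFlip ⟨p0, np0⟩ ↔ z = p1 := by
        rw [Subtype.ext_iff, ← sp0]; rfl
      have t2 : (⟨z, hz⟩ : s) = M₀.endFlip ⟨p0, np0⟩ ↔ z = q0 := by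
        rw [Subtype.ext_iff, ← fp0]; rfl
      have t3 : (⟨z, hz⟩ : s) = M₀.endFlip (M₀.sideFlip ⟨p0, np0⟩) ↔ z = q1 := by
        rw [Subtype.ext_iff, ← fp1, ← sp0]; rfl
      simp only [addLeaf_end, spurEnd, t0, t1, t2, t3, Equiv.ofBijective_apply, Sum.elim_inl]
      rcases cases4 z with rfl | rfl | rfl | rfl | ⟨h1, h2, h3, h4⟩
      · simp only [if_true, Sum.elim_inr]
        exact (e1 _).symm
      · simp only [d1.symm, if_true, if_false, Sum.elim_inr]
        exact (e1 _).symm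
      · simp only [d2.symm, d4.symm, if_true, if_false, Sum.elim_inr]
        exact (e1 _).symm
      · simp only [d3.symm, d5.symm, d6.symm, if_true, if_false, Sum.elim_inr]
        exact (e1 _).symm
      · simp only [h1, h2, h3, h4, if_false, Sum.elim_inl]
        exact fz z h1 h2 h3 h4
    · cases i
      · rfl
      · rfl
      · exact (e1 _).symm
      · exact (e1 _).symm
      · rfl
      · exact sp0
      · exact fp0
      · exact (congrArg f sp0).trans fp1
  · rintro (z | i)
    · rfl
    · exact (spurAt_corner h.cube ha i).symm
  · rintro (z | i)
    · rfl
    · exact (spurAt_side i).symm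

end Delete

end CombMap

/-! ### The double counting and the exact recursion. -/

open CombMap RootedMap

/-- The classes of the leafy cubic rooted maps of given type with `n` leaves. -/
def leafyClasses (S : Surface) (n : ℕ) : Set (Quotient RootedMap.setoid) :=
  classes fun R => IsLeafyCubic S n R.toMap R.root

theorem leafyClasses_finite (S : Surface) (n : ℕ) : (leafyClasses S n).Finite :=
  classes_finite (N := (8 * n - 12 * S.eulerChar).toNat) fun R h => by
    have := h.card_flag
    rw [Nat.card_eq_fintype_card, Fintype.card_fin] at this
    omega

noncomputable instance (S : Surface) (n : ℕ) : Fintype (leafyClasses S n) :=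
  (leafyClasses_finite S n).fintype

theorem isLeafyCubic_out {S : Surface} {n : ℕ} (q : leafyClasses S n) :
    IsLeafyCubic S n q.1.out.toMap q.1.out.root := by
  obtain ⟨R, hR, h⟩ := q.2
  refine h.iso (iso_iff.1 ?_)
  rw [hR, Quotient.out_eq]

theorem ofMap_mem_leafyClasses {F : Type} [Finite F] {S : Surface} {n : ℕ} {M : CombMap F} {r : F}
    (h : IsLeafyCubic S n M r) : ⟦ofMap M r⟧ ∈ leafyClasses S n :=
  ⟨_, rfl, h.iso (pointedIso_ofMap M r)⟩

theorem pointedIso_out {F : Type} [Finite F] (M : CombMap F) (r : F) :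
    PointedIso M r (⟦ofMap M r⟧ : Quotient RootedMap.setoid).out.toMap
      (⟦ofMap M r⟧ : Quotient RootedMap.setoid).out.root :=
  (pointedIso_ofMap M r).trans (iso_iff.1 (by rw [Quotient.out_eq]))

theorem PointedIso.eq_ofMap {F : Type} [Finite F] {M : CombMap F} {r : F}
    {q : Quotient RootedMap.setoid} (h : PointedIso M r q.out.toMap q.out.root) :
    q = ⟦ofMap M r⟧ := by
  rw [← Quotient.out_eq q, iso_iff]
  exact h.symm.trans (pointedIso_ofMap M r)

/-- The class of the map obtained from a representative of `q` by adding a leaf at `x`. -/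
noncomputable def grow {S : Surface} {n : ℕ} (q : leafyClasses S n) (x : Fin q.1.out.numFlags) :
    Quotient RootedMap.setoid :=
  ⟦ofMap (q.1.out.toMap.addLeaf (isLeafyCubic_out q).side_ne x) (.inl q.1.out.root)⟧

/-- The flags at the leaves other than the root-vertex. -/
def NonrootLeaf {F : Type*} (M : CombMap F) (r : F) : Type _ :=
  {y // M.IsLeaf y ∧ r ≠ y ∧ r ≠ M.sideFlip y}

noncomputable instance {F : Type*} [Finite F] (M : CombMap F) (r : F) : Fintype (NonrootLeaf M r) :=
  @Fintype.ofFinite _ (inferInstanceAs (Finite {y // M.IsLeaf y ∧ r ≠ y ∧ r ≠ M.sideFlip y}))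

theorem card_nonrootLeaf {F : Type*} [Finite F] {S : Surface} {n : ℕ} {M : CombMap F} {r : F}
    (h : IsLeafyCubic S (n + 1) M r) : Fintype.card (NonrootLeaf M r) = 2 * n := by
  have h1 : Nat.card (NonrootLeaf M r) = ({y | M.IsLeaf y} \ {r, M.sideFlip r}).ncard := by
    rw [← Nat.card_coe_set_eq]
    refine Nat.card_congr (Equiv.subtypeEquivRight fun y => ?_)
    simp only [Set.mem_sdiff, Set.mem_ofPred_eq, Set.mem_insert_iff, Set.mem_singleton_iff, not_or]
    have : r = M.sideFlip y ↔ y = M.sideFlip r :=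
      ⟨fun e => by rw [e, M.sideFlip_sideFlip], fun e => by rw [e, M.sideFlip_sideFlip]⟩
    rw [Ne, Ne, this, eq_comm]
  rw [← Nat.card_eq_fintype_card, h1, Set.ncard_sdiff, Set.ncard_pair (h.side_ne r).symm,
    ← Nat.card_coe_set_eq]
  · have := h.card_leaf
    change Nat.card {x // M.IsLeaf x} - 2 = 2 * n
    omega
  · rintro y (rfl | rfl)
    exacts [h.root, h.root.sideFlip]

/-- Attaching a leaf matches pairs (smaller map, flag) with pairs (larger map, flag at a non-root
leaf). Every larger map has `2n` flags of the latter kind. The function `g` is arbitrary, so that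
the identity serves both for cardinalities and for weights. -/
theorem sum_leafyClasses_succ {S : Surface} (hS : S.eulerChar ≤ 0) (n : ℕ)
    (g : Quotient RootedMap.setoid → ℝ) :
    2 * n * ∑ q : leafyClasses S (n + 1), g q =
      ∑ q : leafyClasses S n, ∑ x : Fin q.1.out.numFlags, g (grow q x) := by
  let A := Σ q : leafyClasses S n, Fin q.1.out.numFlags
  let B := Σ q : leafyClasses S (n + 1), NonrootLeaf q.1.out.toMap q.1.out.root
  -- A relation, because the attached map is only isomorphic to the chosen representative of its
  -- class.
  let Rel : A → B → Prop := fun a b => ∃ Φ : Fin a.1.1.out.numFlags ⊕ Spur ≃ Fin b.1.1.out.numFlags,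
    IsIso (a.1.1.out.toMap.addLeaf (isLeafyCubic_out a.1).side_ne a.2) b.1.1.out.toMap Φ ∧
      Φ (.inl a.1.1.out.root) = b.1.1.out.root ∧ Φ (.inr .a0) = b.2.1
  have hcls : ∀ a b, Rel a b → b.1.1 = grow a.1 a.2 := by
    rintro a b ⟨Φ, h1, h2, -⟩
    exact PointedIso.eq_ofMap ⟨Φ, h1, h2⟩
  have hex : ∀ a, ∃ b, Rel a b := by
    rintro ⟨q, x⟩
    have hq := isLeafyCubic_out q
    have hmem : grow q x ∈ leafyClasses S (n + 1) :=
      ofMap_mem_leafyClasses ((addLeaf_isLeafyCubic_iff _ _ _).2 hq)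
    obtain ⟨Φ, h1, h2⟩ := pointedIso_out (q.1.out.toMap.addLeaf hq.side_ne x) (.inl q.1.out.root)
    refine ⟨⟨⟨_, hmem⟩, Φ (.inr .a0), ?_, ?_, ?_⟩, Φ, h1, h2, rfl⟩
    · exact (h1.isLeaf_iff _).2 ((addLeaf_isLeaf_inr _ _ _ _).2 (Or.inl rfl))
    · intro e
      have := Φ.injective (h2.trans e)
      simp at this
    · intro e
      have h3 := h1.map_side (.inr .a0)
      have := Φ.injective (h2.trans (e.trans h3.symm))
      simp at this
  -- Two isomorphisms that agree on the root are equal, hence send `a0` to the same flag.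
  have huniq : ∀ a b b', Rel a b → Rel a b' → b = b' := by
    rintro a ⟨q, y⟩ ⟨q', y'⟩ h h'
    obtain rfl : q = q' := Subtype.ext ((hcls _ _ h).trans (hcls _ _ h').symm)
    obtain ⟨Φ, h1, h2, h3⟩ := h
    obtain ⟨Φ', h1', h2', h3'⟩ := h'
    have hr := ((addLeaf_reaches_iff _ _ _ _).2 (isLeafyCubic_out a.1).reaches :
      (a.1.1.out.toMap.addLeaf (isLeafyCubic_out a.1).side_ne a.2).ReachesAll (.inl _))
    have := hr.iso_unique h1 h1' (h2.trans h2'.symm)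
    subst this
    congr 1
    exact Subtype.ext (h3.symm.trans h3')
  choose e he using hex
  have hbij : Function.Bijective e := by
    constructor
    · rintro ⟨q, x⟩ ⟨q', x'⟩ hee
      obtain ⟨Φ, h1, h2, h3⟩ := he ⟨q, x⟩
      have he' := he ⟨q', x'⟩
      rw [← hee] at he'
      obtain ⟨Φ', h1', h2', h3'⟩ := he'
      -- The composite fixes `a0` and the root, so it restricts to an isomorphism of the smaller
      -- rooted maps. This must be the identity once the classes agree.
      obtain ⟨φ, k1, k2, k3⟩ := (h1.trans h1'.symm).of_addLeaf (by
        rw [Equiv.trans_apply, h3, ← h3', Equiv.symm_apply_apply])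
      have k4 : φ q.1.out.root = q'.1.out.root := by
        have := k2 q.1.out.root
        rw [Equiv.trans_apply, h2, ← h2', Equiv.symm_apply_apply] at this
        exact (Sum.inl_injective this).symm
      obtain rfl : q = q' := by
        apply Subtype.ext
        rw [← Quotient.out_eq q.1, ← Quotient.out_eq q'.1]
        exact iso_iff.2 ⟨φ, k1, k4⟩
      have := (isLeafyCubic_out q).reaches.iso_unique k1 (IsIso.refl _) k4
      subst this
      exact congrArg (Sigma.mk q) k3
    · rintro ⟨q', y⟩
      have hq' := isLeafyCubic_out q'
      -- Surjectivity: remove the marked leaf, then move to the representative of the class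
      -- obtained.
      obtain ⟨s, M, hs, x, r, Φ, h1, h2, h3⟩ := hq'.exists_addLeaf hS y.2.1 y.2.2.1 y.2.2.2
      have hM : IsLeafyCubic S n M r := by
        rw [← M.addLeaf_isLeafyCubic_iff hs x]
        exact hq'.iso (PointedIso.symm ⟨Φ, h1, h3⟩)
      obtain ⟨ψ, g1, g2⟩ := pointedIso_out M r
      let q : leafyClasses S n := ⟨_, ofMap_mem_leafyClasses hM⟩
      have hadd := g1.addLeaf hs (isLeafyCubic_out q).side_ne x
      refine ⟨⟨q, ψ x⟩, huniq ⟨q, ψ x⟩ _ _ (he _) ⟨_, hadd.symm.trans h1, ?_, ?_⟩⟩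
      · rw [Equiv.trans_apply, ← h3]
        congr 1
        rw [Equiv.symm_apply_eq]
        exact congrArg Sum.inl g2.symm
      · rw [Equiv.trans_apply, ← h2]
        congr 1
  have hsum : ∑ a : A, g (grow a.1 a.2) = ∑ b : B, g b.1.1 :=
    Fintype.sum_bijective e hbij _ _ fun a => by rw [hcls a _ (he a)]
  rw [Fintype.sum_sigma, Fintype.sum_sigma] at hsum
  rw [hsum, Finset.mul_sum]
  refine Finset.sum_congr rfl fun q _ => ?_
  change _ = ∑ _y : NonrootLeaf q.1.out.toMap q.1.out.root, g q.1
  rw [Finset.sum_const, Finset.card_univ, card_nonrootLeaf (isLeafyCubic_out q), nsmul_eq_mul]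
  push_cast
  ring

theorem card_leafyClasses_succ {S : Surface} (hS : S.eulerChar ≤ 0) (n : ℕ) :
    2 * n * (Fintype.card (leafyClasses S (n + 1)) : ℝ) =
      (8 * n - 12 * S.eulerChar) * Fintype.card (leafyClasses S n) := by
  have h := sum_leafyClasses_succ hS n fun _ => 1
  simp only [Finset.sum_const, Finset.card_univ, nsmul_eq_mul, mul_one, Fintype.card_fin] at h
  rw [h]
  have : ∀ q : leafyClasses S n, (q.1.out.numFlags : ℝ) = 8 * n - 12 * S.eulerChar := fun q => by
    have := (isLeafyCubic_out q).card_flag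
    rw [Nat.card_eq_fintype_card, Fintype.card_fin] at this
    exact_mod_cast this
  rw [Finset.sum_congr rfl fun q _ => this q, Finset.sum_const, Finset.card_univ, nsmul_eq_mul,
    mul_comm]

/-! ### Leafless faces and their weight. -/

namespace CombMap

variable {F F' : Type*}

noncomputable instance [Finite F] (M : CombMap F) : Fintype M.Face := Fintype.ofFinite _

/-- There is no vertex of degree one along the face. -/
def Leafless (M : CombMap F) (f : M.Face) : Prop := ∀ z, M.faceOf z = f → ¬ M.IsLeaf z

/-- The number of flags of the face whose edge has another face on its other side. -/
noncomputable def outerDegree (M : CombMap F) (f : M.Face) : ℕ :=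
  {z | M.faceOf z = f ∧ M.faceOf (M.sideFlip z) ≠ f}.ncard

open Classical in
/-- The faces without leaves, weighted by their outer degrees. -/
noncomputable def leaflessWeight [Finite F] (M : CombMap F) (y : ℝ) : ℝ :=
  ∑ f : M.Face, if M.Leafless f then y ^ (M.outerDegree f / 2) else 0

theorem leaflessWeight_iso [Finite F] [Finite F'] {M : CombMap F} {M' : CombMap F'} {φ : F ≃ F'}
    (h : IsIso M M' φ) (y : ℝ) : M.leaflessWeight y = M'.leaflessWeight y := by
  refine Fintype.sum_equiv h.faceEquiv _ _ fun f => ?_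
  have hf : ∀ z, M'.faceOf (φ z) = h.faceEquiv f ↔ M.faceOf z = f := fun z => by
    rw [← h.faceEquiv_faceOf, h.faceEquiv.apply_eq_iff_eq]
  have h1 : M.Leafless f ↔ M'.Leafless (h.faceEquiv f) := by
    refine φ.forall_congr fun {z} => ?_
    rw [hf, h.isLeaf_iff]
  have h2 : M.outerDegree f = M'.outerDegree (h.faceEquiv f) := by
    rw [outerDegree, outerDegree, ← Nat.card_coe_set_eq, ← Nat.card_coe_set_eq]
    refine Nat.card_congr (φ.subtypeEquiv fun z => ?_)
    simp only [Set.mem_ofPred_eq]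
    rw [hf, ← h.map_side, Ne, Ne, hf]
  by_cases hl : M.Leafless f
  · rw [if_pos hl, if_pos (h1.1 hl), h2]
  · rw [if_neg hl, if_neg fun hl' => hl (h1.2 hl')]

theorem addLeaf_leafless_iff (M : CombMap F) (hs : ∀ x, M.sideFlip x ≠ x) (x : F)
    (f : (M.addLeaf hs x).Face) : (M.addLeaf hs x).Leafless f ↔
      M.Leafless (M.addLeafFace hs x f) ∧ M.addLeafFace hs x f ≠ M.faceOf x := by
  have hf : ∀ z, (M.addLeaf hs x).faceOf z = f ↔
      Sum.elim M.faceOf (M.spurFace x) z = M.addLeafFace hs x f := fun z => by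
    rw [← addLeafFace_faceOf M hs, (M.addLeafFace hs x).apply_eq_iff_eq]
  simp only [Leafless, hf]
  constructor
  · intro h
    refine ⟨fun z hz hl => h (.inl z) hz ((addLeaf_isLeaf_inl _ _ _ _).2 hl), fun e => ?_⟩
    exact h (.inr .a0) e.symm ((addLeaf_isLeaf_inr _ _ _ _).2 (Or.inl rfl))
  · rintro ⟨h1, h2⟩ (z | i) hz hl
    · exact h1 z hz ((addLeaf_isLeaf_inl _ _ _ _).1 hl)
    · rcases (addLeaf_isLeaf_inr _ _ _ _).1 hl with rfl | rfl <;> exact h2 hz.symm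

open Classical in
-- A leaf attached across an edge of `f` subdivides that edge, and the side in `f` gains the flags
-- `x1` and `y1`. An outer side has two flags, whence the halved exponent in `leaflessWeight`.
theorem addLeaf_outerDegree [Finite F] (M : CombMap F) (hs : ∀ x, M.sideFlip x ≠ x) (x : F)
    (f : (M.addLeaf hs x).Face) (hx : M.addLeafFace hs x f ≠ M.faceOf x) :
    (M.addLeaf hs x).outerDegree f = M.outerDegree (M.addLeafFace hs x f) +
      if M.addLeafFace hs x f = M.faceOf (M.sideFlip x) then 2 else 0 := by
  have hf : ∀ z, (M.addLeaf hs x).faceOf z = f ↔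
      Sum.elim M.faceOf (M.spurFace x) z = M.addLeafFace hs x f := fun z => by
    rw [← addLeafFace_faceOf M hs, (M.addLeafFace hs x).apply_eq_iff_eq]
  set f' := M.addLeafFace hs x f
  have e : {z | (M.addLeaf hs x).faceOf z = f ∧
      (M.addLeaf hs x).faceOf ((M.addLeaf hs x).sideFlip z) ≠ f} ≃
      {z | M.faceOf z = f' ∧ M.faceOf (M.sideFlip z) ≠ f'} ⊕
        {i | M.spurFace x i = f' ∧ M.spurFace x (spurSide i) ≠ f'} :=
    (Equiv.subtypeSum).trans (Equiv.sumCongr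
      (Equiv.subtypeEquivRight fun z => by simp only [Set.mem_ofPred_eq, Ne, hf]; rfl)
      (Equiv.subtypeEquivRight fun z => by simp only [Set.mem_ofPred_eq, Ne, hf]; rfl))
  rw [outerDegree, ← Nat.card_coe_set_eq, Nat.card_congr e, Nat.card_sum, Nat.card_coe_set_eq,
    Nat.card_coe_set_eq, outerDegree]
  congr 1
  split_ifs with h
  · have : {i | M.spurFace x i = f' ∧ M.spurFace x (spurSide i) ≠ f'} = {Spur.x1, Spur.y1} := by
      ext i
      cases i <;> simp [spurFace, spurSide, hx.symm, ← h]
    rw [this, Set.ncard_pair (by simp)]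
  · have : {i | M.spurFace x i = f' ∧ M.spurFace x (spurSide i) ≠ f'} = ∅ := by
      ext i
      cases i <;> simp [spurFace, hx.symm, Ne.symm h]
    rw [this, Set.ncard_empty]

open Classical in
theorem addLeaf_leaflessWeight [Finite F] (M : CombMap F) (hs : ∀ x, M.sideFlip x ≠ x) (x : F)
    (y : ℝ) : (M.addLeaf hs x).leaflessWeight y = ∑ f : M.Face, if M.Leafless f then
      if M.faceOf x = f then 0 else
        if M.faceOf (M.sideFlip x) = f then y ^ (M.outerDegree f / 2 + 1)
        else y ^ (M.outerDegree f / 2)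
      else 0 := by
  refine Fintype.sum_equiv (M.addLeafFace hs x) _ _ fun f => ?_
  rw [addLeaf_leafless_iff]
  by_cases h1 : M.Leafless (M.addLeafFace hs x f)
  · by_cases h2 : M.addLeafFace hs x f = M.faceOf x
    · simp [h2]
    · rw [addLeaf_outerDegree M hs x f h2]
      rw [if_pos ⟨h1, h2⟩, if_pos h1, if_neg (Ne.symm h2)]
      by_cases h3 : M.faceOf (M.sideFlip x) = M.addLeafFace hs x f
      · rw [if_pos h3, if_pos h3.symm, Nat.add_div_right _ (by norm_num)]
      · rw [if_neg h3, if_neg (Ne.symm h3), add_zero]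
  · simp [h1]

/-- `sideFlip` exchanges the outer flags of `f` with the flags facing `f` from outside. Both are
disjoint from the flags of edges with no side in `f`. -/
theorem ncard_side_faces_le [Finite F] (M : CombMap F) (f : M.Face) :
    {x | M.faceOf x ≠ f ∧ M.faceOf (M.sideFlip x) = f}.ncard = M.outerDegree f ∧
      {x | M.faceOf x ≠ f ∧ M.faceOf (M.sideFlip x) ≠ f}.ncard + 2 * M.outerDegree f ≤
        Nat.card F := by
  have h1 : {x | M.faceOf x ≠ f ∧ M.faceOf (M.sideFlip x) = f}.ncard = M.outerDegree f := by
    rw [outerDegree, ← Nat.card_coe_set_eq, ← Nat.card_coe_set_eq]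
    refine Nat.card_congr (M.sideFlip.subtypeEquiv fun z => ?_)
    simp only [Set.mem_ofPred_eq, M.sideFlip_sideFlip]
    exact and_comm
  refine ⟨h1, ?_⟩
  rw [two_mul, ← add_assoc]
  nth_rewrite 1 [← h1]
  rw [outerDegree, ← Set.ncard_union_eq, ← Set.ncard_union_eq, ← Set.ncard_univ]
  · exact Set.ncard_le_ncard (Set.subset_univ _)
  · rw [Set.disjoint_left]
    rintro z (⟨h, -⟩ | ⟨h, -⟩) ⟨h', -⟩ <;> exact h h'
  · rw [Set.disjoint_left]
    rintro z ⟨-, h⟩ ⟨-, h'⟩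
    exact h h'

open Classical in
-- Let `f` be leafless of outer degree `d`, and let there be `N` flags. A leaf at a flag of `f`
-- cancels its term, a leaf at one of the `d` flags facing `f` multiplies it by `y`, and any other
-- leaf keeps it. The sum is thus at most `y^(d/2) (N - d (2 - y))`, which Bernoulli's inequality
-- compares with `N` times the same power of a smaller number.
theorem sum_addLeaf_leaflessWeight_le [Fintype F] (M : CombMap F) (hs : ∀ x, M.sideFlip x ≠ x)
    {y : ℝ} (h0 : 0 ≤ y) (h1 : y ≤ 1) (hF : 2 ≤ Nat.card F) :
    ∑ x, (M.addLeaf hs x).leaflessWeight y ≤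
      Nat.card F * M.leaflessWeight (y * (1 - (2 - y) / (Nat.card F / 2))) := by
  simp only [addLeaf_leaflessWeight]
  rw [Finset.sum_comm, leaflessWeight, Finset.mul_sum]
  refine Finset.sum_le_sum fun f _ => ?_
  by_cases hf : M.Leafless f
  swap
  · simp [hf]
  simp only [hf, if_true]
  set d := M.outerDegree f
  obtain ⟨hA, hC⟩ := M.ncard_side_faces_le f
  have hsum : (∑ x, if M.faceOf x = f then (0 : ℝ) else
        if M.faceOf (M.sideFlip x) = f then y ^ (d / 2 + 1) else y ^ (d / 2)) =
      d * y ^ (d / 2 + 1) +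
        {x | M.faceOf x ≠ f ∧ M.faceOf (M.sideFlip x) ≠ f}.ncard * y ^ (d / 2) := by
    have e : ∀ x, (if M.faceOf x = f then (0 : ℝ) else
        if M.faceOf (M.sideFlip x) = f then y ^ (d / 2 + 1) else y ^ (d / 2)) =
        (if M.faceOf x ≠ f ∧ M.faceOf (M.sideFlip x) = f then y ^ (d / 2 + 1) else 0) +
        (if M.faceOf x ≠ f ∧ M.faceOf (M.sideFlip x) ≠ f then y ^ (d / 2) else 0) := by
      intro x
      by_cases a : M.faceOf x = f <;> by_cases b : M.faceOf (M.sideFlip x) = f <;> simp [a, b]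
    have c1 : (Finset.univ.filter fun x => M.faceOf x ≠ f ∧ M.faceOf (M.sideFlip x) = f).card =
        d := by
      rw [show d = _ from hA.symm, ← Set.ncard_coe_finset]
      simp
    rw [Finset.sum_congr rfl fun x _ => e x, Finset.sum_add_distrib, ← Finset.sum_filter,
      ← Finset.sum_filter, Finset.sum_const, Finset.sum_const, nsmul_eq_mul, nsmul_eq_mul, c1,
      ← Set.ncard_coe_finset]
    simp
  rw [hsum]
  set C := {x | M.faceOf x ≠ f ∧ M.faceOf (M.sideFlip x) ≠ f}.ncard
  have hC' : (C : ℝ) ≤ Nat.card F - 2 * d := by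
    have : ((C + 2 * d : ℕ) : ℝ) ≤ Nat.card F := by exact_mod_cast hC
    push_cast at this
    linarith
  have hN : (2 : ℝ) ≤ Nat.card F := by exact_mod_cast hF
  set N : ℝ := (Nat.card F : ℝ)
  set h := d / 2
  have hd : 2 * (h : ℝ) ≤ d := by
    have : 2 * h ≤ d := Nat.mul_div_le d 2
    exact_mod_cast this
  have hy : 0 ≤ y ^ h := pow_nonneg h0 h
  -- Bernoulli's inequality; it needs `(2 - y) / (N / 2) ≤ 2`, which holds as `N ≥ 2`.
  have hB : 1 + h * (-((2 - y) / (N / 2))) ≤ (1 + -((2 - y) / (N / 2))) ^ h := by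
    refine one_add_mul_le_pow ?_ h
    have : (2 - y) / (N / 2) ≤ 2 := by
      rw [div_le_iff₀ (by linarith)]
      linarith
    linarith
  calc d * y ^ (h + 1) + C * y ^ h ≤ y ^ h * (N - d * (2 - y)) := by
        rw [pow_succ]
        nlinarith [mul_le_mul_of_nonneg_right hC' hy]
    _ ≤ y ^ h * (N - (2 * h) * (2 - y)) := by
        refine mul_le_mul_of_nonneg_left ?_ hy
        nlinarith
    _ = N * (y ^ h * (1 + h * (-((2 - y) / (N / 2))))) := by
        field_simp
        ring
    _ ≤ N * (y ^ h * (1 + -((2 - y) / (N / 2))) ^ h) := by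
        refine mul_le_mul_of_nonneg_left (mul_le_mul_of_nonneg_left hB hy) (by linarith)
    _ = N * (y * (1 - (2 - y) / (N / 2))) ^ h := by rw [mul_pow]; ring

theorem leaflessWeight_mono [Finite F] (M : CombMap F) {y y' : ℝ} (h0 : 0 ≤ y) (h : y ≤ y') :
    M.leaflessWeight y ≤ M.leaflessWeight y' := by
  refine Finset.sum_le_sum fun f _ => ?_
  split_ifs
  · exact pow_le_pow_left₀ h0 h _
  · exact le_rfl

/-- If `sideFlip` never left `f`, connectedness would put every flag in `f`, including the root
leaf. An outer side contributes both of its flags. -/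
theorem IsLeafyCubic.two_le_outerDegree [Finite F] {S : Surface} {n : ℕ} {M : CombMap F} {r : F}
    (h : IsLeafyCubic S n M r) {f : M.Face} (hf : M.Leafless f) : 2 ≤ M.outerDegree f := by
  obtain ⟨z, hz, hz'⟩ : ∃ z, M.faceOf z = f ∧ M.faceOf (M.sideFlip z) ≠ f := by
    by_contra! hcon
    obtain ⟨z₀, hz₀⟩ := PairOrbit.mk_surjective f
    exact hf r (h.reaches.mem_of_mem (p := fun z => M.faceOf z = f) hz₀
      (fun z hz => by rw [faceOf_endFlip, hz]) (fun z hz => by rw [faceOf_cornerFlip, hz])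
      hcon r) h.root
  refine (Set.one_lt_ncard_iff).2 ⟨z, M.endFlip z, ⟨hz, hz'⟩, ⟨?_, ?_⟩, (M.endFlip_ne z).symm⟩
  · rw [faceOf_endFlip, hz]
  · rwa [← M.endFlip_sideFlip, faceOf_endFlip]

theorem IsLeafyCubic.leaflessWeight_le [Finite F] {S : Surface} {n : ℕ} {M : CombMap F} {r : F}
    (h : IsLeafyCubic S n M r) {y : ℝ} (h0 : 0 ≤ y) (h1 : y ≤ 1) :
    M.leaflessWeight y ≤ S.β * y := by
  classical
  have : ∀ f ∈ (Finset.univ : Finset M.Face),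
      (if M.Leafless f then y ^ (M.outerDegree f / 2) else 0) ≤ y := by
    intro f _
    split_ifs with hf
    · have := h.two_le_outerDegree hf
      exact pow_le_of_le_one h0 h1 (by omega)
    · exact h0
  refine (Finset.sum_le_sum this).trans ?_
  rw [Finset.sum_const, Finset.card_univ, nsmul_eq_mul, ← Nat.card_eq_fintype_card, h.card_face]

theorem one_le_leaflessWeight_one [Finite F] {M : CombMap F} {f : M.Face} (hf : M.Leafless f) :
    1 ≤ M.leaflessWeight 1 := by
  classical
  have := Finset.single_le_sum (f := fun f : M.Face => if M.Leafless f then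
    (1 : ℝ) ^ (M.outerDegree f / 2) else 0) (fun f _ => by positivity) (Finset.mem_univ f)
  simp only [hf, if_true, one_pow] at this
  exact this.trans (le_of_eq (Finset.sum_congr rfl fun f _ => by rw [one_pow]))

end CombMap

/-! ### Decay of the total weight. -/

/-- The number of flags of the leafy cubic maps with `n` leaves. -/
def flagCount (S : Surface) (n : ℕ) : ℝ := 8 * n - 12 * S.eulerChar

theorem flagCount_succ (S : Surface) (n : ℕ) : flagCount S (n + 1) = flagCount S n + 8 := by
  simp only [flagCount]; push_cast; ring

theorem flagCount_ge {S : Surface} (hS : S.eulerChar ≤ 0) (n : ℕ) : 8 * n ≤ flagCount S n := by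
  have : (S.eulerChar : ℝ) ≤ 0 := by exact_mod_cast hS
  simp only [flagCount]; linarith

theorem natCard_flags {S : Surface} {n : ℕ} (q : leafyClasses S n) :
    (Nat.card (Fin q.1.out.numFlags) : ℝ) = flagCount S n := by
  have := (isLeafyCubic_out q).card_flag
  rw [flagCount]
  exact_mod_cast this

/-- The total weight of the leafless faces of the maps with `n` leaves. -/
noncomputable def totalWeight (S : Surface) (n : ℕ) (y : ℝ) : ℝ :=
  ∑ q : leafyClasses S n, q.1.out.toMap.leaflessWeight y

theorem totalWeight_mono (S : Surface) (n : ℕ) {y y' : ℝ} (h0 : 0 ≤ y) (h : y ≤ y') :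
    totalWeight S n y ≤ totalWeight S n y' :=
  Finset.sum_le_sum fun q _ => q.1.out.toMap.leaflessWeight_mono h0 h

theorem totalWeight_succ_le {S : Surface} (hS : S.eulerChar ≤ 0) {n : ℕ} (hn : 1 ≤ n) {y : ℝ}
    (h0 : 0 ≤ y) (h1 : y ≤ 1) : 2 * n * totalWeight S (n + 1) y ≤
      flagCount S n * totalWeight S n (y * (1 - (2 - y) / (flagCount S n / 2))) := by
  have h := sum_leafyClasses_succ hS n fun q => q.out.toMap.leaflessWeight y
  rw [totalWeight, h, totalWeight, Finset.mul_sum]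
  refine Finset.sum_le_sum fun q _ => ?_
  have hq := isLeafyCubic_out q
  have hN := natCard_flags q
  have hw : ∀ x, (grow q x).out.toMap.leaflessWeight y =
      (q.1.out.toMap.addLeaf hq.side_ne x).leaflessWeight y := fun x => by
    obtain ⟨Φ, h, -⟩ := pointedIso_out (q.1.out.toMap.addLeaf hq.side_ne x) (.inl q.1.out.root)
    exact (leaflessWeight_iso h y).symm
  rw [Finset.sum_congr rfl fun x _ => hw x, ← hN]
  refine sum_addLeaf_leaflessWeight_le _ hq.side_ne h0 h1 ?_
  have : (2 : ℝ) ≤ Nat.card (Fin q.1.out.numFlags) := by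
    rw [hN]
    have := flagCount_ge hS n
    have : (1 : ℝ) ≤ n := by exact_mod_cast hn
    linarith
  exact_mod_cast this

/-- One removal decreases `y` by `2 y (2 - y) / G` while the number of flags drops from `G + 8` to
`G`. The continuous analogue `dy/dG = y (2 - y) / (4G)` has the solutions `2 / (1 + √(T/G))`, and
the discrete step stays below them. -/
theorem weight_step {G T : ℝ} (hG : 8 ≤ G) (hT : 0 ≤ T) :
    2 / (1 + √(T / (G + 8))) * (1 - (2 - 2 / (1 + √(T / (G + 8)))) / (G / 2)) ≤
      2 / (1 + √(T / G)) := by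
  set g' := √(T / (G + 8)) with hg'
  have hg'0 : 0 ≤ g' := Real.sqrt_nonneg _
  -- This is `√(1 + 8/G) ≤ 1 + 4/G`.
  have hg : √(T / G) ≤ g' * (1 + 4 / G) := by
    rw [Real.sqrt_le_iff]
    refine ⟨by positivity, ?_⟩
    rw [mul_pow, hg', Real.sq_sqrt (by positivity), div_mul_eq_mul_div, div_le_div_iff₀ (by linarith)
      (by linarith), mul_assoc]
    refine mul_le_mul_of_nonneg_left ?_ hT
    have : (1 + 4 / G) ^ 2 * G = G + 8 + 16 / G := by field_simp; ring
    rw [this]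
    have : 0 ≤ 16 / G := by positivity
    linarith
  have h1 : 2 / (1 + g' * (1 + 4 / G)) ≤ 2 / (1 + √(T / G)) :=
    div_le_div_of_nonneg_left (by norm_num) (by positivity) (by linarith)
  refine le_trans ?_ h1
  have e : 2 / (1 + g') * (1 - (2 - 2 / (1 + g')) / (G / 2)) =
      2 * ((1 + g') - 4 * g' / G) / (1 + g') ^ 2 := by
    field_simp
    ring
  rw [e, div_le_div_iff₀ (by positivity) (by positivity)]
  have : (1 + g' * (1 + 4 / G)) = (1 + g') + 4 * g' / G := by ring
  rw [this]
  -- With `w = 4 * g' / G`, this is `(1 + g' - w) (1 + g' + w) ≤ (1 + g')^2`.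
  nlinarith [sq_nonneg (4 * g' / G)]

/-- The parameter `T` labels the curve and stays fixed in the induction, while `n` descends to one.
There each of the `β` faces weighs at most `y`. -/
theorem totalWeight_le {S : Surface} (hS : S.eulerChar ≤ 0) {n : ℕ} (hn : 1 ≤ n) :
    ∀ T : ℝ, flagCount S n ≤ T → totalWeight S n (2 / (1 + √(T / flagCount S n))) ≤
      S.β * Fintype.card (leafyClasses S n) * (2 / (1 + √(T / flagCount S 1))) := by
  have ypos : ∀ {n : ℕ} {T : ℝ}, 1 ≤ n → flagCount S n ≤ T →
      0 ≤ 2 / (1 + √(T / flagCount S n)) ∧ 2 / (1 + √(T / flagCount S n)) ≤ 1 := by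
    intro n T hn hT
    have h2 := flagCount_ge hS n
    have : (1 : ℝ) ≤ n := by exact_mod_cast hn
    refine ⟨by positivity, ?_⟩
    rw [div_le_one (by positivity)]
    have : 1 ≤ √(T / flagCount S n) := by
      rw [Real.one_le_sqrt, one_le_div (by linarith)]
      exact hT
    linarith
  induction n, hn using Nat.le_induction with
  | base =>
    intro T hT
    obtain ⟨h0, h1⟩ := ypos le_rfl hT
    refine (Finset.sum_le_sum fun q _ => (isLeafyCubic_out q).leaflessWeight_le h0 h1).trans ?_
    rw [Finset.sum_const, Finset.card_univ, nsmul_eq_mul]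
    exact le_of_eq (by ring)
  | succ n hn ih =>
    intro T hT
    have hG := flagCount_ge hS n
    have hn' : (1 : ℝ) ≤ n := by exact_mod_cast hn
    obtain ⟨h0, h1⟩ := ypos (by omega) hT
    have hs := flagCount_succ S n
    have hstep := totalWeight_succ_le hS hn h0 h1
    have hcard := card_leafyClasses_succ hS n
    have hy := weight_step (G := flagCount S n) (T := T) (by linarith) (by linarith)
    rw [← hs] at hy
    set y := 2 / (1 + √(T / flagCount S (n + 1)))
    have hy0 : 0 ≤ y * (1 - (2 - y) / (flagCount S n / 2)) := by
      refine mul_nonneg h0 ?_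
      rw [sub_nonneg, div_le_one (by linarith)]
      linarith
    have h3 := (totalWeight_mono S n hy0 hy).trans (ih T (by linarith))
    have h4 := hstep.trans (mul_le_mul_of_nonneg_left h3 (by linarith))
    have h5 : (2 * n : ℝ) * totalWeight S (n + 1) y ≤ (2 * n) * (S.β *
        Fintype.card (leafyClasses S (n + 1)) * (2 / (1 + √(T / flagCount S 1)))) := by
      refine h4.trans (le_of_eq ?_)
      have : flagCount S n * Fintype.card (leafyClasses S n) =
          2 * n * Fintype.card (leafyClasses S (n + 1)) := hcard.symm
      linear_combination (S.β * (2 / (1 + √(T / flagCount S 1)))) * this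
    exact le_of_mul_le_mul_left h5 (by linarith)

theorem totalWeight_one_le {S : Surface} (hS : S.eulerChar ≤ 0) {n : ℕ} (hn : 1 ≤ n) :
    totalWeight S n 1 ≤
      S.β * Fintype.card (leafyClasses S n) * (2 * √(flagCount S 1) / √n) := by
  have hn' : (1 : ℝ) ≤ n := by exact_mod_cast hn
  have hG := flagCount_ge hS n
  have hG1 := flagCount_ge hS 1
  push_cast at hG1
  -- `T = flagCount S n` selects the curve with `y = 1` at `n` leaves.
  have h := totalWeight_le hS hn _ le_rfl
  rw [div_self (ne_of_gt (by linarith)), Real.sqrt_one, show (2 : ℝ) / (1 + 1) = 1 by norm_num] at h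
  refine h.trans (mul_le_mul_of_nonneg_left ?_ (by positivity))
  have h1 : √n / √(flagCount S 1) ≤ 1 + √(flagCount S n / flagCount S 1) := by
    rw [← Real.sqrt_div' _ (by linarith)]
    have : √(n / flagCount S 1) ≤ √(flagCount S n / flagCount S 1) :=
      Real.sqrt_le_sqrt (div_le_div_of_nonneg_right (by linarith) (by linarith))
    linarith
  have h2 : 0 < √(flagCount S 1) := Real.sqrt_pos.2 (by linarith)
  have h3 : (0 : ℝ) < √n := Real.sqrt_pos.2 (by linarith)
  calc 2 / (1 + √(flagCount S n / flagCount S 1)) ≤ 2 / (√n / √(flagCount S 1)) :=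
        div_le_div_of_nonneg_left (by norm_num) (by positivity) h1
    _ = 2 * √(flagCount S 1) / √n := by field_simp

/-! ### Asymptotics of the recursion by Gamma functions. -/

/-- `Γ(n + s) / (Γ(n) n ^ s)`. -/
noncomputable def gammaRatio (s : ℝ) (n : ℕ) : ℝ :=
  Real.Gamma (n + s) / (Real.Gamma n * (n : ℝ) ^ s)

theorem isBigO_inv_sqrt :
    (fun n : ℕ => 1 / (n : ℝ)) =O[atTop] fun n : ℕ => (n : ℝ) ^ (-(1 / 2) : ℝ) := by
  refine IsBigO.of_bound 1 ?_
  filter_upwards [eventually_ge_atTop 1] with n hn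
  have hn' : (1 : ℝ) ≤ n := by exact_mod_cast hn
  rw [one_mul, Real.norm_of_nonneg (by positivity), Real.norm_of_nonneg (by positivity), one_div,
    ← Real.rpow_neg_one]
  exact Real.rpow_le_rpow_of_exponent_le hn' (by norm_num)

theorem gammaRatio_zero_sub_one :
    (fun n => gammaRatio 0 n - 1) =O[atTop] fun n : ℕ => (n : ℝ) ^ (-(1 / 2) : ℝ) := by
  have h0 : (fun _ : ℕ => (0 : ℝ)) =O[atTop] fun n : ℕ => (n : ℝ) ^ (-(1 / 2) : ℝ) :=
    isBigO_zero _ _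
  refine EventuallyEq.trans_isBigO ?_ h0
  filter_upwards [eventually_ge_atTop 1] with n hn
  have hn' : (0 : ℝ) < n := by exact_mod_cast hn
  have := Real.Gamma_pos_of_pos hn'
  rw [gammaRatio, add_zero, Real.rpow_zero, mul_one, div_self this.ne', sub_self]

/-- Log-convexity of `Γ` between `y` and `y + 1`, taken at `y = x` for the upper bound and at `y = x
+ 1/2` for the lower one. -/
theorem gamma_add_half_bounds {x : ℝ} (hx : 0 < x) :
    x / √(x + 1 / 2) * Real.Gamma x ≤ Real.Gamma (x + 1 / 2) ∧
      Real.Gamma (x + 1 / 2) ≤ √x * Real.Gamma x := by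
  have key : ∀ y : ℝ, 0 < y → Real.Gamma (y + 1 / 2) ≤ √y * Real.Gamma y := by
    intro y hy
    have h := Real.Gamma_mul_add_mul_le_rpow_Gamma_mul_rpow_Gamma (s := y) (t := y + 1)
      (a := 1 / 2) (b := 1 / 2) hy (by linarith) (by norm_num) (by norm_num) (by norm_num)
    rw [Real.Gamma_add_one hy.ne', ← Real.sqrt_eq_rpow, ← Real.sqrt_eq_rpow,
      show 1 / 2 * y + 1 / 2 * (y + 1) = y + 1 / 2 by ring, Real.sqrt_mul hy.le] at h
    refine h.trans (le_of_eq ?_)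
    have := Real.mul_self_sqrt (Real.Gamma_pos_of_pos hy).le
    linear_combination √y * this
  refine ⟨?_, key x hx⟩
  have h := key (x + 1 / 2) (by linarith)
  rw [show x + 1 / 2 + 1 / 2 = x + 1 by ring, Real.Gamma_add_one hx.ne'] at h
  have hp : 0 < √(x + 1 / 2) := Real.sqrt_pos.2 (by linarith)
  rw [div_mul_eq_mul_div, div_le_iff₀ hp]
  linarith

theorem gammaRatio_half_sub_one :
    (fun n => gammaRatio (1 / 2) n - 1) =O[atTop] fun n : ℕ => (n : ℝ) ^ (-(1 / 2) : ℝ) := by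
  refine IsBigO.trans (IsBigO.of_bound 1 ?_) isBigO_inv_sqrt
  filter_upwards [eventually_ge_atTop 1] with n hn
  have hn' : (0 : ℝ) < n := by exact_mod_cast hn
  obtain ⟨h1, h2⟩ := gamma_add_half_bounds hn'
  have hG := Real.Gamma_pos_of_pos hn'
  have hs : 0 < √(n : ℝ) := Real.sqrt_pos.2 hn'
  have hs' : 0 < √((n : ℝ) + 1 / 2) := Real.sqrt_pos.2 (by linarith)
  have hsq := Real.mul_self_sqrt hn'.le
  have hsq' := Real.mul_self_sqrt (show (0 : ℝ) ≤ n + 1 / 2 by linarith)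
  have hle : √(n : ℝ) ≤ √((n : ℝ) + 1 / 2) := Real.sqrt_le_sqrt (by linarith)
  rw [gammaRatio, ← Real.sqrt_eq_rpow, one_mul, Real.norm_eq_abs, Real.norm_of_nonneg
    (by positivity), abs_le]
  constructor
  · have h3 : √(n : ℝ) / √((n : ℝ) + 1 / 2) ≤ Real.Gamma (n + 1 / 2) / (Real.Gamma n * √n) := by
      rw [le_div_iff₀ (by positivity)]
      refine le_trans (le_of_eq ?_) h1
      rw [div_mul_eq_mul_div, div_mul_eq_mul_div]
      congr 1
      linear_combination Real.Gamma n * hsq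
    have h4 : 1 - 1 / (n : ℝ) ≤ √(n : ℝ) / √((n : ℝ) + 1 / 2) := by
      rw [le_div_iff₀ hs', sub_mul, one_mul, sub_le_iff_le_add, one_div_mul_eq_div,
        ← sub_le_iff_le_add', le_div_iff₀ hn']
      nlinarith
    linarith
  · have h3 : Real.Gamma (n + 1 / 2) / (Real.Gamma n * √n) ≤ 1 := by
      rw [div_le_one (by positivity), mul_comm]
      exact h2
    have : 0 ≤ 1 / (n : ℝ) := by positivity
    linarith

theorem gammaRatio_add_one_sub_one {s : ℝ} (hs : 0 ≤ s)
    (h : (fun n => gammaRatio s n - 1) =O[atTop] fun n : ℕ => (n : ℝ) ^ (-(1 / 2) : ℝ)) :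
    (fun n => gammaRatio (s + 1) n - 1) =O[atTop] fun n : ℕ => (n : ℝ) ^ (-(1 / 2) : ℝ) := by
  -- The functional equation of `Γ` gives `gammaRatio (s + 1) n = gammaRatio s n * (1 + s / n)`.
  have h1 : (fun n : ℕ => (gammaRatio s n - 1) * (1 + s / n) + s * (1 / n)) =O[atTop]
      fun n : ℕ => (n : ℝ) ^ (-(1 / 2) : ℝ) := by
    refine IsBigO.add ?_ (isBigO_inv_sqrt.const_mul_left s)
    have h2 : (fun n : ℕ => 1 + s / (n : ℝ)) =O[atTop] fun _ : ℕ => (1 : ℝ) := by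
      refine IsBigO.of_bound (1 + s) ?_
      filter_upwards [eventually_ge_atTop 1] with n hn
      have hn' : (1 : ℝ) ≤ n := by exact_mod_cast hn
      rw [Real.norm_of_nonneg (by positivity), norm_one, mul_one]
      have := div_le_self hs hn'
      linarith
    simpa using h.mul h2
  refine EventuallyEq.trans_isBigO ?_ h1
  filter_upwards [eventually_ge_atTop 1] with n hn
  have hn' : (0 : ℝ) < n := by exact_mod_cast hn
  have hG := Real.Gamma_pos_of_pos hn'
  rw [gammaRatio, gammaRatio, ← add_assoc, Real.Gamma_add_one (by positivity),
    Real.rpow_add_one hn'.ne']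
  have := Real.rpow_pos_of_pos hn' s
  field_simp
  ring

/-- Half-integers suffice, since `χ` is an integer; steps of one start from both `0` and `1/2`. -/
theorem gammaRatio_sub_one (k : ℕ) :
    (fun n => gammaRatio (k / 2) n - 1) =O[atTop] fun n : ℕ => (n : ℝ) ^ (-(1 / 2) : ℝ) := by
  induction k using Nat.twoStepInduction with
  | zero => simpa using gammaRatio_zero_sub_one
  | one => simpa using gammaRatio_half_sub_one
  | more k h _ =>
    have := gammaRatio_add_one_sub_one (by positivity) h
    convert this using 3
    push_cast
    ring_nf

theorem eq_gammaRatio_of_rec {N : ℕ → ℝ} {s : ℝ} (hs : 0 ≤ s)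
    (h : ∀ n : ℕ, 1 ≤ n → n * N (n + 1) = 4 * (n + s) * N n) {n : ℕ} (hn : 1 ≤ n) :
    N n = N 1 / (4 * Real.Gamma (1 + s)) * (n : ℝ) ^ s * 4 ^ n * gammaRatio s n := by
  have key : ∀ n : ℕ, 1 ≤ n → N n * (4 * Real.Gamma (1 + s) * Real.Gamma n) =
      N 1 * 4 ^ n * Real.Gamma (n + s) := by
    intro n hn
    induction n, hn using Nat.le_induction with
    | base => simp; ring
    | succ n hn ih =>
      have hn' : (0 : ℝ) < n := by exact_mod_cast hn
      push_cast
      rw [Real.Gamma_add_one hn'.ne', show (n : ℝ) + 1 + s = (n + s) + 1 by ring,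
        Real.Gamma_add_one (by positivity), pow_succ]
      linear_combination (4 * Real.Gamma (1 + s) * Real.Gamma n) * h n hn + (4 * (n + s)) * ih
  have hn' : (0 : ℝ) < n := by exact_mod_cast hn
  have h1 := Real.Gamma_pos_of_pos hn'
  have h2 := Real.Gamma_pos_of_pos (show 0 < 1 + s by linarith)
  have h3 := Real.rpow_pos_of_pos hn' s
  have := key n hn
  rw [gammaRatio]
  field_simp
  linear_combination this

/-- Two relative errors of order `n^(-1/2)` are added: that of the Gamma ratio in `N`, and that of
replacing `N` by `M`. -/
theorem exists_error_term {N M : ℕ → ℝ} {k : ℕ} {C : ℝ}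
    (h : ∀ n : ℕ, 1 ≤ n → n * N (n + 1) = 4 * (n + k / 2) * N n)
    (hM : ∀ n : ℕ, 1 ≤ n → |N n - M n| ≤ C * |N n| / √n) :
    ∃ ε : ℕ → ℝ, ε =O[atTop] (fun n : ℕ => (n : ℝ) ^ (-(1 / 2) : ℝ)) ∧
      ∀ᶠ n : ℕ in atTop,
        M n = N 1 / (4 * Real.Gamma (1 + k / 2)) * (n : ℝ) ^ (k / 2 : ℝ) * 4 ^ n * (1 + ε n) := by
  have hN := fun n hn => eq_gammaRatio_of_rec (by positivity) h (n := n) hn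
  -- The error is defined by division by the main term. If that vanishes, so do `N` and `M` for `n ≥
  -- 1`.
  by_cases h0 : N 1 = 0
  · refine ⟨fun _ => 0, isBigO_zero _ _, ?_⟩
    filter_upwards [eventually_ge_atTop 1] with n hn
    have h1 := hM n hn
    rw [hN n hn, h0] at h1
    simp only [zero_div, zero_mul, abs_zero, mul_zero, zero_sub, abs_neg] at h1
    rw [h0, abs_nonpos_iff.1 h1]
    simp
  · set m : ℕ → ℝ := fun n => N 1 / (4 * Real.Gamma (1 + k / 2)) * (n : ℝ) ^ (k / 2 : ℝ) * 4 ^ n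
      with hm
    have hm0 : ∀ n : ℕ, 1 ≤ n → m n ≠ 0 := by
      intro n hn
      have hn' : (0 : ℝ) < n := by exact_mod_cast hn
      have h2 := Real.Gamma_pos_of_pos (show (0 : ℝ) < 1 + k / 2 by positivity)
      have h3 := Real.rpow_pos_of_pos hn' (k / 2 : ℝ)
      rw [hm]
      exact mul_ne_zero (mul_ne_zero (div_ne_zero h0 (by positivity)) h3.ne') (by positivity)
    refine ⟨fun n => M n / m n - 1, ?_, ?_⟩
    · have hg := gammaRatio_sub_one k
      have hbd : (fun n => gammaRatio (k / 2) n) =O[atTop] fun _ : ℕ => (1 : ℝ) := by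
        have h1 : (fun n : ℕ => (n : ℝ) ^ (-(1 / 2) : ℝ)) =O[atTop] fun _ : ℕ => (1 : ℝ) := by
          refine IsBigO.of_bound 1 ?_
          filter_upwards [eventually_ge_atTop 1] with n hn
          have hn' : (1 : ℝ) ≤ n := by exact_mod_cast hn
          rw [Real.norm_of_nonneg (by positivity), norm_one, mul_one]
          exact Real.rpow_le_one_of_one_le_of_nonpos hn' (by norm_num)
        have := (hg.trans h1).add (isBigO_refl (fun _ : ℕ => (1 : ℝ)) atTop)
        simpa using this
      have hdiff : (fun n => (M n - N n) / m n) =O[atTop]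
          fun n : ℕ => (n : ℝ) ^ (-(1 / 2) : ℝ) := by
        have h1 : (fun n => (M n - N n) / m n) =O[atTop]
            fun n : ℕ => gammaRatio (k / 2) n * (n : ℝ) ^ (-(1 / 2) : ℝ) := by
          refine IsBigO.of_bound C ?_
          filter_upwards [eventually_ge_atTop 1] with n hn
          have h2 := hM n hn
          have hn' : (0 : ℝ) < n := by exact_mod_cast hn
          have h3 : |m n| ≠ 0 := abs_ne_zero.2 (hm0 n hn)
          rw [abs_sub_comm] at h2
          rw [norm_div, Real.norm_eq_abs, Real.norm_eq_abs, div_le_iff₀ (by positivity)]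
          refine h2.trans (le_of_eq ?_)
          rw [hN n hn, norm_mul, Real.norm_eq_abs, Real.norm_of_nonneg (by positivity),
            Real.rpow_neg hn'.le, ← Real.sqrt_eq_rpow]
          change C * |m n * _| / _ = _
          rw [abs_mul]
          ring
        refine h1.trans ?_
        simpa using hbd.mul (isBigO_refl (fun n : ℕ => (n : ℝ) ^ (-(1 / 2) : ℝ)) atTop)
      refine EventuallyEq.trans_isBigO ?_ (hg.add hdiff)
      filter_upwards [eventually_ge_atTop 1] with n hn
      have h2 : N n = m n * gammaRatio (k / 2) n := hN n hn
      rw [h2]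
      have := hm0 n hn
      field_simp
      ring
    · filter_upwards [eventually_ge_atTop 1] with n hn
      have := hm0 n hn
      change M n = m n * _
      field_simp
      ring

/-! ### Euler characteristic, and cubic schemes as one-leaf maps. -/

theorem ncard_orbits_eq_sum {F : Type*} [Fintype F] (H : Subgroup (Equiv.Perm F)) :
    ((Set.range fun x : F => (MulAction.orbit H x : Set F)).ncard : ℚ) =
      ∑ x : F, 1 / ((MulAction.orbit H x).ncard : ℚ) := by
  rw [ncard_range_eq_sum]
  refine Finset.sum_congr rfl fun x _ => ?_
  congr 3
  ext y
  exact MulAction.orbit_eq_iff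

theorem sum_ite_const {F : Type*} [Fintype F] (p : F → Prop) [DecidablePred p] (a b : ℚ) :
    (∑ x, if p x then a else b) =
      Nat.card {x // p x} * a + (Nat.card F - Nat.card {x // p x}) * b := by
  rw [Finset.sum_ite, Finset.sum_const, Finset.sum_const, nsmul_eq_mul, nsmul_eq_mul]
  have h := Finset.card_filter_add_card_filter_not (s := (Finset.univ : Finset F)) p
  have h1 : (Finset.univ.filter p).card = Nat.card {x // p x} := by
    rw [Nat.card_eq_fintype_card, Fintype.card_subtype]
  rw [Finset.card_univ, ← Nat.card_eq_fintype_card, h1] at h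
  rw [h1, ← h]
  push_cast
  ring

namespace CombMap

variable {F : Type*} (M : CombMap F)

theorem vertexDegree_eq_one_iff {x : F} : M.vertexDegree x = 1 ↔ M.IsLeaf x :=
  ncard_ends_eq_one_iff M.cornerFlip_cornerFlip M.sideFlip_sideFlip M.cornerFlip_ne

theorem vertexDegree_eq_three_iff [Finite F] (hs : ∀ x, M.sideFlip x ≠ x) {x : F} :
    M.vertexDegree x = 3 ↔ ¬ M.IsLeaf x ∧ M.cornerFlip (M.sideFlip (M.cornerFlip (M.sideFlip
      (M.cornerFlip (M.sideFlip x))))) = x :=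
  ncard_ends_eq_three_iff M.cornerFlip_cornerFlip M.sideFlip_sideFlip M.cornerFlip_ne hs

theorem IsLeaf.vertex_eq {M : CombMap F} {x : F} (h : M.IsLeaf x) :
    M.vertex x = {x, M.sideFlip x} :=
  orbit_pair_of_eq M.cornerFlip_cornerFlip M.sideFlip_sideFlip h

theorem IsLeaf.cube {M : CombMap F} {x : F} (h : M.IsLeaf x) : M.cornerFlip (M.sideFlip
    (M.cornerFlip (M.sideFlip (M.cornerFlip (M.sideFlip x))))) = x := by
  rw [IsLeaf] at h
  simp [← h, M.cornerFlip_cornerFlip]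

end CombMap

theorem ncard_orbit_pair_of_cube {F : Type*} {p q : Equiv.Perm F} (hp : ∀ z, p (p z) = z)
    (hq : ∀ z, q (q z) = z) (hp' : ∀ z, p z ≠ z) (hq' : ∀ z, q z ≠ z) {x : F}
    (h : p (q (p (q (p (q x))))) = x) (hne : p x ≠ q x) :
    (MulAction.orbit (Subgroup.closure {p, q}) x).ncard = 6 := by
  classical
  have h1 : MulAction.orbit (Subgroup.closure {p, q}) x =
      ↑([x, q x, p (q x), q (p (q x)), p (q (p (q x))), p x].toFinset) := by
    rw [orbit_pair_of_cube hp hq h]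
    ext y
    simp
  rw [h1, Set.ncard_coe_finset, List.toFinset_card_of_nodup (cube_distinct hp hq hp' hq' h hne)]
  rfl

namespace CombMap

variable {F : Type*} (M : CombMap F)

theorem edge_eq (x : F) :
    M.edge x = {x, M.sideFlip x, M.endFlip x, M.endFlip (M.sideFlip x)} := by
  have e1 := M.endFlip_endFlip
  have e2 := M.sideFlip_sideFlip
  have e3 := M.endFlip_sideFlip
  ext y
  rw [edge, PairOrbit.mem_orbit_pair_iff e1 e2]
  constructor
  · refine fun H => H (fun z => z ∈ ({x, M.sideFlip x, M.endFlip x, M.endFlip (M.sideFlip x)} :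
      Set F)) (by simp) ?_ ?_
    · rintro z (rfl | rfl | rfl | rfl) <;> simp [e1]
    · rintro z (rfl | rfl | rfl | rfl) <;> simp [e2, e3]
  · rintro (rfl | rfl | rfl | rfl) P h0 h1 h2
    exacts [h0, h2 _ h0, h1 _ h0, h1 _ (h2 _ h0)]

theorem ncard_edge_of_ne {x : F} (hx : M.sideFlip x ≠ x) : (M.edge x).ncard = 4 := by
  classical
  have h1 := M.endFlip_ne x
  have h3 := M.endFlip_ne_sideFlip x
  have h4 := M.endFlip_ne (M.sideFlip x)
  have h5 := M.endFlip_ne_sideFlip (M.sideFlip x)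
  have h7 : M.endFlip x ≠ M.endFlip (M.sideFlip x) := fun h => hx (M.endFlip.injective h).symm
  rw [M.sideFlip_sideFlip] at h5
  have hnd : [x, M.sideFlip x, M.endFlip x, M.endFlip (M.sideFlip x)].Nodup := by
    simp only [List.nodup_cons, List.mem_cons, List.not_mem_nil, or_false, not_or, List.nodup_nil,
      not_false_eq_true, and_true]
    exact ⟨⟨hx.symm, h1.symm, h5.symm⟩, ⟨h3.symm, h4.symm⟩, h7⟩
  have h : M.edge x = ↑([x, M.sideFlip x, M.endFlip x, M.endFlip (M.sideFlip x)].toFinset) := by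
    rw [edge_eq]; ext y; simp
  rw [h, Set.ncard_coe_finset, List.toFinset_card_of_nodup hnd]
  rfl

theorem ncard_edge_of_eq {x : F} (hx : M.sideFlip x = x) : (M.edge x).ncard = 2 := by
  have : M.edge x = {x, M.endFlip x} := by
    rw [edge_eq, hx]; ext y; simp
  rw [this, Set.ncard_pair (M.endFlip_ne x).symm]

open Classical in
theorem numEdges_eq [Finite F] : (M.numEdges : ℚ) =
    Nat.card {x // M.OnBoundary x} * (1 / 2) +
      (Nat.card F - Nat.card {x // M.OnBoundary x}) * (1 / 4) := by
  have := Fintype.ofFinite F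
  rw [← sum_ite_const]
  refine (ncard_orbits_eq_sum (Subgroup.closure {M.endFlip, M.sideFlip})).trans
    (Finset.sum_congr rfl fun x _ => ?_)
  split_ifs with h
  · rw [show MulAction.orbit _ x = M.edge x from rfl, M.ncard_edge_of_eq h]; norm_num
  · rw [show MulAction.orbit _ x = M.edge x from rfl, M.ncard_edge_of_ne h]; norm_num

open Classical in
theorem numVertices_eq_of_cube [Finite F] (hs : ∀ x, M.sideFlip x ≠ x) (hc : ∀ x, M.cornerFlip
    (M.sideFlip (M.cornerFlip (M.sideFlip (M.cornerFlip (M.sideFlip x))))) = x) :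
    (M.numVertices : ℚ) = Nat.card {x // M.IsLeaf x} * (1 / 2) +
      (Nat.card F - Nat.card {x // M.IsLeaf x}) * (1 / 6) := by
  have := Fintype.ofFinite F
  rw [← sum_ite_const]
  refine (ncard_orbits_eq_sum (Subgroup.closure {M.cornerFlip, M.sideFlip})).trans
    (Finset.sum_congr rfl fun x _ => ?_)
  split_ifs with h
  · rw [show MulAction.orbit _ x = M.vertex x from rfl, h.vertex_eq, Set.ncard_pair (hs x).symm]
    norm_num
  · rw [ncard_orbit_pair_of_cube M.cornerFlip_cornerFlip M.sideFlip_sideFlip M.cornerFlip_ne hs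
      (hc x) h]
    norm_num

theorem numBoundaries_eq_zero_iff [Finite F] : M.numBoundaries = 0 ↔ ∀ x, M.sideFlip x ≠ x := by
  rw [numBoundaries, Finite.card_eq_zero_iff]
  constructor
  · intro h x hx
    exact h.false (Quot.mk _ ⟨x, hx⟩)
  · intro h
    refine ⟨fun q => ?_⟩
    obtain ⟨⟨x, hx⟩, -⟩ := Quot.exists_rep q
    exact h x hx

/-- A flag counts for `1/4` of an edge, and for `1/2` or `1/6` of a vertex according to whether that
is a leaf. -/
theorem eulerChar_eq_of_cube [Finite F] (hs : ∀ x, M.sideFlip x ≠ x) (hc : ∀ x, M.cornerFlip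
    (M.sideFlip (M.cornerFlip (M.sideFlip (M.cornerFlip (M.sideFlip x))))) = x) :
    12 * M.eulerChar = 4 * Nat.card {x // M.IsLeaf x} - Nat.card F + 12 * Nat.card M.Face := by
  have h1 := M.numVertices_eq_of_cube hs hc
  have h2 := M.numEdges_eq
  have h3 : Nat.card {x // M.OnBoundary x} = 0 := by
    rw [Finite.card_eq_zero_iff]
    exact ⟨fun x => hs x.1 x.2⟩
  rw [h3] at h2
  rw [eulerChar, M.numFaces_eq]
  have : (12 * ((M.numVertices : ℚ) - M.numEdges + Nat.card M.Face)) =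
      4 * Nat.card {x // M.IsLeaf x} - Nat.card F + 12 * Nat.card M.Face := by
    rw [h1, h2]
    push_cast
    ring
  exact_mod_cast this

/-- Once the numbers of leaves and faces are fixed, the Euler characteristic and the number of flags
determine each other. With one leaf, all other vertices are cubic. -/
theorem isCubicScheme_iff [Finite F] {S : Surface} {r : F} :
    (M.IsMapOn S.closure ∧ M.vertexDegree r = 1 ∧ (∀ x, x ∉ M.vertex r → M.vertexDegree x = 3) ∧
      M.numFaces = S.β) ↔ IsLeafyCubic S 1 M r := by
  have hχ : S.closure.eulerChar = S.eulerChar + S.β := by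
    simp [Surface.closure, Surface.eulerChar]
  constructor
  · rintro ⟨⟨h1, h2, h3, h4⟩, h5, h6, h7⟩
    have hs := M.numBoundaries_eq_zero_iff.1 h3
    have hr := M.vertexDegree_eq_one_iff.1 h5
    have h6' := fun x hx => (M.vertexDegree_eq_three_iff hs).1 (h6 x hx)
    rw [hr.vertex_eq] at h6'
    have hleaf : {x | M.IsLeaf x} = {r, M.sideFlip r} := by
      ext x
      refine ⟨fun hx => by_contra fun hx' => (h6' x hx').1 hx, ?_⟩
      rintro (rfl | rfl)
      exacts [hr, hr.sideFlip]
    have hcard : Nat.card {x // M.IsLeaf x} = 2 := by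
      rw [← Set.ncard_pair (hs r).symm, ← hleaf, ← Nat.card_coe_set_eq]
      rfl
    have hc : ∀ x, M.cornerFlip (M.sideFlip (M.cornerFlip (M.sideFlip (M.cornerFlip
        (M.sideFlip x))))) = x := by
      intro x
      by_cases hx : M.IsLeaf x
      · exact hx.cube
      · refine (h6' x fun hx' => hx ?_).2
        rwa [← hleaf] at hx'
    have he := M.eulerChar_eq_of_cube hs hc
    rw [M.numFaces_eq] at h7
    refine ⟨hs, (M.isConnected_iff r).1 h1, hc, hr, hcard, ?_, h7, h4⟩
    rw [hcard, h7, h2, hχ] at he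
    push_cast at he ⊢
    linarith
  · intro h
    have hs := h.side_ne
    have hcard := h.card_leaf
    have he := M.eulerChar_eq_of_cube hs h.cube
    have hF := h.card_flag
    rw [hcard, h.card_face] at he
    have hleaf : {x | M.IsLeaf x} = {r, M.sideFlip r} := by
      symm
      refine Set.eq_of_subset_of_ncard_le ?_ ?_
      · rintro x (rfl | rfl)
        exacts [h.root, h.root.sideFlip]
      · rw [Set.ncard_pair (hs r).symm, ← Nat.card_coe_set_eq]
        exact hcard.le
    refine ⟨⟨(M.isConnected_iff r).2 h.reaches, ?_, M.numBoundaries_eq_zero_iff.2 hs, h.orientable⟩,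
      M.vertexDegree_eq_one_iff.2 h.root, fun x hx => ?_, by rw [M.numFaces_eq, h.card_face]⟩
    · rw [hχ]
      push_cast at he hF
      linarith
    · rw [h.root.vertex_eq, ← hleaf] at hx
      exact (M.vertexDegree_eq_three_iff hs).2 ⟨hx, h.cube x⟩

end CombMap

theorem cubicSchemes_eq (S : Surface) : cubicSchemes S = leafyClasses S 1 := by
  ext q
  exact exists_congr fun R => and_congr_right fun _ => R.toMap.isCubicScheme_iff

/-! ### Boundary vertices and duals of maps with boundary. -/

/-- The orbit of a fixed point of one of two involutions, the other having no fixed point, is a path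
with two ends. -/
theorem ncard_fixed_orbit_pair {F : Type*} [Finite F] {p q : Equiv.Perm F} (hp : ∀ z, p (p z) = z)
    (hq : ∀ z, q (q z) = z) (hp' : ∀ z, p z ≠ z) {x : F} (hx : q x = x) :
    {y | y ∈ MulAction.orbit (Subgroup.closure {p, q}) x ∧ q y = y}.ncard = 2 := by
  set ρ : Equiv.Perm F := p * q with hρ
  have hqq : q⁻¹ = q := Equiv.ext fun z => by rw [Equiv.Perm.inv_eq_iff_eq, hq]
  have hconj : q * ρ * q⁻¹ = ρ⁻¹ := by
    rw [eq_inv_iff_mul_eq_one, hqq]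
    ext z
    simp [hρ, hp, hq]
  -- As `q` fixes `x`, the orbit consists of the points `ρ^k x`, on which `q` acts by `k ↦ -k` and
  -- `p` by `k ↦ 1 - k`.
  have hqz : ∀ k : ℤ, q ((ρ ^ k) x) = (ρ ^ (-k)) x := fun k => by
    have h := congrArg (fun g : Equiv.Perm F => (g ^ k) x) hconj
    simp only [conj_zpow, inv_zpow'] at h
    rw [← h, hqq]
    simp [hx]
  have hpz : ∀ k : ℤ, p ((ρ ^ k) x) = (ρ ^ (1 - k)) x := fun k => by
    have : p ((ρ ^ k) x) = ρ (q ((ρ ^ k) x)) := by simp [hρ, hq]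
    rw [this, hqz, sub_eq_add_neg, zpow_add, zpow_one]
    rfl
  have horb : ∀ y, y ∈ MulAction.orbit (Subgroup.closure {p, q}) x ↔ ∃ k : ℤ, y = (ρ ^ k) x := by
    intro y
    rw [PairOrbit.mem_orbit_pair_iff hp hq]
    constructor
    · refine fun H => H (fun z => ∃ k : ℤ, z = (ρ ^ k) x) ⟨0, by simp⟩ ?_ ?_
      · rintro _ ⟨k, rfl⟩; exact ⟨_, hpz k⟩
      · rintro _ ⟨k, rfl⟩; exact ⟨_, hqz k⟩
    · rintro ⟨k, rfl⟩ P h0 h1 h2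
      have h3 : ∀ z, P (ρ z) ↔ P z := fun z => by
        have e : ρ z = p (q z) := rfl
        rw [e]
        exact ⟨fun h => by simpa [hp, hq] using h2 _ (h1 _ h), fun h => h1 _ (h2 _ h)⟩
      induction k using Int.induction_on with
      | zero => simpa using h0
      | succ k ih => rw [add_comm, zpow_add, zpow_one, Equiv.Perm.mul_apply, h3]; exact ih
      | pred k ih => rw [← h3, ← Equiv.Perm.mul_apply, ← zpow_one_add, add_sub_cancel]; exact ih
  set d := Function.minimalPeriod (ρ • ·) x with hd
  have hdvd : ∀ k : ℤ, (ρ ^ k) x = x ↔ (d : ℤ) ∣ k := fun k =>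
    MulAction.zpow_smul_eq_iff_minimalPeriod_dvd (a := ρ) (b := x) (n := k)
  have hd0 : d ≠ 0 := by
    intro h0
    have := (hdvd (orderOf ρ)).1 (by rw [zpow_natCast, pow_orderOf_eq_one]; rfl)
    rw [h0, Nat.cast_zero, zero_dvd_iff] at this
    exact (orderOf_pos ρ).ne' (by exact_mod_cast this)
  have heq : ∀ j k : ℤ, (ρ ^ j) x = (ρ ^ k) x ↔ (d : ℤ) ∣ j - k := fun j k => by
    rw [← hdvd, sub_eq_neg_add, zpow_add, Equiv.Perm.mul_apply, zpow_neg, Equiv.Perm.inv_eq_iff_eq]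
  -- A fixed point of `p` would solve `2k ≡ 1` modulo the period. Their absence makes the period
  -- even, so `2k ≡ 0` has exactly two solutions.
  have hodd : ∀ k : ℤ, ¬ (d : ℤ) ∣ 1 - 2 * k := fun k h => hp' ((ρ ^ k) x) (by
    rw [hpz, heq]; convert h using 1; ring)
  obtain ⟨m, hm⟩ : ∃ m : ℕ, d = 2 * m := by
    rcases Nat.even_or_odd' d with ⟨m, h | h⟩
    · exact ⟨m, h⟩
    · exact absurd (by rw [h]; push_cast; exact ⟨1, by ring⟩) (hodd (-m))
  have hset : {y | y ∈ MulAction.orbit (Subgroup.closure {p, q}) x ∧ q y = y} =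
      {x, (ρ ^ (m : ℤ)) x} := by
    ext y
    simp only [Set.mem_ofPred_eq, horb, Set.mem_insert_iff, Set.mem_singleton_iff]
    constructor
    · rintro ⟨⟨k, rfl⟩, h⟩
      rw [hqz, heq, hm] at h
      obtain ⟨j, hj⟩ := h
      push_cast at hj
      rw [hdvd, heq, hm]
      push_cast
      have hk : k = -(m * j) := by linarith
      rcases Int.even_or_odd' j with ⟨i, rfl | rfl⟩
      · exact Or.inl ⟨-i, by rw [hk]; ring⟩
      · exact Or.inr ⟨-i - 1, by rw [hk]; ring⟩
    · rintro (rfl | rfl)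
      · exact ⟨⟨0, by simp⟩, hx⟩
      · refine ⟨⟨m, rfl⟩, ?_⟩
        rw [hqz, heq, hm]
        exact ⟨-1, by push_cast; ring⟩
  rw [hset, Set.ncard_pair]
  intro h
  have := (hdvd m).1 h.symm
  rw [hm] at this
  have h2 := Int.le_of_dvd (by omega) this
  push_cast at h2
  omega

namespace CombMap

variable {F F' : Type*} (M : CombMap F)

/-- The flags on the boundary. -/
abbrev BdFlag : Type _ := {x // M.OnBoundary x}

theorem OnBoundary.endFlip {M : CombMap F} {x : F} (h : M.OnBoundary x) :
    M.OnBoundary (M.endFlip x) := by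
  rw [OnBoundary] at h ⊢
  rw [← M.endFlip_sideFlip, h]

/-- The other flag of a boundary edge. -/
def bdFlip (b : M.BdFlag) : M.BdFlag := ⟨M.endFlip b, b.2.endFlip⟩

open Classical in
/-- The action of `endFlip` on the dual map. -/
noncomputable def dualEnd : F ⊕ M.BdFlag → F ⊕ M.BdFlag
  | .inl x => if h : M.OnBoundary x then .inr ⟨x, h⟩ else .inl (M.sideFlip x)
  | .inr b => .inl b

theorem dualEnd_of_onBoundary {x : F} (h : M.OnBoundary x) :
    M.dualEnd (.inl x) = .inr ⟨x, h⟩ := dif_pos h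

theorem dualEnd_of_not_onBoundary {x : F} (h : ¬ M.OnBoundary x) :
    M.dualEnd (.inl x) = .inl (M.sideFlip x) := dif_neg h

theorem not_onBoundary_sideFlip {x : F} (h : ¬ M.OnBoundary x) :
    ¬ M.OnBoundary (M.sideFlip x) := fun h' => h (M.sideFlip.injective h')

theorem onBoundary_endFlip_iff {x : F} : M.OnBoundary (M.endFlip x) ↔ M.OnBoundary x :=
  ⟨fun h => by simpa [M.endFlip_endFlip] using h.endFlip, fun h => h.endFlip⟩

/-- The dual of a map, with a leaf in place of every edge of the boundary. -/
noncomputable def dual : CombMap (F ⊕ M.BdFlag) :=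
  ofFun M.dualEnd (Sum.map M.cornerFlip M.bdFlip) (Sum.map M.endFlip M.bdFlip)
    (by
      rintro (x | b)
      · by_cases h : M.OnBoundary x
        · rw [M.dualEnd_of_onBoundary h]; rfl
        · rw [M.dualEnd_of_not_onBoundary h,
            M.dualEnd_of_not_onBoundary (M.not_onBoundary_sideFlip h), M.sideFlip_sideFlip]
      · exact M.dualEnd_of_onBoundary b.2)
    (by rintro (x | b) <;> simp [M.cornerFlip_cornerFlip, bdFlip, M.endFlip_endFlip])
    (by rintro (x | b) <;> simp [bdFlip, M.endFlip_endFlip])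
    (by
      rintro (x | b)
      · by_cases h : M.OnBoundary x
        · rw [M.dualEnd_of_onBoundary h, Sum.map_inl, M.dualEnd_of_onBoundary h.endFlip]; rfl
        · rw [M.dualEnd_of_not_onBoundary h, Sum.map_inl, Sum.map_inl,
            M.dualEnd_of_not_onBoundary (mt M.onBoundary_endFlip_iff.1 h), M.endFlip_sideFlip]
      · rfl)
    (by
      rintro (x | b)
      · by_cases h : M.OnBoundary x
        · rw [M.dualEnd_of_onBoundary h]; simp
        · rw [M.dualEnd_of_not_onBoundary h]; exact fun e => h (Sum.inl_injective e)
      · simp [dualEnd])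
    (by
      rintro (x | b)
      · simp [M.cornerFlip_ne]
      · exact fun e => M.endFlip_ne b (congrArg Subtype.val (Sum.inr_injective e)))
    (by
      rintro (x | b)
      · by_cases h : M.OnBoundary x
        · rw [M.dualEnd_of_onBoundary h]; simp
        · rw [M.dualEnd_of_not_onBoundary h]
          exact fun e => M.endFlip_ne_sideFlip x (Sum.inl_injective e).symm
      · simp [dualEnd])

@[simp] theorem dual_corner_inl (x : F) :
    M.dual.cornerFlip (.inl x) = .inl (M.cornerFlip x) := rfl

@[simp] theorem dual_corner_inr (b : M.BdFlag) :
    M.dual.cornerFlip (.inr b) = .inr (M.bdFlip b) := rfl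

@[simp] theorem dual_side_inl (x : F) : M.dual.sideFlip (.inl x) = .inl (M.endFlip x) := rfl

@[simp] theorem dual_side_inr (b : M.BdFlag) :
    M.dual.sideFlip (.inr b) = .inr (M.bdFlip b) := rfl

@[simp] theorem dual_end_inr (b : M.BdFlag) : M.dual.endFlip (.inr b) = .inl b.1 := rfl

theorem dual_end_bd (b : M.BdFlag) : M.dual.endFlip (.inl b.1) = .inr b :=
  M.dualEnd_of_onBoundary b.2

theorem dual_end_inl {x : F} (h : ¬ M.OnBoundary x) :
    M.dual.endFlip (.inl x) = .inl (M.sideFlip x) := M.dualEnd_of_not_onBoundary h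

theorem dual_side_ne (z : F ⊕ M.BdFlag) : M.dual.sideFlip z ≠ z := by
  rcases z with x | b
  · simp [M.endFlip_ne]
  · exact fun e => M.endFlip_ne b (congrArg Subtype.val (Sum.inr_injective e))

theorem dual_isLeaf_inr (b : M.BdFlag) : M.dual.IsLeaf (.inr b) := rfl

theorem dual_isLeaf_inl (x : F) : M.dual.IsLeaf (.inl x) ↔ M.cornerFlip x = M.endFlip x := by
  simp [IsLeaf]

theorem dual_reaches_iff (r : M.BdFlag) : M.dual.ReachesAll (.inr r) ↔ M.ReachesAll r.1 := by
  constructor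
  · intro h p h0 h1 h2 h3 z
    refine h (Sum.elim p fun b => p b.1) h0 ?_ ?_ ?_ (.inl z)
    · rintro (x | b) hz
      · by_cases hx : M.OnBoundary x
        · rw [M.dual_end_bd ⟨x, hx⟩]; exact hz
        · rw [M.dual_end_inl hx]; exact h3 _ hz
      · exact hz
    · rintro (x | b) hz
      · exact h2 _ hz
      · exact h1 _ hz
    · rintro (x | b) hz
      · exact h1 _ hz
      · exact h1 _ hz
  · intro h p h0 h1 h2 h3
    have hl : ∀ x, p (.inl x) := by
      refine h (fun x => p (.inl x)) (h1 _ h0) (fun z hz => h3 _ hz) (fun z hz => h2 _ hz)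
        fun z hz => ?_
      by_cases hx : M.OnBoundary z
      · rw [show M.sideFlip z = z from hx]; exact hz
      · rw [← M.dual_end_inl hx]; exact h1 _ hz
    rintro (x | b)
    · exact hl x
    · rw [← M.dual_end_bd b]; exact h1 _ (hl b.1)

theorem dual_isOrientable_iff : M.dual.IsOrientable ↔ M.IsOrientable := by
  constructor
  · rintro ⟨c, hc⟩
    refine ⟨fun x => c (.inl x), fun x => ⟨(hc (.inl x)).2.2 (M.dual_side_ne _), (hc (.inl x)).2.1,
      fun hx => ?_⟩⟩
    beta_reduce
    rw [← M.dual_end_inl hx]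
    exact (hc (.inl x)).1
  · rintro ⟨c, hc⟩
    -- A leaf flag takes the sign opposite to that of the boundary flag it is attached to.
    refine ⟨Sum.elim c fun b => !c b.1, ?_⟩
    rintro (x | b)
    · refine ⟨?_, (hc x).2.1, fun _ => (hc x).1⟩
      by_cases hx : M.OnBoundary x
      · rw [M.dual_end_bd ⟨x, hx⟩]; simp
      · rw [M.dual_end_inl hx]; exact (hc x).2.2 hx
    · have h1 : (!c (M.endFlip b.1)) ≠ !c b.1 := fun e => (hc b.1).1 (Bool.not_inj e)
      refine ⟨?_, h1, fun _ => h1⟩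
      simp

theorem dual_cube_iff : (∀ z, M.dual.cornerFlip (M.dual.sideFlip (M.dual.cornerFlip
      (M.dual.sideFlip (M.dual.cornerFlip (M.dual.sideFlip z))))) = z) ↔
    ∀ z, M.cornerFlip (M.endFlip (M.cornerFlip (M.endFlip (M.cornerFlip (M.endFlip z))))) = z := by
  constructor
  · intro h z
    simpa using h (.inl z)
  · rintro h (z | b)
    · simp [h]
    · simp [bdFlip, M.endFlip_endFlip]

theorem mem_vertex_iff {x y : F} : y ∈ M.vertex x ↔ ∀ P : F → Prop, P x →
    (∀ z, P z → P (M.cornerFlip z)) → (∀ z, P z → P (M.sideFlip z)) → P y :=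
  PairOrbit.mem_orbit_pair_iff M.cornerFlip_cornerFlip M.sideFlip_sideFlip

theorem vertex_eq_iff {x y : F} : M.vertex x = M.vertex y ↔ x ∈ M.vertex y :=
  MulAction.orbit_eq_iff

theorem mem_vertex_self (x : F) : x ∈ M.vertex x := MulAction.mem_orbit_self x

theorem vertex_sideFlip (x : F) : M.vertex (M.sideFlip x) = M.vertex x :=
  M.vertex_eq_iff.2 (M.mem_vertex_iff.2 fun _ h0 _ h2 => h2 _ h0)

theorem vertex_cornerFlip (x : F) : M.vertex (M.cornerFlip x) = M.vertex x :=
  M.vertex_eq_iff.2 (M.mem_vertex_iff.2 fun _ h0 h1 _ => h1 _ h0)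

theorem dual_faceOf_bd (b : M.BdFlag) : M.dual.faceOf (.inr b) = M.dual.faceOf (.inl b.1) :=
  (faceOf_endFlip M.dual (.inr b)).symm

theorem dual_faceOf_of_mem_vertex {x y : F} (h : y ∈ M.vertex x) :
    M.dual.faceOf (.inl y) = M.dual.faceOf (.inl x) := by
  refine M.mem_vertex_iff.1 h (fun z => M.dual.faceOf (.inl z) = M.dual.faceOf (.inl x)) rfl
    (fun z hz => ?_) fun z hz => ?_
  · rw [← hz, ← dual_corner_inl, faceOf_cornerFlip]
  · by_cases hx : M.OnBoundary z
    · rw [show M.sideFlip z = z from hx, hz]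
    · rw [← M.dual_end_inl hx, faceOf_endFlip, hz]

/-- Along every face, there is a vertex of degree one. -/
def EveryFaceHasLeaf (M : CombMap F) : Prop := ∀ x, ∃ z, M.faceOf z = M.faceOf x ∧ M.IsLeaf z

theorem EveryFaceHasLeaf.iso {M : CombMap F} {M' : CombMap F'} {φ : F ≃ F'} (h : IsIso M M' φ)
    (hM : M.EveryFaceHasLeaf) : M'.EveryFaceHasLeaf := by
  intro x
  obtain ⟨x, rfl⟩ := φ.surjective x
  obtain ⟨z, hz, hl⟩ := hM x
  exact ⟨φ z, by rw [← h.faceEquiv_faceOf, hz, h.faceEquiv_faceOf], (h.isLeaf_iff z).2 hl⟩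

/-- A face of the dual turns round a vertex of `M` until it meets a boundary flag, where there is a
leaf. Round an inner vertex it closes up among flags that `hne` keeps from being leaves. -/
theorem dual_everyFaceHasLeaf_iff (hne : ∀ x, M.cornerFlip x ≠ M.endFlip x) :
    M.dual.EveryFaceHasLeaf ↔ M.AllVerticesOnBoundary := by
  constructor
  · intro h x
    by_contra! hx
    obtain ⟨z, hz, hl⟩ := h (.inl x)
    have hmem := (PairOrbit.mk_eq_mk_iff M.dual.endFlip_endFlip M.dual.cornerFlip_cornerFlip).1
      hz.symm
    obtain ⟨y, -, rfl⟩ := (PairOrbit.mem_orbit_pair_iff M.dual.endFlip_endFlip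
      M.dual.cornerFlip_cornerFlip).1 hmem (fun z => ∃ y ∈ M.vertex x, z = .inl y)
      ⟨x, M.mem_vertex_self x, rfl⟩
      (by
        rintro _ ⟨y, hy, rfl⟩
        rw [M.dual_end_inl (hx y hy)]
        exact ⟨_, M.vertex_eq_iff.1 ((M.vertex_sideFlip y).trans (M.vertex_eq_iff.2 hy)), rfl⟩)
      (by
        rintro _ ⟨y, hy, rfl⟩
        exact ⟨_, M.vertex_eq_iff.1 ((M.vertex_cornerFlip y).trans (M.vertex_eq_iff.2 hy)), rfl⟩)
    exact hne y ((M.dual_isLeaf_inl y).1 hl)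
  · rintro h (x | b)
    · obtain ⟨y, hy, hb⟩ := h x
      exact ⟨.inr ⟨y, hb⟩, by rw [dual_faceOf_bd, M.dual_faceOf_of_mem_vertex hy], rfl⟩
    · exact ⟨.inr b, rfl, rfl⟩

/-- A dual face turns round a boundary vertex, then round the leaf of a boundary edge to the next
vertex, and so follows one boundary component. Since every vertex is on the boundary, there is no
other face. -/
theorem numBoundaries_eq_card_dual_face (h : M.AllVerticesOnBoundary) :
    M.numBoundaries = Nat.card M.dual.Face := by
  -- `β x` is some boundary flag at the vertex of `x`; its class does not depend on the choice.
  choose β hβ hb using h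
  let r : M.BdFlag → M.BdFlag → Prop := fun x y => (y : F) ∈ M.edge (x : F) ∨ (y : F) ∈ M.vertex x
  have hfw : ∀ x y, r x y → M.dual.faceOf (.inr x) = M.dual.faceOf (.inr y) := by
    rintro ⟨x, hx⟩ ⟨y, hy⟩ (h | h)
    · rw [edge_eq, show M.sideFlip _ = _ from hx] at h
      have : y = x ∨ y = M.endFlip x := by simpa using h
      rcases this with rfl | rfl
      · rfl
      · exact (faceOf_cornerFlip M.dual (.inr ⟨x, hx⟩)).symm
    · rw [dual_faceOf_bd, dual_faceOf_bd]
      exact (M.dual_faceOf_of_mem_vertex h).symm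
  have hE : ∀ z, Sum.elim (fun x => Quot.mk r ⟨β x, hb x⟩) (Quot.mk r) (M.dual.endFlip z) =
      Sum.elim (fun x => Quot.mk r ⟨β x, hb x⟩) (Quot.mk r) z := by
    rintro (x | b)
    · by_cases hx : M.OnBoundary x
      · rw [M.dual_end_bd ⟨x, hx⟩]
        exact Quot.sound (Or.inr (hβ x))
      · rw [M.dual_end_inl hx]
        refine Quot.sound (Or.inr ?_)
        have h1 := M.vertex_eq_iff.2 (hβ (M.sideFlip x))
        rw [vertex_sideFlip] at h1
        change β x ∈ M.vertex (β (M.sideFlip x))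
        rw [h1]
        exact hβ x
    · exact (Quot.sound (r := r) (a := b) (b := ⟨β b.1, hb b.1⟩) (Or.inr (hβ b.1))).symm
  have hC : ∀ z, Sum.elim (fun x => Quot.mk r ⟨β x, hb x⟩) (Quot.mk r) (M.dual.cornerFlip z) =
      Sum.elim (fun x => Quot.mk r ⟨β x, hb x⟩) (Quot.mk r) z := by
    rintro (x | b)
    · refine Quot.sound (Or.inr ?_)
      have h1 := M.vertex_eq_iff.2 (hβ (M.cornerFlip x))
      rw [vertex_cornerFlip] at h1
      change β x ∈ M.vertex (β (M.cornerFlip x))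
      rw [h1]
      exact hβ x
    · refine (Quot.sound (r := r) (a := b) (b := M.bdFlip b) (Or.inl ?_)).symm
      rw [edge_eq]
      simp [bdFlip]
  refine Nat.card_congr (⟨Quot.lift (fun b => M.dual.faceOf (.inr b)) hfw,
    PairOrbit.lift _ hE hC, ?_, ?_⟩ : Quot r ≃ M.dual.Face)
  · intro q
    obtain ⟨b, rfl⟩ := Quot.exists_rep q
    rfl
  · intro f
    obtain ⟨x | b, rfl⟩ := PairOrbit.mk_surjective f
    · change M.dual.faceOf (.inr ⟨β x, hb x⟩) = M.dual.faceOf (.inl x)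
      rw [dual_faceOf_bd]
      exact M.dual_faceOf_of_mem_vertex (hβ x)
    · rfl

/-- The flags at a boundary vertex form a path for `cornerFlip` and `sideFlip`, whose two ends are
its boundary flags. -/
theorem card_bdFlag [Finite F] (h : M.AllVerticesOnBoundary) :
    Nat.card M.BdFlag = 2 * M.numVertices := by
  have := Fintype.ofFinite M.BdFlag
  have h1 := ncard_range_eq_sum fun b : M.BdFlag => M.vertex b.1
  have h2 : (Set.range fun b : M.BdFlag => M.vertex b.1) = Set.range M.vertex := by
    ext s
    constructor
    · rintro ⟨b, rfl⟩; exact ⟨b.1, rfl⟩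
    · rintro ⟨x, rfl⟩
      obtain ⟨y, hy, hb⟩ := h x
      exact ⟨⟨y, hb⟩, M.vertex_eq_iff.2 hy⟩
  have h3 : ∀ b : M.BdFlag, {b' : M.BdFlag | M.vertex b'.1 = M.vertex b.1}.ncard = 2 := by
    intro b
    rw [← ncard_fixed_orbit_pair M.cornerFlip_cornerFlip M.sideFlip_sideFlip M.cornerFlip_ne b.2,
      ← Set.ncard_image_of_injective _ Subtype.val_injective]
    congr 1
    ext y
    constructor
    · rintro ⟨b', hb', rfl⟩
      exact ⟨M.vertex_eq_iff.1 hb', b'.2⟩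
    · rintro ⟨hy, hb⟩
      exact ⟨⟨y, hb⟩, M.vertex_eq_iff.2 hy, rfl⟩
  simp only [h3, h2, Finset.sum_const, Finset.card_univ, nsmul_eq_mul,
    ← Nat.card_eq_fintype_card] at h1
  change (M.numVertices : ℚ) = _ at h1
  have h4 : (Nat.card M.BdFlag : ℚ) = 2 * M.numVertices := by rw [h1]; push_cast; ring
  exact_mod_cast h4

end CombMap

/-! ### Triangular maps as duals of leafy cubic maps. -/

namespace CombMap

variable {F F' : Type*}

theorem faceDegree_eq_three_iff [Finite F] (M : CombMap F) {x : F} :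
    M.faceDegree x = 3 ↔ M.cornerFlip x ≠ M.endFlip x ∧ M.cornerFlip (M.endFlip (M.cornerFlip
      (M.endFlip (M.cornerFlip (M.endFlip x))))) = x := by
  rw [← ncard_ends_eq_three_iff M.cornerFlip_cornerFlip M.endFlip_endFlip M.cornerFlip_ne
    M.endFlip_ne, Set.pair_comm M.cornerFlip M.endFlip]
  rfl

theorem numFaces_of_isTriangular [Finite F] (M : CombMap F) (h : M.IsTriangular) :
    Nat.card F = 6 * M.numFaces := by
  have := Fintype.ofFinite F
  have h1 := ncard_orbits_eq_sum (Subgroup.closure {M.endFlip, M.cornerFlip})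
  have h2 : ∀ x : F, (MulAction.orbit (Subgroup.closure {M.endFlip, M.cornerFlip}) x).ncard = 6 := by
    intro x
    obtain ⟨h3, h4⟩ := M.faceDegree_eq_three_iff.1 (h x)
    rw [Set.pair_comm]
    exact ncard_orbit_pair_of_cube M.cornerFlip_cornerFlip M.endFlip_endFlip M.cornerFlip_ne
      M.endFlip_ne h4 h3
  simp only [h2, Finset.sum_const, Finset.card_univ, nsmul_eq_mul, ← Nat.card_eq_fintype_card] at h1
  change (M.numFaces : ℚ) = _ at h1
  have h4 : (Nat.card F : ℚ) = 6 * M.numFaces := by rw [h1]; push_cast; ring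
  exact_mod_cast h4

theorem dual_card_leaf [Finite F] (M : CombMap F) (hne : ∀ x, M.cornerFlip x ≠ M.endFlip x) :
    Nat.card {z // M.dual.IsLeaf z} = Nat.card M.BdFlag :=
  Nat.card_congr (Equiv.symm (Equiv.ofBijective
    (fun b : M.BdFlag => (⟨.inr b, M.dual_isLeaf_inr b⟩ : {z // M.dual.IsLeaf z}))
    ⟨fun a b h => Sum.inr_injective (congrArg Subtype.val h), by
      rintro ⟨x | b, h⟩
      · exact absurd ((M.dual_isLeaf_inl x).1 h) (hne x)
      · exact ⟨b, rfl⟩⟩))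

theorem eulerChar_of_isTriangular [Finite F] (M : CombMap F) (h : M.IsTriangular)
    (hv : M.AllVerticesOnBoundary) :
    12 * M.eulerChar = 6 * M.numVertices - Nat.card F := by
  have h1 := M.numEdges_eq
  have h2 := M.numFaces_of_isTriangular h
  have h3 := M.card_bdFlag hv
  rw [h3] at h1
  have h4 : (12 * ((M.numVertices : ℚ) - M.numEdges + M.numFaces)) =
      6 * M.numVertices - Nat.card F := by
    rw [h1, h2]
    push_cast
    ring
  rw [eulerChar]
  exact_mod_cast h4

/-- With `n` vertices, Euler's formula gives `6n - 12χ` flags, and the leaves of the dual add `2n`,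
which makes the prescribed `8n - 12χ`. -/
theorem isTriangularMap_iff_dual [Finite F] (M : CombMap F) {S : Surface} {n : ℕ} (r : M.BdFlag) :
    (M.IsMapOn S ∧ M.IsTriangular ∧ M.AllVerticesOnBoundary ∧ M.numVertices = n) ↔
      IsLeafyCubic S n M.dual (.inr r) ∧ M.dual.EveryFaceHasLeaf ∧
        ∀ x, M.cornerFlip x ≠ M.endFlip x := by
  have hcard : Nat.card (F ⊕ M.BdFlag) = Nat.card F + Nat.card M.BdFlag := Nat.card_sum
  constructor
  · rintro ⟨⟨h1, h2, h3, h4⟩, ht, hv, rfl⟩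
    have hne : ∀ x, M.cornerFlip x ≠ M.endFlip x := fun x => (M.faceDegree_eq_three_iff.1 (ht x)).1
    have hbd := M.card_bdFlag hv
    have he := M.eulerChar_of_isTriangular ht hv
    refine ⟨⟨M.dual_side_ne, (M.dual_reaches_iff r).2 ((M.isConnected_iff _).1 h1),
      M.dual_cube_iff.2 fun x => (M.faceDegree_eq_three_iff.1 (ht x)).2, M.dual_isLeaf_inr r, ?_, ?_,
      ?_, ?_⟩, (M.dual_everyFaceHasLeaf_iff hne).2 hv, hne⟩
    · rw [M.dual_card_leaf hne, hbd]
    · rw [hcard, hbd, ← h2]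
      push_cast
      linarith
    · rw [← M.numBoundaries_eq_card_dual_face hv, h3]
    · rw [M.dual_isOrientable_iff, h4]
  · rintro ⟨h, hf, hne⟩
    have hv := (M.dual_everyFaceHasLeaf_iff hne).1 hf
    have ht : M.IsTriangular := fun x =>
      M.faceDegree_eq_three_iff.2 ⟨hne x, M.dual_cube_iff.1 h.cube x⟩
    have hbd := M.card_bdFlag hv
    have he := M.eulerChar_of_isTriangular ht hv
    have hl := h.card_leaf
    rw [M.dual_card_leaf hne, hbd] at hl
    have hn : M.numVertices = n := by omega
    have hF := h.card_flag
    rw [hcard, hbd, hn] at hF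
    rw [hn] at he
    refine ⟨⟨(M.isConnected_iff r.1).2 ((M.dual_reaches_iff r).1 h.reaches), ?_, ?_, ?_⟩, ht, hv, hn⟩
    · push_cast at hF
      linarith
    · rw [M.numBoundaries_eq_card_dual_face hv, h.card_face]
    · rw [← M.dual_isOrientable_iff, h.orientable]

theorem IsIso.onBoundary_iff {M : CombMap F} {M' : CombMap F'} {φ : F ≃ F'} (h : IsIso M M' φ)
    (x : F) : M.OnBoundary x ↔ M'.OnBoundary (φ x) := by
  rw [OnBoundary, OnBoundary, ← h.map_side, φ.apply_eq_iff_eq]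

theorem IsIso.dual {M : CombMap F} {M' : CombMap F'} {φ : F ≃ F'} (h : IsIso M M' φ) :
    IsIso M.dual M'.dual (Equiv.sumCongr φ (φ.subtypeEquiv h.onBoundary_iff)) where
  map_end := by
    rintro (x | b)
    · by_cases hx : M.OnBoundary x
      · rw [M.dual_end_bd ⟨x, hx⟩]
        exact (M'.dual_end_bd ⟨φ x, (h.onBoundary_iff x).1 hx⟩).symm
      · rw [M.dual_end_inl hx]
        have hx' := mt (h.onBoundary_iff x).2 hx
        exact (congrArg Sum.inl (h.map_side x)).trans (M'.dual_end_inl hx').symm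
    · rfl
  map_corner := by
    rintro (x | b)
    · exact congrArg Sum.inl (h.map_corner x)
    · exact congrArg Sum.inr (Subtype.ext (h.map_end b.1))
  map_side := by
    rintro (x | b)
    · exact congrArg Sum.inl (h.map_end x)
    · exact congrArg Sum.inr (Subtype.ext (h.map_end b.1))

/-- Without faces of degree one, the added flags are exactly the leaf flags of the dual.
Isomorphisms of duals preserve them, hence restrict. -/
theorem pointedIso_dual_iff {M : CombMap F} {M' : CombMap F'} {r : M.BdFlag} {r' : M'.BdFlag}
    (hne : ∀ x, M.cornerFlip x ≠ M.endFlip x) (hne' : ∀ x, M'.cornerFlip x ≠ M'.endFlip x) :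
    PointedIso M.dual (.inr r) M'.dual (.inr r') ↔ PointedIso M r.1 M' r'.1 := by
  constructor
  · rintro ⟨Φ, h, hr⟩
    have key : ∀ {M : CombMap F} {M' : CombMap F'} {Φ : F ⊕ M.BdFlag ≃ F' ⊕ M'.BdFlag},
        IsIso M.dual M'.dual Φ → (∀ x, M'.cornerFlip x ≠ M'.endFlip x) →
        ∀ b, (Φ (.inr b)).isRight := by
      intro M M' Φ h hne b
      have := (h.isLeaf_iff (.inr b)).2 (M.dual_isLeaf_inr b)
      rcases hz : Φ (.inr b) with x | b'
      · rw [hz, dual_isLeaf_inl] at this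
        exact absurd this (hne x)
      · rfl
    have key' : ∀ b, (Φ.symm (.inr b)).isRight := by
      intro b
      have := (h.symm.isLeaf_iff (.inr b)).2 (M'.dual_isLeaf_inr b)
      rcases hz : Φ.symm (.inr b) with x | b'
      · rw [hz, dual_isLeaf_inl] at this
        exact absurd this (hne x)
      · rfl
    obtain ⟨φ, hφ⟩ := Equiv.exists_inl_eq_of_isRight Φ (key h hne') key'
    refine ⟨φ, ⟨fun x => ?_, fun x => ?_, fun x => ?_⟩, ?_⟩
    · have := h.map_side (.inl x)
      rw [dual_side_inl, hφ, hφ, dual_side_inl] at this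
      exact Sum.inl_injective this
    · have := h.map_corner (.inl x)
      rw [dual_corner_inl, hφ, hφ, dual_corner_inl] at this
      exact Sum.inl_injective this
    · have h1 := h.map_end (.inl x)
      rw [hφ] at h1
      by_cases hx : M.OnBoundary x
      · rw [M.dual_end_bd ⟨x, hx⟩] at h1
        have h2 := key h hne' ⟨x, hx⟩
        by_cases hx' : M'.OnBoundary (φ x)
        · rw [show M.sideFlip x = x from hx, show M'.sideFlip (φ x) = φ x from hx']
        · rw [M'.dual_end_inl hx'] at h1
          rw [h1] at h2
          simp at h2
      · rw [M.dual_end_inl hx, hφ] at h1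
        by_cases hx' : M'.OnBoundary (φ x)
        · rw [M'.dual_end_bd ⟨φ x, hx'⟩] at h1
          simp at h1
        · rw [M'.dual_end_inl hx'] at h1
          exact Sum.inl_injective h1
    · have h1 := h.map_end (.inr r)
      rw [hr, dual_end_inr, dual_end_inr, hφ] at h1
      exact Sum.inl_injective h1
  · rintro ⟨φ, h, hr⟩
    exact ⟨_, h.dual, congrArg Sum.inr (Subtype.ext hr)⟩

open Classical in
/-- Every leafy cubic map is the dual of a map, without the flags at the leaves. -/
theorem exists_pointedIso_dual {M : CombMap F} {r : F} (hs : ∀ x, M.sideFlip x ≠ x)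
    (hl : ∀ x, M.IsLeaf x → ¬ M.IsLeaf (M.endFlip x)) (hr : M.IsLeaf r) :
    ∃ (s : Set F) (M₀ : CombMap s) (r₀ : M₀.BdFlag), (∀ x, M₀.cornerFlip x ≠ M₀.endFlip x) ∧
      PointedIso M₀.dual (.inr r₀) M r := by
  let s : Set F := {x | ¬ M.IsLeaf x}
  have e1 := M.endFlip_endFlip
  have e2 := M.sideFlip_sideFlip
  have lS : ∀ x, M.IsLeaf (M.sideFlip x) ↔ M.IsLeaf x := fun x =>
    ⟨fun h => by simpa [e2] using h.sideFlip, fun h => h.sideFlip⟩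
  have lC : ∀ x, M.IsLeaf (M.cornerFlip x) → M.IsLeaf x := fun x h => by
    have h1 := h
    rw [IsLeaf, M.cornerFlip_cornerFlip] at h1
    rw [h1]
    exact h.sideFlip
  -- The new `sideFlip`: an edge that ended at a leaf becomes the dual of a boundary edge, so its
  -- remaining flags are fixed.
  let f : F → F := fun x => if M.IsLeaf (M.endFlip x) then x else M.endFlip x
  have f1 : ∀ x, M.IsLeaf (M.endFlip x) → f x = x := fun x h => if_pos h
  have f2 : ∀ x, ¬ M.IsLeaf (M.endFlip x) → f x = M.endFlip x := fun x h => if_neg h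
  have hfs : ∀ x ∈ s, f x ∈ s := fun x hx => by
    by_cases h : M.IsLeaf (M.endFlip x)
    · rw [f1 x h]; exact hx
    · rw [f2 x h]; exact h
  have hff : ∀ x ∈ s, f (f x) = x := fun x hx => by
    by_cases h : M.IsLeaf (M.endFlip x)
    · rw [f1 x h, f1 x h]
    · rw [f2 x h, f2 _ (by rw [e1]; exact hx), e1]
  have hfe : ∀ x, M.sideFlip (f x) = f (M.sideFlip x) := fun x => by
    have h0 : M.IsLeaf (M.endFlip (M.sideFlip x)) ↔ M.IsLeaf (M.endFlip x) := by
      rw [M.endFlip_sideFlip, lS]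
    by_cases h : M.IsLeaf (M.endFlip x)
    · rw [f1 x h, f1 _ (h0.2 h)]
    · rw [f2 x h, f2 _ (mt h0.1 h), M.endFlip_sideFlip]
  have hne : ∀ x, M.sideFlip x ≠ f x := fun x => by
    by_cases h : M.IsLeaf (M.endFlip x)
    · rw [f1 x h]; exact hs x
    · rw [f2 x h]; exact (M.endFlip_ne_sideFlip x).symm
  let M₀ : CombMap s := ofFun (fun x => ⟨M.sideFlip x, mt (lS _).1 x.2⟩)
    (fun x => ⟨M.cornerFlip x, mt (lC _) x.2⟩) (fun x => ⟨f x, hfs x x.2⟩)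
    (fun x => Subtype.ext (e2 x)) (fun x => Subtype.ext (M.cornerFlip_cornerFlip x))
    (fun x => Subtype.ext (hff x x.2)) (fun x => Subtype.ext (hfe x))
    (fun x e => hs x (congrArg Subtype.val e))
    (fun x e => M.cornerFlip_ne x (congrArg Subtype.val e))
    (fun x e => hne x (congrArg Subtype.val e))
  have hbd : ∀ x : s, M₀.OnBoundary x ↔ M.IsLeaf (M.endFlip x) := fun x => by
    constructor
    · intro h
      by_contra h'
      have h1 : f x = x := congrArg Subtype.val h
      rw [f2 _ h'] at h1
      exact M.endFlip_ne x h1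
    · exact fun h => Subtype.ext (f1 x h)
  have hbij : Function.Bijective (Sum.elim (Subtype.val : s → F)
      fun b : M₀.BdFlag => M.endFlip b.1) := by
    refine ⟨Subtype.val_injective.sumElim (fun a b h => Subtype.ext (Subtype.ext
      (M.endFlip.injective h))) fun x b h => x.2 (h ▸ (hbd _).1 b.2), fun z => ?_⟩
    by_cases hz : M.IsLeaf z
    · have hz' : (⟨M.endFlip z, hl z hz⟩ : s) ∈ {x | M₀.OnBoundary x} :=
        (hbd _).2 (by rw [e1]; exact hz)
      exact ⟨.inr ⟨_, hz'⟩, e1 z⟩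
    · exact ⟨.inl ⟨z, hz⟩, rfl⟩
  have hr₀ : M₀.OnBoundary ⟨M.endFlip r, hl r hr⟩ := (hbd _).2 (by rw [e1]; exact hr)
  refine ⟨s, M₀, ⟨_, hr₀⟩, fun x e => x.2 (congrArg Subtype.val e), Equiv.ofBijective _ hbij,
    ⟨?_, ?_, ?_⟩, e1 r⟩
  · rintro (x | b)
    · by_cases hx : M₀.OnBoundary x
      · rw [M₀.dual_end_bd ⟨x, hx⟩]; rfl
      · rw [M₀.dual_end_inl hx]
        exact f2 x.1 (mt (hbd x).2 hx)
    · exact (e1 _).symm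
  · rintro (x | b)
    · rfl
    · have h1 : M.IsLeaf (M.endFlip b.1) := (hbd _).1 b.2
      change M.endFlip (M.sideFlip b.1) = M.cornerFlip (M.endFlip b.1)
      rw [h1, M.endFlip_sideFlip]
  · rintro (x | b)
    · rfl
    · exact M.endFlip_sideFlip b.1

end CombMap

/-! ### The bijection on classes and the conclusion. -/

/-- The classes of leafy cubic maps all of whose faces have a leaf. -/
def fullLeafyClasses (S : Surface) (n : ℕ) : Set (Quotient RootedMap.setoid) :=
  classes fun R => IsLeafyCubic S n R.toMap R.root ∧ R.toMap.EveryFaceHasLeaf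

theorem exists_bijOn_triangularMaps {S : Surface} (hS : S.eulerChar ≤ 0) (n : ℕ) :
    ∃ f, Set.BijOn f (triangularMaps S n) (fullLeafyClasses S n) := by
  let P : RootedMap → Prop := fun R => R.toMap.IsMapOn S ∧ R.IsBoundaryRooted ∧
    R.toMap.IsTriangular ∧ R.toMap.AllVerticesOnBoundary ∧ R.toMap.numVertices = n
  have hP : ∀ (R : RootedMap) (h : R.IsBoundaryRooted), P R ↔
      IsLeafyCubic S n R.toMap.dual (.inr ⟨R.root, h⟩) ∧ R.toMap.dual.EveryFaceHasLeaf ∧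
        ∀ x, R.toMap.cornerFlip x ≠ R.toMap.endFlip x := by
    intro R h
    rw [← R.toMap.isTriangularMap_iff_dual ⟨R.root, h⟩]
    exact ⟨fun h' => ⟨h'.1, h'.2.2⟩, fun h' => ⟨h'.1, h, h'.2⟩⟩
  refine bijOn_classes (P := P) (fun R h => ofMap R.toMap.dual (.inr ⟨R.root, h.2.1⟩)) ?_ ?_ ?_
  · intro R h
    obtain ⟨h1, h2, -⟩ := (hP R h.2.1).1 h
    obtain ⟨φ, hφ, -⟩ := pointedIso_ofMap R.toMap.dual (.inr ⟨R.root, h.2.1⟩)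
    exact ⟨h1.iso (pointedIso_ofMap _ _), h2.iso hφ⟩
  · intro R R' h h'
    rw [ofMap_eq_iff, iso_iff]
    exact pointedIso_dual_iff ((hP R h.2.1).1 h).2.2 ((hP R' h'.2.1).1 h').2.2
  · rintro R' ⟨h1, h2⟩
    -- The root is at a leaf, so there is at least one; no edge then joins two leaves.
    have hn : n ≠ 0 := by
      rintro rfl
      have := h1.card_leaf
      rw [mul_zero, Finite.card_eq_zero_iff] at this
      exact this.false ⟨_, h1.root⟩
    obtain ⟨n, rfl⟩ := Nat.exists_eq_succ_of_ne_zero hn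
    obtain ⟨s, M₀, r₀, hne, hiso⟩ := exists_pointedIso_dual h1.side_ne
      (fun x hx => h1.not_isLeaf_endFlip hS hx) h1.root
    obtain ⟨φ, hφ, hr⟩ := pointedIso_ofMap M₀ r₀.1
    have hbd : (ofMap M₀ r₀.1).IsBoundaryRooted := by
      rw [RootedMap.IsBoundaryRooted, ← hr]
      exact (hφ.onBoundary_iff _).1 r₀.2
    have hiso' : PointedIso M₀.dual (.inr r₀) (ofMap M₀ r₀.1).toMap.dual
        (.inr ⟨(ofMap M₀ r₀.1).root, hbd⟩) := ⟨_, hφ.dual, congrArg Sum.inr (Subtype.ext hr)⟩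
    have hR : P (ofMap M₀ r₀.1) := by
      rw [hP _ hbd]
      refine ⟨h1.iso (hiso.symm.trans hiso'), ?_, fun x => ?_⟩
      · obtain ⟨ψ, hψ, -⟩ := hiso.symm.trans hiso'
        exact h2.iso hψ
      · obtain ⟨x, rfl⟩ := φ.surjective x
        rw [← hφ.map_corner, ← hφ.map_end]
        exact fun e => hne x (φ.injective e)
    refine ⟨_, hR, ?_⟩
    rw [← ofMap_toMap R', ofMap_eq_iff]
    exact hiso'.symm.trans hiso

theorem fullLeafyClasses_subset (S : Surface) (n : ℕ) : fullLeafyClasses S n ⊆ leafyClasses S n := by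
  rintro q ⟨R, hR, h, -⟩
  exact ⟨R, hR, h⟩

/-- At `y = 1` the weight is the number of leafless faces, which is at least one in each map
excluded. -/
theorem ncard_leafyClasses_sdiff_le (S : Surface) (n : ℕ) :
    ((leafyClasses S n \ fullLeafyClasses S n).ncard : ℝ) ≤ totalWeight S n 1 := by
  classical
  have h1 : ∀ q : leafyClasses S n, q.1 ∉ fullLeafyClasses S n →
      1 ≤ q.1.out.toMap.leaflessWeight 1 := by
    intro q hq
    have h2 : ¬ q.1.out.toMap.EveryFaceHasLeaf := fun h =>
      hq ⟨q.1.out, Quotient.out_eq _, isLeafyCubic_out q, h⟩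
    simp only [EveryFaceHasLeaf, not_forall, not_exists, not_and] at h2
    obtain ⟨x, hx⟩ := h2
    exact one_le_leaflessWeight_one hx
  have h2 : (leafyClasses S n \ fullLeafyClasses S n).ncard =
      (Finset.univ.filter fun q : leafyClasses S n => q.1 ∉ fullLeafyClasses S n).card := by
    rw [← Set.ncard_coe_finset, ← Set.ncard_image_of_injective _ Subtype.val_injective]
    congr 1
    ext q
    simp [and_comm]
  rw [h2, Finset.card_eq_sum_ones, Nat.cast_sum, totalWeight, Finset.sum_filter]
  refine Finset.sum_le_sum fun q _ => ?_
  split_ifs with hq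
  · exact Finset.sum_nonneg fun f _ => by split_ifs <;> positivity
  · exact_mod_cast h1 q hq

theorem Surface.eulerChar_nonpos {S : Surface} (hβ : 1 ≤ S.β) (hS : S ≠ Surface.disc) :
    S.eulerChar ≤ 0 := by
  obtain ⟨c, β⟩ := S
  rcases c with g | k
  · simp only [Surface.eulerChar, ClosedSurface.eulerChar] at *
    by_contra! h
    obtain rfl : g = 0 := by omega
    obtain rfl : β = 1 := by omega
    exact hS rfl
  · have := k.pos
    simp only [Surface.eulerChar, ClosedSurface.eulerChar] at *
    omega

theorem mainTheorem4 (S : Surface) (hboundary : 1 ≤ S.β) (hdisc : S ≠ Surface.disc) :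
    (cubicSchemes S).Finite ∧ (∀ n : ℕ, (triangularMaps S n).Finite) ∧
    ∃ ε : ℕ → ℝ, ε =O[atTop] (fun n : ℕ => (n : ℝ) ^ (-(1 / 2) : ℝ)) ∧
      ∀ᶠ n : ℕ in atTop,
        ((triangularMaps S n).ncard : ℝ) =
          ((cubicSchemes S).ncard : ℝ) / (4 * Real.Gamma (1 - 3 * (S.eulerChar : ℝ) / 2)) *
            (n : ℝ) ^ (-3 * (S.eulerChar : ℝ) / 2) * (4 : ℝ) ^ n * (1 + ε n) := by
  have hS := Surface.eulerChar_nonpos hboundary hdisc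
  have hfin : ∀ n, (fullLeafyClasses S n).Finite := fun n =>
    (leafyClasses_finite S n).subset (fullLeafyClasses_subset S n)
  have hcard : ∀ n, (Fintype.card (leafyClasses S n) : ℝ) = ((leafyClasses S n).ncard : ℝ) :=
    fun n => by rw [← Nat.card_coe_set_eq, Nat.card_eq_fintype_card]
  refine ⟨cubicSchemes_eq S ▸ leafyClasses_finite S 1, fun n => ?_, ?_⟩
  · obtain ⟨f, hf⟩ := exists_bijOn_triangularMaps hS n
    exact hf.finite_iff_finite.2 (hfin n)
  have htri : ∀ n, (triangularMaps S n).ncard = (fullLeafyClasses S n).ncard := fun n => by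
    obtain ⟨f, hf⟩ := exists_bijOn_triangularMaps hS n
    rw [← hf.image_eq, hf.injOn.ncard_image]
  -- The exponent is the half-integer `k / 2`, with `k` natural because `χ ≤ 0`.
  obtain ⟨k, hk⟩ : ∃ k : ℕ, (k : ℝ) = -3 * S.eulerChar := by
    refine ⟨(-3 * S.eulerChar).toNat, ?_⟩
    have : (((-3 * S.eulerChar).toNat : ℕ) : ℤ) = -3 * S.eulerChar := Int.toNat_of_nonneg (by omega)
    exact_mod_cast this
  obtain ⟨ε, hε, h⟩ := exists_error_term (N := fun n => ((leafyClasses S n).ncard : ℝ))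
    (M := fun n => ((triangularMaps S n).ncard : ℝ)) (k := k)
    -- The constant of `totalWeight_one_le`.
    (C := S.β * (2 * √(flagCount S 1))) (fun n _ => by
      have := card_leafyClasses_succ hS n
      rw [hcard, hcard] at this
      rw [hk]
      linear_combination this / 2) (fun n hn => by
      have h1 := (ncard_leafyClasses_sdiff_le S n).trans (totalWeight_one_le hS hn)
      have h2 := Set.ncard_sdiff_add_ncard_of_subset (fullLeafyClasses_subset S n)
        (leafyClasses_finite S n)
      have h3 : ((leafyClasses S n).ncard : ℝ) - ((triangularMaps S n).ncard : ℝ) =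
          ((leafyClasses S n \ fullLeafyClasses S n).ncard : ℝ) := by
        rw [htri, ← h2]; push_cast; ring
      rw [h3, abs_of_nonneg (by positivity), abs_of_nonneg (by positivity)]
      refine h1.trans (le_of_eq ?_)
      rw [hcard]
      ring)
  refine ⟨ε, hε, h.mono fun n hn => ?_⟩
  rw [cubicSchemes_eq]
  simp only [hk] at hn
  rw [hn, show (1 : ℝ) - 3 * S.eulerChar / 2 = 1 + -3 * S.eulerChar / 2 by ring]
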